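/- Let $p$ be a prime and let $A$ be a Dedekind domain, not a field, that is finitely generated as an $\mathbb F_p$-algebra (for instance the ring $\mathcal O_C(C\setminus\{\infty\})$ of functions on a smooth projective curve $C$ over $\mathbb F_p$ that are regular away from a closed point $\infty$). Let $K=\operatorname{Frac}A$, let $L$ be a finite extension of $K$, $L^s$ a separable closure of $L$, $G_L=\operatorname{Gal}(L^s/L)$, and $\mathcal O_L$ the integral closure of $A$ in $L$. *Definitions.* An *$A$-module scheme* over $L$ is a functor $\mathbf G$ from commutative $L$-algebras to $A$-modules that is represented by the points of an $L$-scheme. Its *characteristic morphism* is the unique ring homomorphism $\delta_{\mathbf G}:A\to L$ (when it exists; it does if $\mathbf G$ is smooth of dimension $1$) such that every $a\in A$ acts on $\operatorname{Lie}_{\mathbf G}(L)=\ker(\mathbf G(L[\varepsilon]/\varepsilon^2)\to\mathbf G(L))$ as the multiplication by the scalar $\delta_{\mathbf G}(a)$. For a maximal ideal $\ell$ of $A$, $\operatorname T_\ell\mathbf G=\varprojlim_n\mathbf G[\ell^n](L^s)$, the transition maps being the multiplication by a fixed $\pi\in\ell\setminus\ell^2$; up to isomorphism it does not depend on $\pi$.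 It is a module over the completion $A_\ell$ with an $A_\ell$-linear action of $G_L$. For an integer $r\ge 1$, $\mathbf G$ is *of rank $r$* if $\operatorname T_\ell\mathbf G$ is free of rank $r$ over $A_\ell$ for every maximal ideal $\ell\ne\ker\delta_{\mathbf G}$ of $A$. Suppose that $\mathbf G$ is of finite type, connected and smooth of dimension $1$ over $L$, and of rank $r$. It is an *elementary module of rank $r$ of type (1)* if $\delta_{\mathbf G}$ is the inclusion $A\subset L$. It is an *elementary module of rank $r$ of type (2)* if there is a finite set $S$ of maximal ideals of $\mathcal O_L$ such that for every maximal ideal $\mathfrak P\notin S$ of $\mathcal O_L$: (a) for every maximal ideal $\ell\ne\mathfrak P\cap A$ of $A$, the inertia groups at $\mathfrak P$ act trivially on $\operatorname T_\ell\mathbf G$; (b) there is $s(\mathfrak P)\in A$ such that for every maximal ideal $\ell\neq\mathfrak P\cap A$ of $A$, the determinant of the (arithmetic) Frobenius at $\mathfrak P$ acting on $\operatorname T_\ell\mathbf G$ is $s(\mathfrak P)$. A *Drinfeld $A$-module of rank $r$* over $L$ is an $A$-module scheme $E$ over $L$ that is isomorphic to $\mathbf G_a$ as a group scheme over $L$ and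 for which the $A\otimes_{\mathbb F_p}L$-module $M(E)=\operatorname{Hom}_{\mathrm{grp}/L}(E,\mathbf G_a)$ is locally free of (finite) rank $r$. It is *generic* if $\delta_E$ is the inclusion $A\subset L$. **Proposition.** Let $E$ be a Drinfeld $A$-module of rank $r$ over $L$. 1. If $E$ is generic then, as an $A$-module scheme, $E$ is an elementary module of rank $r$ both of type (1) and of type (2). 2. If there is an integer $k\ge 0$ such that $\delta_E(a)=a^{p^k}$ for all $a\in A$, then $E$ is an elementary module of rank $r$ of type (2). -/

import Mathlib

open CategoryTheory AlgebraicGeometry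
open scoped TensorProduct

universe u w

noncomputable section

/-! ### `A`-module schemes over a field `L` -/

/-- The `R`-points over `L` of an `L`-scheme `s : X ⟶ Spec L`. -/
def RelativePoints {L : Type u} [Field L] {X : Scheme.{u}}
    (s : X ⟶ Spec (CommRingCat.of L)) (R : CommAlgCat.{u} L) : Type u :=
  {g : Spec (CommRingCat.of R) ⟶ X //
    g ≫ s = Spec.map (CommRingCat.ofHom (algebraMap L R))}

/-- An `A`-module scheme over `L`: a functor from commutative `L`-algebras to `A`-modules,
whose underlying functor to sets is represented by the points of an `L`-scheme. -/
structure AModuleScheme (A : Type w) [CommRing A] (L : Type u) [Field L] where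
  /-- the functor of points, with values in `A`-modules -/
  functor : CommAlgCat.{u} L ⥤ ModuleCat.{u} A
  /-- the underlying scheme -/
  scheme : Scheme.{u}
  /-- its structure morphism to `Spec L` -/
  toSpec : scheme ⟶ Spec (CommRingCat.of L)
  /-- the elements of the module at `R` are the `R`-points of the scheme -/
  points (R : CommAlgCat.{u} L) : functor.obj R ≃ RelativePoints toSpec R
  points_map {R S : CommAlgCat.{u} L} (f : R ⟶ S) (x : functor.obj R) :
    (points S ((functor.map f).hom x)).1 =
      Spec.map (CommRingCat.ofHom f.hom.toRingHom) ≫ (points R x).1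

namespace AModuleScheme

variable {A : Type w} [CommRing A] {L : Type u} [Field L]

/-- The `A`-module `G(R)`, for a commutative `L`-algebra `R`. -/
abbrev Pts (G : AModuleScheme A L) (R : Type u) [CommRing R] [Algebra L R] : Type u :=
  G.functor.obj (CommAlgCat.of L R)

/-- The `A`-linear map `G(R) → G(S)` induced by a homomorphism `R → S` of `L`-algebras. -/
def ptsMap (G : AModuleScheme A L) {R S : Type u} [CommRing R] [Algebra L R]
    [CommRing S] [Algebra L S] (f : R →ₐ[L] S) : G.Pts R →ₗ[A] G.Pts S :=
  (G.functor.map (CommAlgCat.ofHom f)).hom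

/-! ### The tangent action and the characteristic morphism -/

/-- The tangent space `Lie_G(L)`, the kernel of `G(L[ε]) → G(L)`, `ε ↦ 0`. -/
def lie (G : AModuleScheme A L) : Submodule A (G.Pts (DualNumber L)) :=
  LinearMap.ker (G.ptsMap (TrivSqZeroExt.fstHom L L L))

/-- Multiplication by the scalar `l : L` on `G(L[ε])`, induced by `a + ε b ↦ a + ε l b`
(it is used on the submodule `Lie_G(L)`). -/
def lieScale (G : AModuleScheme A L) (l : L) :
    G.Pts (DualNumber L) →ₗ[A] G.Pts (DualNumber L) :=
  G.ptsMap (TrivSqZeroExt.map (l • (LinearMap.id : L →ₗ[L] L)))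

/-- Each `a : A` acts on `Lie_G(L)` as the multiplication by the scalar `δ a`. -/
def ActsOnLieThrough (G : AModuleScheme A L) (δ : A →+* L) : Prop :=
  ∀ (a : A), ∀ v ∈ G.lie, a • v = G.lieScale (δ a) v

/-- `δ` is the characteristic morphism of `G`: the unique ring homomorphism through which
`A` acts on `Lie_G(L)`. -/
def IsCharacteristicMorphism (G : AModuleScheme A L) (δ : A →+* L) : Prop :=
  G.ActsOnLieThrough δ ∧ ∀ δ' : A →+* L, G.ActsOnLieThrough δ' → δ' = δ

end AModuleScheme

/-! ### Tate modules -/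

section Tate

variable {A : Type w} [CommRing A]

/-- The inverse limit of the `ℓ ^ n`-torsion submodules `N[ℓ ^ n]` of an `A`-module `N`, the
transition maps `N[ℓ ^ (n + 1)] → N[ℓ ^ n]` being the multiplication by an element `π` of `ℓ`.
It is used when `ℓ` is a maximal ideal of a Dedekind domain and `π ∈ ℓ \ ℓ ^ 2`. Up to
isomorphism it does not depend on `π` (two choices differ by a unit of the completion at `ℓ`,
which acts on the `ℓ`-power torsion). -/
def tateSubgroup (ℓ : Ideal A) (π : A) (N : Type u) [AddCommGroup N] [Module A N] :
    AddSubgroup (∀ n : ℕ, Submodule.torsionBySet A N (ℓ ^ n : Ideal A)) where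
  carrier := {x | ∀ n, π • (x (n + 1) : N) = x n}
  zero_mem' := by intro n; simp
  add_mem' := by
    intro x y hx hy n
    simp [smul_add, hx n, hy n]
  neg_mem' := by
    intro x hx n
    simp [smul_neg, hx n]

/-- The `ℓ`-adic Tate module of an `A`-module `N`. -/
def TateModule (ℓ : Ideal A) (π : A) (N : Type u) [AddCommGroup N] [Module A N] : Type u :=
  tateSubgroup ℓ π N

variable {ℓ : Ideal A} {π : A} {N : Type u} [AddCommGroup N] [Module A N]

instance : AddCommGroup (TateModule ℓ π N) :=
  inferInstanceAs (AddCommGroup (tateSubgroup ℓ π N))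

theorem torsion_mk_smul {I : Ideal A} (a : A) (x : Submodule.torsionBySet A N I) :
    ((Ideal.Quotient.mk I a • x : Submodule.torsionBySet A N I) : N) = a • (x : N) := rfl

theorem tate_smul_mem (c : AdicCompletion ℓ A) {x : ∀ n : ℕ,
    Submodule.torsionBySet A N (ℓ ^ n : Ideal A)} (hx : x ∈ tateSubgroup ℓ π N) :
    (fun n => AdicCompletion.evalₐ ℓ n c • x n) ∈ tateSubgroup ℓ π N := by
  intro n
  obtain ⟨f, rfl⟩ := AdicCompletion.mk_surjective ℓ A c
  simp only [AdicCompletion.evalₐ_mk, torsion_mk_smul]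
  rw [smul_comm, hx n]
  have h : (f.val (n + 1) - f.val n : A) ∈ (ℓ ^ n : Ideal A) := by
    have := f.2 (Nat.le_succ n)
    rw [SModEq.comm, SModEq.sub_mem] at this
    simpa using this
  have h0 := (Submodule.mem_torsionBySet_iff _ _).1 (x n).2 ⟨_, h⟩
  rw [← sub_eq_zero, ← sub_smul]
  exact h0

/-- The completion `A_ℓ` acts on the Tate module: on the component `N[ℓ ^ n]` it acts through
`A_ℓ → A ⧸ ℓ ^ n`. -/
instance : Module (AdicCompletion ℓ A) (TateModule ℓ π N) where
  smul c x := ⟨fun n => AdicCompletion.evalₐ ℓ n c • x.1 n, tate_smul_mem c x.2⟩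
  one_smul x := Subtype.ext (funext fun n =>
    show AdicCompletion.evalₐ ℓ n 1 • x.1 n = x.1 n by rw [map_one, one_smul])
  mul_smul c d x := Subtype.ext (funext fun n =>
    show AdicCompletion.evalₐ ℓ n (c * d) • x.1 n =
      AdicCompletion.evalₐ ℓ n c • AdicCompletion.evalₐ ℓ n d • x.1 n by rw [map_mul, mul_smul])
  smul_zero c := Subtype.ext (funext fun n =>
    show AdicCompletion.evalₐ ℓ n c • (0 : Submodule.torsionBySet A N (ℓ ^ n : Ideal A)) = 0
      by rw [smul_zero])
  smul_add c x y := Subtype.ext (funext fun n =>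
    show AdicCompletion.evalₐ ℓ n c • (x.1 n + y.1 n) =
      AdicCompletion.evalₐ ℓ n c • x.1 n + AdicCompletion.evalₐ ℓ n c • y.1 n by rw [smul_add])
  add_smul c d x := Subtype.ext (funext fun n =>
    show AdicCompletion.evalₐ ℓ n (c + d) • x.1 n =
      AdicCompletion.evalₐ ℓ n c • x.1 n + AdicCompletion.evalₐ ℓ n d • x.1 n
      by rw [map_add, add_smul])
  zero_smul x := Subtype.ext (funext fun n =>
    show AdicCompletion.evalₐ ℓ n 0 • x.1 n = 0 by rw [map_zero, zero_smul])

/-- An `A`-linear map induces, componentwise, an `A_ℓ`-linear map on Tate modules. -/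
def TateModule.map (ℓ : Ideal A) (π : A) {N' : Type u} [AddCommGroup N'] [Module A N']
    (f : N →ₗ[A] N') : TateModule ℓ π N →ₗ[AdicCompletion ℓ A] TateModule ℓ π N' where
  toFun x := ⟨fun n => ⟨f (x.1 n), (Submodule.mem_torsionBySet_iff _ _).2 fun a => by
      rw [← map_smul, (Submodule.mem_torsionBySet_iff _ _).1 (x.1 n).2 a, map_zero]⟩,
    fun n => by
      show π • f (x.1 (n + 1)) = f (x.1 n)
      rw [← map_smul, x.2 n]⟩
  map_add' x y := Subtype.ext (funext fun n => Subtype.ext (map_add f _ _))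
  map_smul' c x := Subtype.ext (funext fun n => Subtype.ext (by
    show f ((AdicCompletion.evalₐ ℓ n c • x.1 n : Submodule.torsionBySet A N (ℓ ^ n : Ideal A)) : N)
      = ((AdicCompletion.evalₐ ℓ n c • (⟨f (x.1 n), _⟩ :
          Submodule.torsionBySet A N' (ℓ ^ n : Ideal A)) :
          Submodule.torsionBySet A N' (ℓ ^ n : Ideal A)) : N')
    obtain ⟨a, ha⟩ := Ideal.Quotient.mk_surjective (AdicCompletion.evalₐ ℓ n c)
    rw [← ha, torsion_mk_smul, torsion_mk_smul, map_smul]))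

end Tate

namespace AModuleScheme

variable {A : Type w} [CommRing A] {L : Type u} [Field L]

/-- The `ℓ`-adic Tate module of `G`, relative to a separable closure `Ls` of `L`. -/
abbrev Tate (G : AModuleScheme A L) (Ls : Type u) [Field Ls] [Algebra L Ls]
    (ℓ : Ideal A) (π : A) : Type u :=
  TateModule ℓ π (G.Pts Ls)

/-- The action of the Galois group of `Ls` over `L` on the Tate module. -/
def galTate (G : AModuleScheme A L) (Ls : Type u) [Field Ls] [Algebra L Ls]
    (ℓ : Ideal A) (π : A) (σ : Ls ≃ₐ[L] Ls) :
    G.Tate Ls ℓ π →ₗ[AdicCompletion ℓ A] G.Tate Ls ℓ π :=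
  TateModule.map ℓ π (G.ptsMap (σ : Ls →ₐ[L] Ls))

/-- `G` is of rank `r`: `1 ≤ r`, and for each maximal ideal `ℓ` of `A` other than the
characteristic ideal, the Tate module at `ℓ` is free of rank `r` over `A_ℓ`. -/
def HasRank (G : AModuleScheme A L) (Ls : Type u) [Field Ls] [Algebra L Ls] (r : ℕ) : Prop :=
  1 ≤ r ∧ ∃ δ : A →+* L, G.IsCharacteristicMorphism δ ∧
    ∀ ℓ : Ideal A, ℓ.IsMaximal → ℓ ≠ RingHom.ker δ → ∀ π ∈ ℓ, π ∉ ℓ ^ 2 →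
      Nonempty (Module.Basis (Fin r) (AdicCompletion ℓ A) (G.Tate Ls ℓ π))

/-- Elementary pre-`A`-modules of rank `r`: algebraic (of finite type over `L`), connected,
smooth of dimension one, and of rank `r`. -/
structure IsPreElementary (G : AModuleScheme A L) (Ls : Type u) [Field Ls] [Algebra L Ls]
    (r : ℕ) : Prop where
  locallyOfFiniteType : LocallyOfFiniteType G.toSpec
  quasiCompact : QuasiCompact G.toSpec
  connected : ConnectedSpace G.scheme
  smooth : SmoothOfRelativeDimension 1 G.toSpec
  rank : G.HasRank Ls r

/-- Elementary `A`-modules of type (1): the characteristic morphism is `A → L`. -/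
structure IsElementaryOne [Algebra A L] (G : AModuleScheme A L)
    (Ls : Type u) [Field Ls] [Algebra L Ls] (r : ℕ) : Prop where
  preElementary : G.IsPreElementary Ls r
  characteristic : G.IsCharacteristicMorphism (algebraMap A L)

end AModuleScheme

/-! ### Inertia and Frobenius elements of the absolute Galois group -/

section Galois

variable (A : Type w) [CommRing A] {L : Type u} [Field L] [Algebra A L]
  {Ls : Type u} [Field Ls] [Algebra L Ls]

/-- The integral closure in `Ls` of the integral closure `𝒪_L` of `A` in `L`. -/
abbrev IntegersAbove (L : Type u) [Field L] [Algebra A L] (Ls : Type u) [Field Ls]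
    [Algebra L Ls] : Type u :=
  integralClosure (integralClosure A L) Ls

/-- The restriction of `σ ∈ Gal(Ls / L)` to the integral closure of `𝒪_L` in `Ls`. -/
def galIntegers (σ : Ls ≃ₐ[L] Ls) :
    IntegersAbove A L Ls →ₐ[integralClosure A L] IntegersAbove A L Ls :=
  ((σ : Ls →ₐ[L] Ls).restrictScalars (integralClosure A L)).mapIntegralClosure

variable {A}

/-- `σ` belongs to the inertia group at the prime `𝔔`: it acts trivially modulo `𝔔`. -/
def IsInertiaAt (𝔔 : Ideal (IntegersAbove A L Ls)) (σ : Ls ≃ₐ[L] Ls) : Prop :=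
  ∀ x, galIntegers A σ x - x ∈ 𝔔

/-- `σ` is an (arithmetic) Frobenius element at the prime `𝔔`: it acts modulo `𝔔` as
`x ↦ x ^ q`, with `q` the cardinality of the residue field of `𝒪_L` below `𝔔`. -/
def IsFrobeniusAt (𝔔 : Ideal (IntegersAbove A L Ls)) (σ : Ls ≃ₐ[L] Ls) : Prop :=
  (galIntegers A σ).IsArithFrobAt 𝔔

end Galois

namespace AModuleScheme

variable {A : Type w} [CommRing A] {L : Type u} [Field L] [Algebra A L]

/-- Elementary `A`-modules of type (2). The inertia and Frobenius elements at `𝔓` are taken at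
all the primes `𝔔` of the integral closure of `𝒪_L` in `Ls` that lie over `𝔓`. -/
structure IsElementaryTwo (G : AModuleScheme A L)
    (Ls : Type u) [Field Ls] [Algebra L Ls] (r : ℕ) : Prop where
  preElementary : G.IsPreElementary Ls r
  independent : ∃ S : Set (Ideal (integralClosure A L)), S.Finite ∧ (∀ 𝔓 ∈ S, 𝔓.IsMaximal) ∧
    ∀ 𝔓 : Ideal (integralClosure A L), 𝔓.IsMaximal → 𝔓 ∉ S →
      -- the Tate modules are unramified at `𝔓`
      (∀ ℓ : Ideal A, ℓ.IsMaximal → ℓ ≠ 𝔓.under A → ∀ π ∈ ℓ, π ∉ ℓ ^ 2 →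
        ∀ 𝔔 : Ideal (IntegersAbove A L Ls), 𝔔.IsPrime → 𝔔.LiesOver 𝔓 →
        ∀ σ : Ls ≃ₐ[L] Ls, IsInertiaAt 𝔔 σ → G.galTate Ls ℓ π σ = LinearMap.id) ∧
      -- the determinant of Frobenius lies in `A` and does not depend on `ℓ`
      (∃ s : A, ∀ ℓ : Ideal A, ℓ.IsMaximal → ℓ ≠ 𝔓.under A → ∀ π ∈ ℓ, π ∉ ℓ ^ 2 →
        ∀ 𝔔 : Ideal (IntegersAbove A L Ls), 𝔔.IsPrime → 𝔔.LiesOver 𝔓 →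
        ∀ σ : Ls ≃ₐ[L] Ls, IsFrobeniusAt 𝔔 σ →
          LinearMap.det (G.galTate Ls ℓ π σ) = algebraMap A (AdicCompletion ℓ A) s)

/-! ### Drinfeld modules -/

end AModuleScheme

namespace AModuleScheme

variable {A : Type w} [CommRing A] {L : Type u} [Field L]

/-- `G` is isomorphic to the additive group `R ↦ (R, +)` as a group scheme over `L`. -/
def IsAdditive (G : AModuleScheme A L) : Prop :=
  ∃ e : ∀ R : CommAlgCat.{u} L, G.functor.obj R ≃+ R,
    ∀ {R S : CommAlgCat.{u} L} (f : R ⟶ S) (x : G.functor.obj R),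
      e S ((G.functor.map f).hom x) = f.hom (e R x)

/-- The homomorphisms of group schemes over `L` from `G` to the additive group, i.e. the
families of additive maps `G(R) → R` that are natural in `R`, with `L` acting on the target. -/
def homToAdditive (G : AModuleScheme A L) :
    Submodule L (∀ R : CommAlgCat.{u} L, G.functor.obj R →+ R) where
  carrier := {m | ∀ {R S : CommAlgCat.{u} L} (f : R ⟶ S) (x : G.functor.obj R),
    m S ((G.functor.map f).hom x) = f.hom (m R x)}
  zero_mem' := by intro R S f x; simp
  add_mem' := by
    intro m m' hm hm' R S f x
    simp [hm f x, hm' f x]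
  smul_mem' := by
    intro l m hm R S f x
    simp [hm f x]

/-- The group `M(G) = Hom(G, 𝔾_a)`. -/
def M (G : AModuleScheme A L) : Type (u + 1) := G.homToAdditive

variable (G : AModuleScheme A L)

instance : AddCommGroup G.M := inferInstanceAs (AddCommGroup G.homToAdditive)

instance : Module L G.M := inferInstanceAs (Module L G.homToAdditive)

/-- `A` acts on `M(G)` through its action on `G`. -/
instance : Module A G.M where
  smul a m := ⟨fun R => (m.1 R).comp (DistribSMul.toAddMonoidHom (G.functor.obj R) a), by
    intro R S f x
    show m.1 S (a • (G.functor.map f).hom x) = f.hom (m.1 R (a • x))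
    rw [← map_smul, m.2 f]⟩
  one_smul m := Subtype.ext (funext fun R => AddMonoidHom.ext fun x =>
    show m.1 R ((1 : A) • x) = m.1 R x by rw [one_smul])
  mul_smul a b m := Subtype.ext (funext fun R => AddMonoidHom.ext fun x =>
    show m.1 R ((a * b) • x) = m.1 R (b • a • x) by rw [mul_comm, mul_smul])
  smul_zero a := rfl
  smul_add a m m' := rfl
  add_smul a b m := Subtype.ext (funext fun R => AddMonoidHom.ext fun x =>
    show m.1 R ((a + b) • x) = m.1 R (a • x) + m.1 R (b • x) by rw [add_smul, map_add])
  zero_smul m := Subtype.ext (funext fun R => AddMonoidHom.ext fun x =>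
    show m.1 R ((0 : A) • x) = 0 by rw [zero_smul, map_zero])

theorem M_smul_apply (a : A) (m : G.M) (R : CommAlgCat.{u} L) (x : G.functor.obj R) :
    (a • m).1 R x = m.1 R (a • x) := rfl

theorem M_scalar_apply (l : L) (m : G.M) (R : CommAlgCat.{u} L) (x : G.functor.obj R) :
    (l • m).1 R x = l • m.1 R x := rfl

instance : SMulCommClass A L G.M where
  smul_comm _ _ _ := rfl

section

variable (p : ℕ) [Algebra (ZMod p) L]

/-- `M(G)` as a vector space over the prime field `ZMod p`, through `ZMod p → L`. -/
abbrev moduleZMod : Module (ZMod p) G.M := Module.compHom G.M (algebraMap (ZMod p) L)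

attribute [local instance] moduleZMod TensorProduct.Algebra.module

theorem isScalarTower_L : IsScalarTower (ZMod p) L G.M where
  smul_assoc c l m := by
    rw [Algebra.smul_def, mul_smul]
    rfl

theorem isScalarTower_A [Algebra (ZMod p) A] : IsScalarTower (ZMod p) A G.M where
  smul_assoc c a m := by
    obtain ⟨n, rfl⟩ := ZMod.intCast_surjective c
    have h : ∀ m : G.M, ((n : ZMod p) • m : G.M) = n • m := fun m => by
      show (algebraMap (ZMod p) L (n : ZMod p)) • m = n • m
      rw [map_intCast, Int.cast_smul_eq_zsmul]
    rw [h, Algebra.smul_def, map_intCast, mul_smul, Int.cast_smul_eq_zsmul]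

/-- `M(G)` as a module over `A ⊗ L` (over the prime field): `a ⊗ l` acts as `m ↦ l ∘ m ∘ a`. -/
instance moduleTensor [Algebra (ZMod p) A] : Module (A ⊗[ZMod p] L) G.M :=
  letI := isScalarTower_L G p
  letI := isScalarTower_A G p
  TensorProduct.Algebra.module

theorem tmul_smul_apply [Algebra (ZMod p) A] (a : A) (l : L) (m : G.M) (R : CommAlgCat.{u} L)
    (x : G.functor.obj R) : ((a ⊗ₜ[ZMod p] l) • m).1 R x = l • m.1 R (a • x) := rfl

end

/-- `E` is a Drinfeld `A`-module of rank `r` over `L` (of characteristic `p`): it is isomorphic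
to the additive group as a group scheme over `L`, and `M(E)` is a locally free module of
(finite) rank `r` over `A ⊗ L`. -/
structure IsDrinfeld (p : ℕ) [Algebra (ZMod p) A] [Algebra (ZMod p) L]
    (E : AModuleScheme A L) (r : ℕ) : Prop where
  additive : E.IsAdditive
  finite : Module.Finite (A ⊗[ZMod p] L) E.M
  projective : Module.Projective (A ⊗[ZMod p] L) E.M
  rank : ∀ 𝔮 : PrimeSpectrum (A ⊗[ZMod p] L), Module.rankAtStalk E.M 𝔮 = r

/-- `E` is generic: its characteristic morphism is `A → L`. -/
def IsGeneric [Algebra A L] (E : AModuleScheme A L) : Prop :=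
  E.IsCharacteristicMorphism (algebraMap A L)

end AModuleScheme

end

open CategoryTheory AlgebraicGeometry
open scoped TensorProduct

noncomputable section

/-! In a coordinate `E ≅ 𝔾_a` the action of `A` is a ring homomorphism `φ : A → L{τ}` to the twisted
polynomials with constant term `δ`, and `M(E)` becomes `L{τ}`, with `A` acting by right
multiplication through `φ` (`Coordinate.hom`, `Coordinate.mEquiv_smul`). By right division, left
ideals of `L{τ}` are principal, and the codimension of a nonzero one is the degree of its generator.
For the left ideal generated by `φ(I)` this codimension is `r · dim (A/I)`, because `M(E)` has rank
`r`. Its generator is separable because `δ` is injective, so `E[I]` has `|A/I|^r` points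
(`Coordinate.natCard_torsionBySet`). As `E(L^s)` is divisible, a basis of `E[ℓ]` lifts to a basis of
the Tate module. The underlying scheme is the affine line by Yoneda, which gives the geometric
conditions.

For type (2), a rescaled coordinate makes `φ` integral over `𝒪_L`. Fix `t` with `φ(t)` of positive
degree. Every nonzero `a` divides a monic polynomial in `t` over the prime field, so a prime `𝔓`
that does not contain the leading coefficient of `φ(t)` contains that of no `φ(a)`, `a ≠ 0`. The
points killed by `a` are then integral at `𝔓`, and reduction is injective on them as soon as `δ(a) ∉
𝔓`. Since `δ(a)` is a power of `a`, such an `a` exists in `ℓ^n` whenever `ℓ ≠ 𝔓 ∩ A`. Hence inertia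
acts trivially, and Frobenius becomes `F : x ↦ x^q` on torsion points of the reduced homomorphism
over `k = 𝒪_L/𝔓`.

The determinant of `F` is read off `k{τ}`. Under right multiplication by `φ(A)` this is a finite
projective `A`-module, and left multiplication by `τ` is `A`-linear; its determinant lies in `A` and
involves no `ℓ`. Let `q = p^(f+1)`, let `W` be the `I`-torsion for `I = ℓ^n`, and let `Ω` be a field
containing the reduced points. The maps `P ↦ (x ↦ P(x)^(p^i))`, `0 ≤ i ≤ f`, identify the extension
to `Ω` of `k{τ}` modulo the left ideal of `φ(I)` with `f + 1` copies of `Hom(W, Ω)`. There `τ`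
shifts the copies, and the last one returns to the first through composition with `F`. So `det F = ±
det τ`, with a sign depending only on `r` and `f` (`det_frobenius_eq`, `exists_det_frobenius_eq`).
-/

open Polynomial in
/-- Twisted polynomials over `R`: the coefficient of `X ^ i` is that of the `i`-th power of the
Frobenius `x ↦ x ^ p`. -/
def TwistedPoly (_p : ℕ) (R : Type*) [CommRing R] : Type _ := R[X]

/-! ### The ring of twisted polynomials and its action on algebras. -/

namespace TwistedPoly

open Polynomial

section Basic

variable {p : ℕ} {R : Type*} [CommRing R]

instance : AddCommGroup (TwistedPoly p R) := inferInstanceAs (AddCommGroup R[X])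

instance : Module R (TwistedPoly p R) := inferInstanceAs (Module R R[X])

/-- The polynomial with the same coefficients. -/
def coeffPoly : TwistedPoly p R ≃ₗ[R] R[X] := LinearEquiv.refl R _

/-- The coefficient of the `i`-th power of Frobenius. -/
def coeff (P : TwistedPoly p R) (i : ℕ) : R := (coeffPoly P).coeff i

/-- The degree in the Frobenius. -/
def natDegree (P : TwistedPoly p R) : ℕ := (coeffPoly P).natDegree

/-- The leading coefficient. -/
def leadingCoeff (P : TwistedPoly p R) : R := (coeffPoly P).leadingCoeff

/-- The twisted monomial `a τ ^ i`. -/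
def monomial (i : ℕ) (a : R) : TwistedPoly p R := coeffPoly.symm (Polynomial.monomial i a)

@[ext] theorem ext {P Q : TwistedPoly p R} (h : ∀ i, P.coeff i = Q.coeff i) : P = Q :=
  coeffPoly.injective (Polynomial.ext h)

@[simp] theorem coeff_zero (i : ℕ) : (0 : TwistedPoly p R).coeff i = 0 := rfl

@[simp] theorem coeff_add (P Q : TwistedPoly p R) (i : ℕ) :
    (P + Q).coeff i = P.coeff i + Q.coeff i := by simp [coeff]

@[simp] theorem coeff_sub (P Q : TwistedPoly p R) (i : ℕ) :
    (P - Q).coeff i = P.coeff i - Q.coeff i := by simp [coeff]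

@[simp] theorem coeff_smul (c : R) (P : TwistedPoly p R) (i : ℕ) :
    (c • P).coeff i = c * P.coeff i := by simp [coeff]

theorem coeff_monomial (i : ℕ) (a : R) (j : ℕ) :
    (monomial i a : TwistedPoly p R).coeff j = if i = j then a else 0 := by
  simp [coeff, monomial, Polynomial.coeff_monomial]

@[simp] theorem monomial_zero (i : ℕ) : (monomial i 0 : TwistedPoly p R) = 0 := by
  simp [monomial]

theorem monomial_add (i : ℕ) (a b : R) :
    (monomial i (a + b) : TwistedPoly p R) = monomial i a + monomial i b := by
  simp [monomial]

@[elab_as_elim] theorem induction_on {motive : TwistedPoly p R → Prop} (P : TwistedPoly p R)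
    (add : ∀ P Q : TwistedPoly p R, motive P → motive Q → motive (P + Q))
    (monomial : ∀ i a, motive (monomial i a)) : motive P :=
  Polynomial.induction_on' (motive := fun Q => motive (coeffPoly.symm Q)) (coeffPoly P)
    (fun _ _ hP hQ => add _ _ hP hQ) monomial

/-- The endomorphism `x ↦ ∑ i, P i * x ^ (p ^ i)` of the additive group of an `R`-algebra. -/
def ev {S : Type*} [CommRing S] [Algebra R S] (P : TwistedPoly p R) (x : S) : S :=
  (coeffPoly P).sum fun i c => algebraMap R S c * x ^ p ^ i

/-- The additive polynomial `∑ i, P i * X ^ (p ^ i)`. -/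
def toPoly (P : TwistedPoly p R) : R[X] := ev P (X : R[X])

section Eval

variable {S : Type*} [CommRing S] [Algebra R S]

theorem ev_add (P Q : TwistedPoly p R) (x : S) : ev (P + Q) x = ev P x + ev Q x := by
  unfold ev
  rw [map_add, Polynomial.sum_add_index] <;> simp [add_mul]

@[simp] theorem ev_zero_left (x : S) : ev (0 : TwistedPoly p R) x = 0 := by
  simp [ev]

@[simp] theorem ev_monomial (i : ℕ) (a : R) (x : S) :
    ev (monomial i a : TwistedPoly p R) x = algebraMap R S a * x ^ p ^ i := by
  simp only [ev, monomial, LinearEquiv.apply_symm_apply]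
  rw [Polynomial.sum_monomial_index]
  simp

/-- The evaluation as an additive map on twisted polynomials. -/
def evAdd (x : S) : TwistedPoly p R →+ S where
  toFun P := ev P x
  map_zero' := ev_zero_left x
  map_add' P Q := ev_add P Q x

theorem ev_sum {ι : Type*} (s : Finset ι) (P : ι → TwistedPoly p R) (x : S) :
    ev (∑ i ∈ s, P i) x = ∑ i ∈ s, ev (P i) x :=
  map_sum (evAdd x) P s

theorem ev_smul (c : R) (P : TwistedPoly p R) (x : S) : ev (c • P) x = c • ev P x := by
  induction P using induction_on with
  | add P Q hP hQ => rw [smul_add, ev_add, ev_add, hP, hQ, smul_add]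
  | monomial i a =>
    have : c • (monomial i a : TwistedPoly p R) = monomial i (c * a) := by
      ext j; simp [coeff_monomial]
    rw [this, ev_monomial, ev_monomial, map_mul, mul_assoc, Algebra.smul_def]

theorem map_ev {T : Type*} [CommRing T] [Algebra R T] (f : S →ₐ[R] T) (P : TwistedPoly p R)
    (x : S) : f (ev P x) = ev P (f x) := by
  induction P using induction_on with
  | add P Q hP hQ => simp [ev_add, hP, hQ]
  | monomial i a => simp

theorem ev_eq_aeval (P : TwistedPoly p R) (x : S) : ev P x = aeval x P.toPoly := by
  rw [toPoly, map_ev, aeval_X]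

@[simp] theorem toPoly_monomial (i : ℕ) (a : R) :
    (monomial i a : TwistedPoly p R).toPoly = Polynomial.monomial (p ^ i) a := by
  simp [toPoly, Polynomial.C_mul_X_pow_eq_monomial]

theorem toPoly_add (P Q : TwistedPoly p R) : (P + Q).toPoly = P.toPoly + Q.toPoly :=
  ev_add P Q _

theorem coeff_toPoly [hp : Fact p.Prime] (P : TwistedPoly p R) (i : ℕ) :
    P.toPoly.coeff (p ^ i) = P.coeff i := by
  induction P using induction_on with
  | add P Q hP hQ => simp [toPoly_add, hP, hQ]
  | monomial j a =>
    simp [Polynomial.coeff_monomial, coeff_monomial, Nat.pow_right_inj hp.1.one_lt]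

theorem coeff_toPoly_of_ne (P : TwistedPoly p R) (n : ℕ) (hn : ∀ i, n ≠ p ^ i) :
    P.toPoly.coeff n = 0 := by
  induction P using induction_on with
  | add P Q hP hQ => simp [toPoly_add, hP, hQ]
  | monomial j a => simp [Polynomial.coeff_monomial, (hn j).symm]

theorem toPoly_injective [Fact p.Prime] :
    Function.Injective (toPoly : TwistedPoly p R → R[X]) := fun P Q h => by
  ext i
  rw [← coeff_toPoly, h, coeff_toPoly]

theorem toPoly_ne_zero [Fact p.Prime] {P : TwistedPoly p R} (hP : P ≠ 0) : P.toPoly ≠ 0 :=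
  fun h => hP (toPoly_injective (h.trans (ev_zero_left _).symm))

theorem coeff_natDegree (P : TwistedPoly p R) : P.coeff P.natDegree = P.leadingCoeff := rfl

theorem coeff_eq_zero_of_natDegree_lt {P : TwistedPoly p R} {i : ℕ} (h : P.natDegree < i) :
    P.coeff i = 0 := Polynomial.coeff_eq_zero_of_natDegree_lt h

theorem le_natDegree_of_ne_zero {P : TwistedPoly p R} {i : ℕ} (h : P.coeff i ≠ 0) :
    i ≤ P.natDegree := Polynomial.le_natDegree_of_ne_zero h

@[simp] theorem leadingCoeff_eq_zero {P : TwistedPoly p R} : P.leadingCoeff = 0 ↔ P = 0 :=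
  Polynomial.leadingCoeff_eq_zero

theorem natDegree_toPoly [hp : Fact p.Prime] {P : TwistedPoly p R} (hP : P ≠ 0) :
    P.toPoly.natDegree = p ^ P.natDegree := by
  refine Polynomial.natDegree_eq_of_le_of_coeff_ne_zero ?_ ?_
  · refine Polynomial.natDegree_le_iff_coeff_eq_zero.2 fun n hn => ?_
    by_cases h : ∃ i, n = p ^ i
    · obtain ⟨i, rfl⟩ := h
      rw [coeff_toPoly]
      exact coeff_eq_zero_of_natDegree_lt ((Nat.pow_lt_pow_iff_right hp.1.one_lt).1 hn)
    · exact coeff_toPoly_of_ne P n (not_exists.1 h)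
  · rw [coeff_toPoly, coeff_natDegree]
    simpa using hP

theorem leadingCoeff_toPoly [hp : Fact p.Prime] (P : TwistedPoly p R) :
    P.toPoly.leadingCoeff = P.leadingCoeff := by
  by_cases hP : P = 0
  · subst hP
    simp [toPoly, leadingCoeff]
  rw [Polynomial.leadingCoeff, natDegree_toPoly hP, coeff_toPoly, coeff_natDegree]

theorem ev_zero_right [hp : Fact p.Prime] (P : TwistedPoly p R) : ev P (0 : S) = 0 := by
  induction P using induction_on with
  | add P Q hP hQ => simp [ev_add, hP, hQ]
  | monomial i a => simp [hp.1.ne_zero]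

theorem ev_add_right [ExpChar S p] (P : TwistedPoly p R) (x y : S) :
    ev P (x + y) = ev P x + ev P y := by
  induction P using induction_on with
  | add P Q hP hQ => simp only [ev_add, hP, hQ]; abel
  | monomial i a => simp [add_pow_expChar_pow, mul_add]

/-- The evaluation of a twisted polynomial as an additive map. -/
def evHom [ExpChar S p] (P : TwistedPoly p R) : S →+ S :=
  AddMonoidHom.mk' (ev P) (ev_add_right P)

end Eval

/-- The map induced on coefficients by a ring homomorphism. -/
def mapAdd {R' : Type*} [CommRing R'] (f : R →+* R') : TwistedPoly p R →+ TwistedPoly p R' where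
  toFun P := coeffPoly.symm ((coeffPoly P).map f)
  map_zero' := by simp
  map_add' P Q := by simp

@[simp] theorem coeff_mapAdd {R' : Type*} [CommRing R'] (f : R →+* R') (P : TwistedPoly p R)
    (i : ℕ) : (mapAdd f P).coeff i = f (P.coeff i) := by
  simp [mapAdd, coeff]

@[simp] theorem mapAdd_monomial {R' : Type*} [CommRing R'] (f : R →+* R') (i : ℕ) (a : R) :
    mapAdd f (monomial i a : TwistedPoly p R) = monomial i (f a) := by
  ext j
  simp only [coeff_mapAdd, coeff_monomial]
  split_ifs <;> simp

theorem ev_mapAdd {R' : Type*} [CommRing R'] (f : R →+* R') (P : TwistedPoly p R)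
    {S : Type*} [CommRing S] [Algebra R' S] {T : Type*} [CommRing T] [Algebra R T] (g : T →+* S)
    (h : ∀ a, g (algebraMap R T a) = algebraMap R' S (f a)) (x : T) :
    ev (mapAdd f P) (g x) = g (ev P x) := by
  induction P using induction_on with
  | add P Q hP hQ => simp [ev_add, hP, hQ]
  | monomial i a => simp [h]

end Basic

instance {p : ℕ} {R : Type*} [CommRing R] : One (TwistedPoly p R) := ⟨monomial 0 1⟩

theorem one_def {p : ℕ} {R : Type*} [CommRing R] : (1 : TwistedPoly p R) = monomial 0 1 := rfl

instance {p : ℕ} {R : Type*} [CommRing R] [Nontrivial R] : Nontrivial (TwistedPoly p R) :=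
  inferInstanceAs (Nontrivial R[X])

@[simp] theorem ev_one {p : ℕ} {R : Type*} [CommRing R] {S : Type*} [CommRing S] [Algebra R S]
    (x : S) : ev (1 : TwistedPoly p R) x = x := by simp [one_def]

section Ring

variable {p : ℕ} {R : Type*} [CommRing R] [ExpChar R p]

instance : Mul (TwistedPoly p R) where
  mul P Q := coeffPoly.symm ((coeffPoly P).sum fun i c =>
    C c * X ^ i * (coeffPoly Q).map (iterateFrobenius R p i))

theorem mul_def (P Q : TwistedPoly p R) : P * Q = coeffPoly.symm ((coeffPoly P).sum fun i c =>
    C c * X ^ i * (coeffPoly Q).map (iterateFrobenius R p i)) := rfl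

theorem monomial_mul_monomial (i j : ℕ) (a b : R) :
    (monomial i a * monomial j b : TwistedPoly p R) = monomial (i + j) (a * b ^ p ^ i) := by
  rw [mul_def, monomial, monomial, monomial]
  congr 1
  simp only [LinearEquiv.apply_symm_apply]
  rw [Polynomial.sum_monomial_index _ _ (by simp), Polynomial.map_monomial,
    Polynomial.C_mul_X_pow_eq_monomial, Polynomial.monomial_mul_monomial, iterateFrobenius_def]

protected theorem left_distrib' (P Q Q' : TwistedPoly p R) : P * (Q + Q') = P * Q + P * Q' := by
  simp only [mul_def, map_add, Polynomial.map_add, mul_add]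
  rw [← map_add, Polynomial.sum_add]

protected theorem right_distrib' (P P' Q : TwistedPoly p R) : (P + P') * Q = P * Q + P' * Q := by
  simp only [mul_def, map_add]
  rw [Polynomial.sum_add_index _ _ _ (by simp) (by simp [add_mul]), map_add]

instance : Ring (TwistedPoly p R) where
  __ := (inferInstance : AddCommGroup (TwistedPoly p R))
  left_distrib := TwistedPoly.left_distrib'
  right_distrib := TwistedPoly.right_distrib'
  zero_mul P := by simp [mul_def]
  mul_zero P := by simp [mul_def, Polynomial.sum]
  mul_assoc P Q S := by
    induction P using induction_on with
    | add P P' hP hP' => simp only [TwistedPoly.right_distrib', hP, hP']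
    | monomial i a =>
      induction Q using induction_on with
      | add P P' hP hP' =>
        simp only [TwistedPoly.right_distrib', TwistedPoly.left_distrib', hP, hP']
      | monomial j b =>
        induction S using induction_on with
        | add P P' hP hP' => simp only [TwistedPoly.left_distrib', hP, hP']
        | monomial l c =>
          simp only [monomial_mul_monomial, add_assoc, mul_pow, ← pow_mul, pow_add, mul_assoc,
            mul_comm (p ^ i)]
  one_mul P := by
    induction P using induction_on with
    | add P P' hP hP' => simp only [TwistedPoly.left_distrib', hP, hP']
    | monomial i a => simp [one_def, monomial_mul_monomial]
  mul_one P := by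
    induction P using induction_on with
    | add P P' hP hP' => simp only [TwistedPoly.right_distrib', hP, hP']
    | monomial i a => simp [one_def, monomial_mul_monomial]

instance : IsScalarTower R (TwistedPoly p R) (TwistedPoly p R) where
  smul_assoc c P Q := by
    have h (c : R) (P : TwistedPoly p R) : c • P = monomial 0 c * P := by
      induction P using induction_on with
      | add P P' hP hP' => rw [smul_add, hP, hP', mul_add]
      | monomial i a =>
        ext j
        simp [monomial_mul_monomial, coeff_monomial]
    rw [smul_eq_mul, smul_eq_mul, h, h, mul_assoc]

theorem ev_mul {S : Type*} [CommRing S] [Algebra R S] [ExpChar S p] (P Q : TwistedPoly p R)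
    (x : S) : ev (P * Q) x = ev P (ev Q x) := by
  induction P using induction_on with
  | add P P' hP hP' => rw [add_mul, ev_add, ev_add, hP, hP']
  | monomial i a =>
    induction Q using induction_on with
    | add P P' hP hP' => rw [mul_add, ev_add, ev_add, ev_add_right, hP, hP']
    | monomial j b =>
      simp only [monomial_mul_monomial, ev_monomial, map_mul, map_pow, mul_pow, ← pow_mul, pow_add,
        mul_assoc, mul_comm (p ^ i)]

/-- Through this dictionary, degrees, leading coefficients and the absence of zero divisors are
inherited from composition of ordinary polynomials. -/
theorem toPoly_mul (P Q : TwistedPoly p R) : (P * Q).toPoly = P.toPoly.comp Q.toPoly := by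
  rw [toPoly, ev_mul, ev_eq_aeval P]
  rfl

theorem coeff_zero_mul (P Q : TwistedPoly p R) :
    (P * Q).coeff 0 = P.coeff 0 * Q.coeff 0 := by
  induction P using induction_on with
  | add P P' hP hP' => rw [add_mul, coeff_add, coeff_add, hP, hP', add_mul]
  | monomial i a =>
    induction Q using induction_on with
    | add P P' hP hP' => rw [mul_add, coeff_add, coeff_add, hP, hP', mul_add]
    | monomial j b =>
      simp only [monomial_mul_monomial, coeff_monomial]
      rcases i with _ | i <;> rcases j with _ | j <;> simp

/-- The ring homomorphism induced on coefficients. -/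
def map {R' : Type*} [CommRing R'] [ExpChar R' p] (f : R →+* R') :
    TwistedPoly p R →+* TwistedPoly p R' where
  __ := mapAdd f
  map_one' := by simp [one_def]
  map_mul' P Q := by
    change mapAdd f (P * Q) = mapAdd f P * mapAdd f Q
    induction P using induction_on with
    | add P P' hP hP' => rw [add_mul, map_add, map_add, add_mul, hP, hP']
    | monomial i a =>
      induction Q using induction_on with
      | add P P' hP hP' => rw [mul_add, map_add, map_add, mul_add, hP, hP']
      | monomial j b => simp [monomial_mul_monomial]

@[simp] theorem coeff_map {R' : Type*} [CommRing R'] [ExpChar R' p] (f : R →+* R')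
    (P : TwistedPoly p R) (i : ℕ) : (map f P).coeff i = f (P.coeff i) := coeff_mapAdd f P i

theorem ev_map {R' : Type*} [CommRing R'] [ExpChar R' p] (f : R →+* R') (P : TwistedPoly p R)
    {S : Type*} [CommRing S] [Algebra R' S] {T : Type*} [CommRing T] [Algebra R T] (g : T →+* S)
    (h : ∀ a, g (algebraMap R T a) = algebraMap R' S (f a)) (x : T) :
    ev (map f P) (g x) = g (ev P x) := ev_mapAdd f P g h x

theorem map_injective {R' : Type*} [CommRing R'] [ExpChar R' p] {f : R →+* R'}
    (hf : Function.Injective f) : Function.Injective (map f : TwistedPoly p R → TwistedPoly p R') :=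
  fun P Q h => ext fun i => hf (by rw [← coeff_map, h, coeff_map])

theorem map_monomial {R' : Type*} [CommRing R'] [ExpChar R' p] (f : R →+* R') (i : ℕ) (a : R) :
    map f (monomial i a : TwistedPoly p R) = monomial i (f a) := mapAdd_monomial f i a

variable [hp : Fact p.Prime] [IsDomain R]

instance : NoZeroDivisors (TwistedPoly p R) where
  eq_zero_or_eq_zero_of_mul_eq_zero {P Q} h := by
    by_contra! hPQ
    have h0 : (P.toPoly.comp Q.toPoly) = 0 := by
      rw [← toPoly_mul, h]
      exact ev_zero_left _
    rcases Polynomial.comp_eq_zero_iff.1 h0 with h0 | ⟨-, h0⟩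
    · exact toPoly_ne_zero hPQ.1 h0
    · have := congrArg Polynomial.natDegree h0
      rw [natDegree_toPoly hPQ.2, Polynomial.natDegree_C] at this
      exact pow_ne_zero _ hp.1.ne_zero this

theorem natDegree_mul {P Q : TwistedPoly p R} (hP : P ≠ 0) (hQ : Q ≠ 0) :
    (P * Q).natDegree = P.natDegree + Q.natDegree := by
  have h := congrArg Polynomial.natDegree (toPoly_mul P Q)
  rw [Polynomial.natDegree_comp, natDegree_toPoly hP, natDegree_toPoly hQ,
    natDegree_toPoly (mul_ne_zero hP hQ), ← pow_add] at h
  exact Nat.pow_right_injective hp.1.two_le h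

theorem leadingCoeff_mul (P Q : TwistedPoly p R) :
    (P * Q).leadingCoeff = P.leadingCoeff * Q.leadingCoeff ^ p ^ P.natDegree := by
  by_cases hP : P = 0
  · subst hP; simp [leadingCoeff]
  by_cases hQ : Q = 0
  · subst hQ; simp [leadingCoeff, hp.1.ne_zero]
  have h := congrArg Polynomial.leadingCoeff (toPoly_mul P Q)
  rw [Polynomial.leadingCoeff_comp, leadingCoeff_toPoly, leadingCoeff_toPoly, leadingCoeff_toPoly,
    natDegree_toPoly hP] at h
  · exact h
  · rw [natDegree_toPoly hQ]
    exact pow_ne_zero _ hp.1.ne_zero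

end Ring

end TwistedPoly


/-! ### Left ideals of twisted polynomials and sets of zeros. -/

namespace TwistedPoly

open Polynomial

section LeftIdeal

variable {p : ℕ}

theorem coeff_monomial_mul {R : Type*} [CommRing R] [ExpChar R p] (i : ℕ) (a : R)
    (Q : TwistedPoly p R) (j : ℕ) :
    (monomial i a * Q).coeff (j + i) = a * Q.coeff j ^ p ^ i := by
  rw [coeff, mul_def, monomial]
  simp only [LinearEquiv.apply_symm_apply]
  rw [Polynomial.sum_monomial_index _ _ (by simp), mul_assoc, Polynomial.coeff_C_mul,
    Polynomial.coeff_X_pow_mul, Polynomial.coeff_map, iterateFrobenius_def, coeff]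

theorem smul_eq_monomial_mul {R : Type*} [CommRing R] [ExpChar R p] (c : R)
    (P : TwistedPoly p R) : c • P = monomial 0 c * P := by
  ext j
  have := coeff_monomial_mul 0 c P j
  simp only [add_zero, pow_zero, pow_one] at this
  rw [this, coeff_smul]

variable {L : Type*} [Field L] [ExpChar L p]

/-- Right division with remainder by a nonzero twisted polynomial. -/
theorem exists_eq_mul_add {g : TwistedPoly p L} (hg : g ≠ 0) (P : TwistedPoly p L) :
    ∃ h r : TwistedPoly p L, P = h * g + r ∧ ∀ i, g.natDegree ≤ i → r.coeff i = 0 := by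
  suffices ∀ n (P : TwistedPoly p L), (∀ i, n ≤ i → P.coeff i = 0) →
      ∃ h r : TwistedPoly p L, P = h * g + r ∧ ∀ i, g.natDegree ≤ i → r.coeff i = 0 from
    this (P.natDegree + 1) P fun i hi => coeff_eq_zero_of_natDegree_lt hi
  intro n
  induction n with
  | zero => exact fun P hP => ⟨0, P, by simp, fun i _ => hP i (Nat.zero_le i)⟩
  | succ n ih =>
    intro P hP
    by_cases hn : n < g.natDegree
    · exact ⟨0, P, by simp, fun i hi => hP i (by omega)⟩
    obtain ⟨m, rfl⟩ := Nat.exists_eq_add_of_le (not_lt.1 hn)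
    have hlc : g.leadingCoeff ≠ 0 := by simpa using hg
    -- Left multiplication by `τ ^ m` raises the coefficients of `g` to the power `p ^ m`, whence
    -- the denominator. No `p`-th root is needed, so right division works over an imperfect field.
    obtain ⟨h, r, hr, hr'⟩ := ih
      (P - monomial m (P.coeff (g.natDegree + m) / g.leadingCoeff ^ p ^ m) * g) (by
        intro i hi
        obtain ⟨j, rfl⟩ : ∃ j, i = j + m := ⟨i - m, by omega⟩
        rw [coeff_sub, coeff_monomial_mul]
        rcases (show g.natDegree ≤ j by omega).eq_or_lt with h | h
        · rw [← h, coeff_natDegree, div_mul_cancel₀ _ (pow_ne_zero _ hlc), sub_self]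
        · rw [hP _ (by omega), coeff_eq_zero_of_natDegree_lt h, zero_pow (expChar_pow_pos L p m).ne',
            mul_zero, sub_zero])
    refine ⟨monomial m (P.coeff (g.natDegree + m) / g.leadingCoeff ^ p ^ m) + h, r, ?_, hr'⟩
    rw [add_mul, add_assoc, ← hr]
    abel

/-- A nonzero left ideal is principal, and its codimension is the degree of a generator. -/
theorem exists_generator (J : Submodule (TwistedPoly p L) (TwistedPoly p L)) (hJ : J ≠ ⊥) :
    ∃ g ∈ J, g ≠ 0 ∧ (∀ m ∈ J, ∃ h, m = h * g) ∧
      Module.Finite L (TwistedPoly p L ⧸ J.restrictScalars L) ∧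
      Module.finrank L (TwistedPoly p L ⧸ J.restrictScalars L) = g.natDegree := by
  classical
  obtain ⟨m, hm, hm0⟩ := Submodule.exists_mem_ne_zero_of_ne_bot hJ
  have hex : ∃ n, ∃ g ∈ J, g ≠ 0 ∧ g.natDegree = n := ⟨_, m, hm, hm0, rfl⟩
  obtain ⟨g, hgJ, hg0, hgn⟩ := Nat.find_spec hex
  have hmin : ∀ r ∈ J, (∀ i, g.natDegree ≤ i → r.coeff i = 0) → r = 0 := by
    intro r hr h
    by_contra hr0
    refine Nat.find_min hex (m := r.natDegree) ?_ ⟨r, hr, hr0, rfl⟩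
    rw [← hgn]
    by_contra hlt
    exact hr0 (leadingCoeff_eq_zero.1 (h _ (not_lt.1 hlt)))
  have hdeg (r : TwistedPoly p L) : coeffPoly r ∈ degreeLT L g.natDegree ↔
      ∀ i, g.natDegree ≤ i → r.coeff i = 0 := by
    rw [mem_degreeLT, Polynomial.degree_lt_iff_coeff_zero]
    rfl
  -- By division and minimality of the degree of `g`, the remainders, of degree less than that of
  -- `g`, form an `L`-linear complement of `J`.
  let D : Submodule L (TwistedPoly p L) :=
    (degreeLT L g.natDegree).comap (coeffPoly (p := p) (R := L)).toLinearMap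
  have hc : IsCompl (J.restrictScalars L) D := by
    refine ⟨Submodule.disjoint_def.2 fun r hr hrD => hmin r hr ((hdeg r).1 hrD), ?_⟩
    rw [codisjoint_iff, eq_top_iff]
    intro P _
    obtain ⟨h, r, rfl, hr⟩ := exists_eq_mul_add hg0 P
    exact Submodule.add_mem_sup (J.smul_mem h hgJ) ((hdeg r).2 hr)
  let e : (TwistedPoly p L ⧸ J.restrictScalars L) ≃ₗ[L] (Fin g.natDegree → L) :=
    (Submodule.quotientEquivOfIsCompl _ _ hc).trans
      ((coeffPoly.submoduleMap D).trans
        ((LinearEquiv.ofEq _ _ (Submodule.map_comap_eq_of_surjective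
          (f := (coeffPoly (p := p) (R := L)).toLinearMap) coeffPoly.surjective _)).trans
          (degreeLTEquiv L g.natDegree)))
  refine ⟨g, hgJ, hg0, fun m hm => ?_, Module.Finite.equiv e.symm, by simp [e.finrank_eq]⟩
  obtain ⟨h, r, rfl, hr⟩ := exists_eq_mul_add hg0 m
  have : r ∈ J := by
    have := J.sub_mem hm (J.smul_mem h hgJ)
    rwa [smul_eq_mul, add_sub_cancel_left] at this
  exact ⟨h, by rw [hmin r this hr, add_zero]⟩

end LeftIdeal

section Roots

variable {p : ℕ} [hp : Fact p.Prime] {L : Type*} [Field L] [CharP L p]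
  {Ω : Type*} [Field Ω] [Algebra L Ω]

theorem setOf_ev_eq_zero {g : TwistedPoly p L} (hg : g ≠ 0) :
    {x : Ω | ev g x = 0} = g.toPoly.rootSet Ω := by
  ext x
  simp [mem_rootSet, toPoly_ne_zero hg, ev_eq_aeval]

theorem finite_ker {g : TwistedPoly p L} (hg : g ≠ 0) : {x : Ω | ev g x = 0}.Finite := by
  rw [setOf_ev_eq_zero hg]
  exact Polynomial.rootSet_finite _ _

theorem ncard_ker_le {g : TwistedPoly p L} (hg : g ≠ 0) :
    {x : Ω | ev g x = 0}.ncard ≤ p ^ g.natDegree := by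
  rw [setOf_ev_eq_zero hg, ← natDegree_toPoly hg]
  exact Polynomial.ncard_rootSet_le _ _

-- The terms of exponent `p ^ i` with `i > 0` have zero derivative in characteristic `p`. Hence
-- separability is decided by the linear coefficient alone.
omit hp in
theorem derivative_toPoly (g : TwistedPoly p L) : derivative g.toPoly = C (g.coeff 0) := by
  induction g using induction_on with
  | add P Q hP hQ => simp [toPoly_add, hP, hQ]
  | monomial i a =>
    rcases i with _ | i
    · simp [coeff_monomial, derivative_monomial]
    · simp [coeff_monomial, derivative_monomial]

omit hp in
theorem separable_toPoly {g : TwistedPoly p L} (hg : g.coeff 0 ≠ 0) : g.toPoly.Separable :=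
  ⟨0, C (g.coeff 0)⁻¹, by rw [derivative_toPoly, ← C_mul, inv_mul_cancel₀ hg]; simp⟩

theorem ncard_ker_eq [IsSepClosed Ω] {g : TwistedPoly p L} (hg : g.coeff 0 ≠ 0) :
    {x : Ω | ev g x = 0}.ncard = p ^ g.natDegree := by
  have hg0 : g ≠ 0 := by rintro rfl; simp at hg
  rw [setOf_ev_eq_zero hg0, ← natDegree_toPoly hg0, ← Nat.card_coe_set_eq, Nat.card_eq_fintype_card]
  exact Polynomial.card_rootSet_eq_natDegree (separable_toPoly hg)
    (IsSepClosed.splits_codomain _ (separable_toPoly hg))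

theorem ev_surjective [IsSepClosed Ω] {g : TwistedPoly p L} (hg : g.coeff 0 ≠ 0) :
    Function.Surjective (ev g : Ω → Ω) := by
  intro y
  have hg0 : g ≠ 0 := by rintro rfl; simp at hg
  have hd : (g.toPoly.map (algebraMap L Ω) - C y).natDegree = p ^ g.natDegree := by
    rw [natDegree_sub_C, natDegree_map, natDegree_toPoly hg0]
  -- Subtracting a constant does not change the derivative, which is a nonzero constant.
  have hs : (g.toPoly.map (algebraMap L Ω) - C y).Separable := by
    refine ⟨0, C (algebraMap L Ω (g.coeff 0))⁻¹, ?_⟩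
    rw [derivative_sub, derivative_map, derivative_toPoly, derivative_C, sub_zero, map_C, ← C_mul,
      inv_mul_cancel₀ (by simpa using hg)]
    simp
  obtain ⟨x, hx⟩ := IsSepClosed.exists_root _ (by
    intro h
    rw [degree_eq_natDegree hs.ne_zero, hd] at h
    exact pow_ne_zero _ hp.1.ne_zero (by exact_mod_cast h)) hs
  refine ⟨x, ?_⟩
  rw [IsRoot.def, eval_sub, eval_C, sub_eq_zero, eval_map_algebraMap] at hx
  rw [ev_eq_aeval, hx]

/-- If a twisted polynomial has as many zeros as its degree allows, so has a right factor. -/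
theorem ncard_ker_of_mul {g h : TwistedPoly p L} (hh : h ≠ 0) (hg : g ≠ 0)
    (H : {x : Ω | ev (h * g) x = 0}.ncard = p ^ (h * g).natDegree) :
    {x : Ω | ev g x = 0}.ncard = p ^ g.natDegree := by
  have : CharP Ω p := charP_of_injective_algebraMap (algebraMap L Ω).injective p
  let K : AddSubgroup Ω := (evHom (S := Ω) (h * g)).ker
  -- Evaluation of `g` maps the zeros of `h * g` to those of `h`, and its kernel consists of zeros
  -- of `g`. As `h` has at most `p ^ h.natDegree` zeros, `g` must have at least `p ^ g.natDegree`.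
  let f : K →+ (evHom (S := Ω) h).ker :=
    ((evHom (S := Ω) g).comp K.subtype).codRestrict _ fun x => by
      have : ev (h * g) (x : Ω) = 0 := x.2
      rwa [ev_mul] at this
  have hK : Nat.card K = p ^ (h * g).natDegree := H
  have hHle : Nat.card (evHom (S := Ω) h).ker ≤ p ^ h.natDegree := ncard_ker_le hh
  have : Finite (evHom (S := Ω) h).ker := finite_ker (Ω := Ω) hh
  have hfK : Nat.card f.ker ≤ {x : Ω | ev g x = 0}.ncard := by
    rw [← Nat.card_coe_set_eq]
    have : Finite {x : Ω | ev g x = 0} := finite_ker (Ω := Ω) hg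
    refine Nat.card_le_card_of_injective (fun x => ⟨x.1.1, congrArg Subtype.val x.2⟩) fun x y hxy => ?_
    exact Subtype.ext (Subtype.ext (Subtype.mk.inj hxy))
  refine le_antisymm (ncard_ker_le hg) ?_
  have h1 : Nat.card K = Nat.card f.range * Nat.card f.ker := by
    rw [← Nat.card_congr (QuotientAddGroup.quotientKerEquivRange f).toEquiv]
    exact AddSubgroup.card_eq_card_quotient_mul_card_addSubgroup _
  have h2 : Nat.card f.range ≤ Nat.card (evHom (S := Ω) h).ker :=
    Nat.card_le_card_of_injective _ Subtype.val_injective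
  rw [hK, natDegree_mul hh hg, pow_add] at h1
  have h3 : p ^ h.natDegree * p ^ g.natDegree ≤ p ^ h.natDegree * {x : Ω | ev g x = 0}.ncard :=
    h1.trans_le (Nat.mul_le_mul (h2.trans hHle) hfK)
  exact Nat.le_of_mul_le_mul_left h3 (pow_pos hp.1.pos _)

end Roots

end TwistedPoly

/-! ### Endomorphisms of the additive group. -/

section AdditivePolynomial

open Polynomial

/-- Compare the coefficients of `X ^ (p ^ k)` in `(X + 1) ^ (p ^ k * m) = (X ^ (p ^ k) + 1) ^ m`. -/
theorem choose_prime_pow_mul_cast {p : ℕ} [hp : Fact p.Prime] (L : Type*) [Field L] [CharP L p]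
    (k m : ℕ) : (((p ^ k * m).choose (p ^ k) : ℕ) : L) = m := by
  have h : ((X + 1 : L[X]) ^ (p ^ k * m)) = expand L (p ^ k) ((X + 1) ^ m) := by
    rw [pow_mul, add_pow_expChar_pow, one_pow, map_pow, map_add, expand_X, map_one]
  have h' := congrArg (fun f => f.coeff (1 * p ^ k)) h
  simp only [coeff_expand_mul (pow_pos hp.1.pos k), coeff_X_add_one_pow,
    Nat.choose_one_right] at h'
  rwa [one_mul] at h'

variable {L : Type u} [Field L]

/-- Additivity is applied to `x` and `x * y` in `L[x][y]`. The coefficient of `x ^ n * y ^ j` in `f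
(x + x * y)` is the left side; it vanishes in `f x` because `j ≠ 0` and in `f (x * y)` because `j ≠
n`. -/
theorem coeff_mul_choose_eq_zero (f : L[X])
    (hf : ∀ (R : Type u) [CommRing R] [Algebra L R] (x y : R),
      aeval (x + y) f = aeval x f + aeval y f) (n j : ℕ) (hj : j ≠ 0) (hjn : j ≠ n) :
    f.coeff n * (n.choose j : L) = 0 := by
  have h1 (f : L[X]) : ((aeval (C X + C X * X : L[X][X]) f).coeff j).coeff n =
      f.coeff n * (n.choose j : L) := by
    induction f using Polynomial.induction_on' with
    | add f g hf hg => simp only [map_add, Polynomial.coeff_add, hf, hg, add_mul]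
    | monomial m a =>
      have : (C X + C X * X : L[X][X]) = C X * (X + 1) := by ring
      rw [aeval_monomial, this, mul_pow, ← C_pow, ← mul_assoc]
      have h0 : algebraMap L L[X][X] a = C (C a) := rfl
      rw [h0, ← C_mul, coeff_C_mul, coeff_X_add_one_pow, Polynomial.coeff_monomial, mul_assoc,
        coeff_C_mul, ← Polynomial.C_eq_natCast, Polynomial.coeff_mul_C, coeff_X_pow]
      by_cases h : m = n
      · subst h; simp
      · simp [h, Ne.symm h]
  have h2 (f : L[X]) : ((aeval (C X : L[X][X]) f).coeff j).coeff n = 0 := by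
    induction f using Polynomial.induction_on' with
    | add f g hf hg => simp only [map_add, Polynomial.coeff_add, hf, hg, add_zero]
    | monomial m a =>
      rw [aeval_monomial, ← C_pow]
      have h0 : algebraMap L L[X][X] a = C (C a) := rfl
      rw [h0, ← C_mul, coeff_C, if_neg hj, Polynomial.coeff_zero]
  have h3 (f : L[X]) : ((aeval (C X * X : L[X][X]) f).coeff j).coeff n = 0 := by
    induction f using Polynomial.induction_on' with
    | add f g hf hg => simp only [map_add, Polynomial.coeff_add, hf, hg, add_zero]
    | monomial m a =>
      rw [aeval_monomial, mul_pow, ← C_pow]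
      have h0 : algebraMap L L[X][X] a = C (C a) := rfl
      rw [h0, ← mul_assoc, ← C_mul, coeff_C_mul, coeff_X_pow]
      split_ifs with h
      · subst h
        rw [mul_one, coeff_C_mul, coeff_X_pow, if_neg hjn.symm, mul_zero]
      · simp
  have := congrArg (fun F => (F.coeff j).coeff n) (hf L[X][X] (C X) (C X * X))
  simpa only [Polynomial.coeff_add, h1, h2, h3, add_zero] using this

/-- A polynomial that is additive on all algebras comes from a twisted polynomial. -/
theorem exists_toPoly_eq (p : ℕ) [hp : Fact p.Prime] [CharP L p] (f : L[X])
    (hf : ∀ (R : Type u) [CommRing R] [Algebra L R] (x y : R),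
      aeval (x + y) f = aeval x f + aeval y f) : ∃ P : TwistedPoly p L, P.toPoly = f := by
  have h0 : f.coeff 0 = 0 := by
    have := hf L 0 0
    simpa [coeff_zero_eq_aeval_zero] using this
  have hn : ∀ n, (∀ i, n ≠ p ^ i) → f.coeff n = 0 := by
    intro n hn
    by_cases hn0 : n = 0
    · rw [hn0, h0]
    -- With `n = p ^ k * m` and `m` prime to `p`, the binomial coefficient of `n` over `p ^ k` is
    -- `m` modulo `p`, hence invertible.
    obtain ⟨k, m, hm, rfl⟩ := Nat.exists_eq_pow_mul_and_not_dvd hn0 p hp.1.ne_one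
    have hk := coeff_mul_choose_eq_zero f hf (p ^ k * m) (p ^ k) (pow_ne_zero _ hp.1.ne_zero)
      (hn k).symm
    rw [choose_prime_pow_mul_cast] at hk
    refine (mul_eq_zero.1 hk).resolve_right ?_
    exact fun h => hm ((CharP.cast_eq_zero_iff L p m).1 h)
  refine ⟨∑ i ∈ Finset.range (f.natDegree + 1), TwistedPoly.monomial i (f.coeff (p ^ i)), ?_⟩
  rw [TwistedPoly.toPoly, TwistedPoly.ev_sum]
  ext n
  simp only [TwistedPoly.ev_monomial, algebraMap_eq, finsetSum_coeff, coeff_C_mul, coeff_X_pow]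
  by_cases h : ∃ i, n = p ^ i
  · obtain ⟨i, rfl⟩ := h
    simp only [Nat.pow_right_inj hp.1.one_lt]
    rw [Finset.sum_eq_single i]
    · simp
    · intro j _ hj
      simp [hj.symm]
    · intro hi
      have : f.natDegree < p ^ i :=
        (show f.natDegree < i by simpa using hi).trans (Nat.lt_pow_self hp.1.one_lt)
      simp [coeff_eq_zero_of_natDegree_lt this]
  · rw [hn n (not_exists.1 h)]
    refine Finset.sum_eq_zero fun i _ => ?_
    rw [if_neg (not_exists.1 h i), mul_zero]

/-- A natural additive endomorphism of the additive group is given by a twisted polynomial. -/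
theorem existsUnique_ev_eq (p : ℕ) [Fact p.Prime] [CharP L p]
    (m : ∀ R : CommAlgCat.{u} L, R →+ R)
    (hm : ∀ {R S : CommAlgCat.{u} L} (f : R ⟶ S) (x : R), m S (f.hom x) = f.hom (m R x)) :
    ∃! P : TwistedPoly p L, ∀ (R : CommAlgCat.{u} L) (x : R), m R x = P.ev x := by
  -- Yoneda: the natural map is determined by its value at the generic point.
  let F : L[X] := m (CommAlgCat.of L L[X]) (X : L[X])
  have hF (R : CommAlgCat.{u} L) (x : R) : m R x = aeval x F := by
    have := hm (CommAlgCat.ofHom (aeval x) : CommAlgCat.of L L[X] ⟶ R) (X : L[X])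
    simpa using this
  obtain ⟨P, hP⟩ := exists_toPoly_eq p F fun R _ _ x y => by
    have := map_add (m (CommAlgCat.of L R)) x y
    rwa [hF, hF, hF] at this
  refine ⟨P, fun R x => by rw [hF, TwistedPoly.ev_eq_aeval, hP], fun Q hQ => ?_⟩
  refine TwistedPoly.toPoly_injective ?_
  rw [hP]
  exact (hQ (CommAlgCat.of L L[X]) (X : L[X])).symm

end AdditivePolynomial

/-! ### Coordinates: the homomorphism to twisted polynomials and the module `M(G)`. -/

namespace AModuleScheme

variable {A : Type w} [CommRing A] {L : Type u} [Field L]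

/-- An isomorphism of group schemes with the additive group. -/
structure Coordinate (G : AModuleScheme A L) where
  /-- the isomorphism on points -/
  equiv (R : CommAlgCat.{u} L) : G.functor.obj R ≃+ R
  natural {R S : CommAlgCat.{u} L} (f : R ⟶ S) (x : G.functor.obj R) :
    equiv S ((G.functor.map f).hom x) = f.hom (equiv R x)

namespace Coordinate

variable {G : AModuleScheme A L} (c : G.Coordinate)

/-- The isomorphism on points with values in an `L`-algebra. -/
def pts (R : Type u) [CommRing R] [Algebra L R] : G.Pts R ≃+ R := c.equiv (CommAlgCat.of L R)

theorem pts_map {R S : Type u} [CommRing R] [Algebra L R] [CommRing S] [Algebra L S]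
    (f : R →ₐ[L] S) (x : G.Pts R) : c.pts S (G.ptsMap f x) = f (c.pts R x) :=
  c.natural (CommAlgCat.ofHom f) x

theorem natural_symm {R S : CommAlgCat.{u} L} (f : R ⟶ S) (x : R) :
    (G.functor.map f).hom ((c.equiv R).symm x) = (c.equiv S).symm (f.hom x) := by
  apply (c.equiv S).injective
  rw [c.natural, AddEquiv.apply_symm_apply, AddEquiv.apply_symm_apply]

variable (p : ℕ) [Fact p.Prime] [CharP L p]

theorem existsUnique_smul (a : A) : ∃! P : TwistedPoly p L,
    ∀ (R : CommAlgCat.{u} L) (x : R), c.equiv R (a • (c.equiv R).symm x) = P.ev x :=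
  existsUnique_ev_eq p (fun R => ((c.equiv R).toAddMonoidHom.comp
    (DistribSMul.toAddMonoidHom (G.functor.obj R) a)).comp (c.equiv R).symm.toAddMonoidHom)
    fun {R S} f x => by
      simp only [AddMonoidHom.comp_apply, DistribSMul.toAddMonoidHom_apply, AddEquiv.toAddMonoidHom_eq_coe, AddMonoidHom.coe_coe]
      rw [← c.natural_symm, ← map_smul, c.natural]

theorem equiv_smul (a : A) (R : CommAlgCat.{u} L) (x : G.functor.obj R) :
    c.equiv R (a • x) = (c.existsUnique_smul p a).choose.ev (c.equiv R x) := by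
  have := (c.existsUnique_smul p a).choose_spec.1 R (c.equiv R x)
  rwa [AddEquiv.symm_apply_apply] at this

theorem eq_choose (a : A) (P : TwistedPoly p L)
    (hP : ∀ (R : CommAlgCat.{u} L) (x : G.functor.obj R), c.equiv R (a • x) = P.ev (c.equiv R x)) :
    (c.existsUnique_smul p a).choose = P :=
  ((c.existsUnique_smul p a).choose_spec.2 P fun R x => by
    rw [hP, AddEquiv.apply_symm_apply]).symm

/-- The ring homomorphism to twisted polynomials by which `A` acts in the coordinate. -/
def hom : A →+* TwistedPoly p L where
  toFun a := (c.existsUnique_smul p a).choose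
  map_one' := c.eq_choose p 1 1 fun R x => by simp
  map_zero' := c.eq_choose p 0 0 fun R x => by simp
  map_add' a b := c.eq_choose p _ _ fun R x => by
    rw [add_smul, map_add, c.equiv_smul p, c.equiv_smul p, TwistedPoly.ev_add]
  map_mul' a b := c.eq_choose p _ _ fun R x => by
    -- The zero algebra does not have characteristic `p` and is set apart.
    rcases subsingleton_or_nontrivial R with h | h
    · exact Subsingleton.elim _ _
    have : CharP R p := charP_of_injective_algebraMap (algebraMap L R).injective p
    rw [mul_smul, c.equiv_smul p, c.equiv_smul p, TwistedPoly.ev_mul]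

theorem equiv_smul_eq (a : A) (R : CommAlgCat.{u} L) (x : G.functor.obj R) :
    c.equiv R (a • x) = (c.hom p a).ev (c.equiv R x) := c.equiv_smul p a R x

theorem pts_smul (a : A) {R : Type u} [CommRing R] [Algebra L R] (x : G.Pts R) :
    c.pts R (a • x) = (c.hom p a).ev (c.pts R x) := c.equiv_smul p a _ x

theorem hom_eq {a : A} {P : TwistedPoly p L}
    (hP : ∀ (R : CommAlgCat.{u} L) (x : G.functor.obj R), c.equiv R (a • x) = P.ev (c.equiv R x)) :
    c.hom p a = P := c.eq_choose p a P hP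

theorem existsUnique_M (m : G.M) : ∃! P : TwistedPoly p L,
    ∀ (R : CommAlgCat.{u} L) (x : R), m.1 R ((c.equiv R).symm x) = P.ev x :=
  existsUnique_ev_eq p (fun R => (m.1 R).comp (c.equiv R).symm.toAddMonoidHom)
    fun {R S} f x => by
      simp only [AddMonoidHom.comp_apply, AddEquiv.toAddMonoidHom_eq_coe, AddMonoidHom.coe_coe]
      rw [← c.natural_symm, m.2 f]

/-- The twisted polynomial of a homomorphism to the additive group. -/
def ofM (m : G.M) : TwistedPoly p L := (c.existsUnique_M p m).choose

theorem M_apply (m : G.M) (R : CommAlgCat.{u} L) (x : G.functor.obj R) :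
    m.1 R x = (c.ofM p m).ev (c.equiv R x) := by
  have := (c.existsUnique_M p m).choose_spec.1 R (c.equiv R x)
  rwa [AddEquiv.symm_apply_apply] at this

theorem ofM_eq (m : G.M) (P : TwistedPoly p L)
    (hP : ∀ (R : CommAlgCat.{u} L) (x : G.functor.obj R), m.1 R x = P.ev (c.equiv R x)) :
    c.ofM p m = P :=
  ((c.existsUnique_M p m).choose_spec.2 P fun R x => by
    rw [hP, AddEquiv.apply_symm_apply]).symm

/-- The homomorphism to the additive group defined by a twisted polynomial. -/
def toM (P : TwistedPoly p L) : G.M :=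
  ⟨fun R => AddMonoidHom.mk' (fun x => P.ev (c.equiv R x)) fun x y => by
      rcases subsingleton_or_nontrivial R with h | h
      · exact Subsingleton.elim _ _
      have : CharP R p := charP_of_injective_algebraMap (algebraMap L R).injective p
      rw [map_add, TwistedPoly.ev_add_right],
    fun {R S} f x => by
      simp only [AddMonoidHom.mk'_apply, c.natural]
      exact (TwistedPoly.map_ev f.hom P _).symm⟩

/-- The isomorphism of `M(G)` with the twisted polynomials. -/
def mEquiv : G.M ≃ₗ[L] TwistedPoly p L where
  toFun := c.ofM p
  map_add' m m' := c.ofM_eq p _ _ fun R x => by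
    rw [TwistedPoly.ev_add, ← M_apply, ← M_apply]
    rfl
  map_smul' l m := c.ofM_eq p _ _ fun R x => by
    rw [RingHom.id_apply, TwistedPoly.ev_smul, ← M_apply]
    rfl
  invFun := c.toM p
  left_inv m := Subtype.ext (funext fun R => AddMonoidHom.ext fun x => (c.M_apply p m R x).symm)
  right_inv P := c.ofM_eq p _ _ fun R x => rfl

/-- `A` acts on `M(G)` by precomposition, hence by multiplication on the right. -/
theorem mEquiv_smul (a : A) (m : G.M) : c.mEquiv p (a • m) = c.mEquiv p m * c.hom p a :=
  c.ofM_eq p _ _ fun R x => by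
    rcases subsingleton_or_nontrivial R with h | h
    · exact Subsingleton.elim _ _
    have : CharP R p := charP_of_injective_algebraMap (algebraMap L R).injective p
    rw [M_smul_apply, TwistedPoly.ev_mul, ← c.equiv_smul_eq, c.M_apply p]
    rfl

/-- The point with coordinate `ε` is a tangent vector, and `ε ^ (p ^ i) = 0` for `i > 0`, so only
the linear coefficient acts on it. -/
theorem coeff_zero_hom {δ : A →+* L} (hδ : G.ActsOnLieThrough δ) (a : A) :
    (c.hom p a).coeff 0 = δ a := by
  have hε (P : TwistedPoly p L) : (P.ev (DualNumber.eps : DualNumber L)).snd = P.coeff 0 := by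
    induction P using TwistedPoly.induction_on with
    | add P Q hP hQ => simp [TwistedPoly.ev_add, hP, hQ]
    | monomial i b =>
      rcases i with _ | i
      · simp [TwistedPoly.coeff_monomial, TrivSqZeroExt.algebraMap_eq_inl]
      · have h2 : 2 ≤ p ^ (i + 1) :=
          (Fact.out : p.Prime).two_le.trans (Nat.le_self_pow (Nat.succ_ne_zero i) p)
        have : (DualNumber.eps : DualNumber L) ^ p ^ (i + 1) = 0 :=
          pow_eq_zero_of_le h2 (by rw [pow_two, DualNumber.eps_mul_eps])
        simp [TwistedPoly.coeff_monomial, this]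
  let v : G.Pts (DualNumber L) := (c.pts _).symm DualNumber.eps
  have hv : v ∈ G.lie := by
    rw [lie, LinearMap.mem_ker]
    apply (c.pts L).injective
    rw [c.pts_map, AddEquiv.apply_symm_apply, map_zero]
    simp
  have h := congrArg (fun y => (c.pts _ y).snd) (hδ a v hv)
  simp only [lieScale, c.pts_map, c.pts_smul p, v, AddEquiv.apply_symm_apply, hε] at h
  rw [h]
  simp

omit [Fact p.Prime] [CharP L p] in
/-- Multiplication of a coordinate by a unit. -/
def rescale (l : L) (hl : l ≠ 0) : G.Coordinate where
  equiv R := (c.equiv R).trans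
    { toFun x := l • x
      invFun x := l⁻¹ • x
      left_inv x := by simp [smul_smul, hl]
      right_inv x := by simp [smul_smul, hl]
      map_add' x y := smul_add l x y }
  natural f x := by
    simp [c.natural]

/-- The rescaled homomorphism is the conjugate `l * c.hom p a * l⁻¹`, and moving `l⁻¹` past `τ ^ i`
raises it to the power `p ^ i`. -/
theorem coeff_hom_rescale (l : L) (hl : l ≠ 0) (a : A) (i : ℕ) :
    ((c.rescale l hl).hom p a).coeff i = l * (c.hom p a).coeff i * l⁻¹ ^ p ^ i := by
  have h : (c.rescale l hl).hom p a =
      TwistedPoly.monomial 0 l * c.hom p a * TwistedPoly.monomial 0 l⁻¹ := by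
    refine hom_eq _ p fun R x => ?_
    rcases subsingleton_or_nontrivial R with h | h
    · exact Subsingleton.elim _ _
    have : CharP R p := charP_of_injective_algebraMap (algebraMap L R).injective p
    change l • c.equiv R (a • x) = TwistedPoly.ev _ (l • c.equiv R x)
    rw [TwistedPoly.ev_mul, TwistedPoly.ev_mul, c.equiv_smul_eq p, TwistedPoly.ev_monomial,
      TwistedPoly.ev_monomial, Algebra.smul_def, Algebra.smul_def]
    simp only [pow_zero, pow_one]
    rw [← mul_assoc (algebraMap L R l⁻¹), ← map_mul, inv_mul_cancel₀ hl, map_one, one_mul]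
  have hr (P : TwistedPoly p L) (b : L) : (P * TwistedPoly.monomial 0 b).coeff i =
      P.coeff i * b ^ p ^ i := by
    induction P using TwistedPoly.induction_on with
    | add P Q hP hQ => rw [_root_.add_mul, TwistedPoly.coeff_add, TwistedPoly.coeff_add, hP, hQ,
        _root_.add_mul]
    | monomial j d =>
      rw [TwistedPoly.monomial_mul_monomial, TwistedPoly.coeff_monomial,
        TwistedPoly.coeff_monomial, add_zero]
      split_ifs with h
      · rw [h]
      · simp
  rw [h, hr, ← TwistedPoly.smul_eq_monomial_mul, TwistedPoly.coeff_smul]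

end Coordinate

theorem IsAdditive.exists_coordinate {G : AModuleScheme A L} (h : G.IsAdditive) :
    Nonempty G.Coordinate := by
  obtain ⟨e, he⟩ := h
  exact ⟨⟨e, he⟩⟩

end AModuleScheme

/-! ### The underlying scheme is the affine line. -/

section AffineLine

open Polynomial

theorem isStandardSmoothOfRelativeDimension_polynomial (L : Type*) [CommRing L] :
    Algebra.IsStandardSmoothOfRelativeDimension 1 L L[X] := by
  let v : Empty → MvPolynomial Unit L := Empty.elim
  let P : Algebra.PreSubmersivePresentation L
      (MvPolynomial Unit L ⧸ Ideal.span (Set.range v)) Unit Empty :=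
    .naive (v := v) Empty.elim (fun a => a.elim) _ Ideal.Quotient.mk_out
  let P' : Algebra.SubmersivePresentation L
      (MvPolynomial Unit L ⧸ Ideal.span (Set.range v)) Unit Empty :=
    ⟨P, by
        rw [P.jacobian_eq_jacobiMatrix_det]
        simp [Matrix.det_isEmpty]⟩
  have hbot : Ideal.span (Set.range v) = ⊥ := by simp
  let e : (MvPolynomial Unit L ⧸ Ideal.span (Set.range v)) ≃ₐ[L] L[X] :=
    ((Ideal.quotientEquivAlgOfEq L hbot).trans (AlgEquiv.quotientBot L _)).trans
      (MvPolynomial.uniqueAlgEquiv L Unit)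
  refine (P'.ofAlgEquiv e).isStandardSmoothOfRelativeDimension ?_
  simp [Algebra.Presentation.dimension]

end AffineLine

namespace AModuleScheme

variable {A : Type w} [CommRing A] {L : Type u} [Field L]

open Polynomial

namespace Coordinate

variable {G : AModuleScheme A L} (c : G.Coordinate)

/-- The affine line over `L`. -/
abbrev line (L : Type u) [Field L] : Scheme.{u} := Spec (CommRingCat.of L[X])

/-- The structure morphism of the affine line. -/
abbrev lineToSpec (L : Type u) [Field L] : line L ⟶ Spec (CommRingCat.of L) :=
  Spec.map (CommRingCat.ofHom (algebraMap L L[X]))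

/-- The morphism from the affine line defined by the generic point of the additive group. -/
def fromLine : line L ⟶ G.scheme :=
  (G.points (CommAlgCat.of L L[X]) ((c.pts L[X]).symm X)).1

theorem fromLine_toSpec : c.fromLine ≫ G.toSpec = lineToSpec L :=
  (G.points (CommAlgCat.of L L[X]) ((c.pts L[X]).symm X)).2

theorem points_eq (R : Type u) [CommRing R] [Algebra L R] (r : R) :
    (G.points (CommAlgCat.of L R) ((c.pts R).symm r)).1 =
      Spec.map (CommRingCat.ofHom (aeval (R := L) r).toRingHom) ≫ c.fromLine := by
  have h := G.points_map (CommAlgCat.ofHom (aeval (R := L) r)) ((c.pts L[X]).symm X)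
  have h' : (G.functor.map (CommAlgCat.ofHom (aeval (R := L) r))).hom ((c.pts L[X]).symm X) =
      (c.pts R).symm r := by
    apply (c.pts R).injective
    refine (c.pts_map (aeval r) _).trans ?_
    rw [AddEquiv.apply_symm_apply, AddEquiv.apply_symm_apply, aeval_X]
  rw [h'] at h
  exact h

/-- The composite with `G.toSpec` makes the global sections of `T` an `L`-algebra, over which `g` is
a point; its coordinate defines the morphism to the line. -/
theorem exists_fac_affine (T : Scheme.{u}) [IsAffine T] (g : T ⟶ G.scheme) :
    ∃ h : T ⟶ line L, h ≫ c.fromLine = g := by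
  let f : CommRingCat.of L ⟶ Γ(T, ⊤) := Spec.preimage (T.isoSpec.inv ≫ g ≫ G.toSpec)
  let _ : Algebra L Γ(T, ⊤) := f.hom.toAlgebra
  let R : CommAlgCat.{u} L := CommAlgCat.of L Γ(T, ⊤)
  let pt : RelativePoints G.toSpec R := ⟨T.isoSpec.inv ≫ g, by
    rw [Category.assoc]
    exact (Spec.map_preimage _).symm⟩
  refine ⟨T.isoSpec.hom ≫ Spec.map (CommRingCat.ofHom (aeval (R := L)
    (c.pts Γ(T, ⊤) ((G.points R).symm pt))).toRingHom), ?_⟩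
  rw [Category.assoc, ← c.points_eq Γ(T, ⊤), AddEquiv.symm_apply_apply]
  have : (G.points R) ((G.points R).symm pt) = pt := Equiv.apply_symm_apply _ _
  rw [this]
  simp [pt]

theorem eq_of_fac_affine (T : Scheme.{u}) [IsAffine T] (h h' : T ⟶ line L)
    (H : h ≫ c.fromLine = h' ≫ c.fromLine) : h = h' := by
  -- Both morphisms induce the same `L`-algebra structure on the global sections of `T`, so they can
  -- be compared as points over one algebra.
  have HL : h ≫ lineToSpec L = h' ≫ lineToSpec L := by
    rw [← c.fromLine_toSpec, ← Category.assoc, H, Category.assoc]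
  let F : CommRingCat.of L[X] ⟶ Γ(T, ⊤) := Spec.preimage (T.isoSpec.inv ≫ h)
  let F' : CommRingCat.of L[X] ⟶ Γ(T, ⊤) := Spec.preimage (T.isoSpec.inv ≫ h')
  have hF : Spec.map F = T.isoSpec.inv ≫ h := Spec.map_preimage _
  have hF' : Spec.map F' = T.isoSpec.inv ≫ h' := Spec.map_preimage _
  have hC : CommRingCat.ofHom (algebraMap L L[X]) ≫ F =
      CommRingCat.ofHom (algebraMap L L[X]) ≫ F' := by
    apply Spec.map_injective
    rw [Spec.map_comp, Spec.map_comp, hF, hF', Category.assoc, Category.assoc, HL]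
  let _ : Algebra L Γ(T, ⊤) := (F.hom.comp (algebraMap L L[X])).toAlgebra
  have h1 : F = CommRingCat.ofHom (aeval (R := L) (F.hom X)).toRingHom := by
    ext x
    · exact ((aeval (R := L) (F.hom X)).commutes x).symm
    · simp
  have h2 : F' = CommRingCat.ofHom (aeval (R := L) (F'.hom X)).toRingHom := by
    ext x
    · refine Eq.trans ?_ ((aeval (R := L) (F'.hom X)).commutes x).symm
      exact (congrArg (fun k => k.hom x) hC).symm
    · simp
  have key : F.hom X = F'.hom X := by
    apply (c.pts Γ(T, ⊤)).symm.injective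
    apply (G.points (CommAlgCat.of L Γ(T, ⊤))).injective
    apply Subtype.ext
    rw [c.points_eq, c.points_eq, ← h1, ← h2, hF, hF', Category.assoc, Category.assoc, H]
  have : F = F' := by rw [h1, h2, key]
  rw [← cancel_epi T.isoSpec.inv, ← hF, ← hF', this]

/-- Morphisms from affine schemes factor uniquely through `c.fromLine`. The factorizations over the
affine opens of `G.scheme` glue to a section, which is also a left inverse because the line itself
is affine. -/
instance isIso_fromLine : IsIso c.fromLine := by
  choose h hh using fun U : G.scheme.directedAffineCover.I₀ =>
    have : IsAffine (G.scheme.directedAffineCover.X U) := U.2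
    c.exists_fac_affine (G.scheme.directedAffineCover.X U) (G.scheme.directedAffineCover.f U)
  let s : G.scheme ⟶ line L := G.scheme.directedAffineCover.glueMorphismsOfLocallyDirected h
    fun {U V} hUV => by
      have : IsAffine (G.scheme.directedAffineCover.X U) := U.2
      apply c.eq_of_fac_affine
      rw [Category.assoc, hh, hh]
      exact Scheme.Cover.trans_map _ hUV
  have hs : s ≫ c.fromLine = 𝟙 _ := by
    refine G.scheme.directedAffineCover.hom_ext _ _ fun U => ?_
    rw [← Category.assoc, Scheme.OpenCover.map_glueMorphismsOfLocallyDirected, hh,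
      Category.comp_id]
  refine ⟨s, ?_, hs⟩
  apply c.eq_of_fac_affine
  rw [Category.assoc, hs, Category.comp_id, Category.id_comp]

theorem toSpec_eq : G.toSpec = inv c.fromLine ≫ lineToSpec L := by
  rw [← c.fromLine_toSpec, IsIso.inv_hom_id_assoc]

include c

theorem locallyOfFiniteType : LocallyOfFiniteType G.toSpec := by
  have : LocallyOfFiniteType (lineToSpec L) := by
    rw [HasRingHomProperty.Spec_iff (P := @LocallyOfFiniteType)]
    exact RingHom.finiteType_algebraMap.2 inferInstance
  rw [c.toSpec_eq]
  infer_instance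

theorem quasiCompact : QuasiCompact G.toSpec := by
  rw [c.toSpec_eq]
  infer_instance

theorem connectedSpace : ConnectedSpace G.scheme :=
  (Scheme.homeoOfIso (asIso c.fromLine)).surjective.connectedSpace
    (Scheme.homeoOfIso (asIso c.fromLine)).continuous

theorem smoothOfRelativeDimension : SmoothOfRelativeDimension 1 G.toSpec := by
  have : SmoothOfRelativeDimension 1 (lineToSpec L) := by
    rw [HasRingHomProperty.Spec_iff (P := @SmoothOfRelativeDimension 1)]
    exact RingHom.locally_of RingHom.isStandardSmoothOfRelativeDimension_respectsIso
      (algebraMap L L[X]) ((RingHom.isStandardSmoothOfRelativeDimension_algebraMap 1).2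
        (isStandardSmoothOfRelativeDimension_polynomial L))
  rw [c.toSpec_eq]
  -- Relative dimensions add under composition, and an isomorphism has relative dimension `0`.
  exact inferInstanceAs (SmoothOfRelativeDimension (0 + 1) (inv c.fromLine ≫ lineToSpec L))

end Coordinate

end AModuleScheme

/-! ### Bases of Tate modules from bases of the torsion. -/

section TateBasis

variable {A : Type w} [CommRing A] {ℓ : Ideal A} {π : A}

theorem pow_le_span_sup_pow_succ (hπ : π ∈ ℓ) (hℓ : ℓ ≤ Ideal.span {π} ⊔ ℓ ^ 2) (j : ℕ) :
    ℓ ^ j ≤ Ideal.span {π ^ j} ⊔ ℓ ^ (j + 1) := by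
  induction j with
  | zero => simp
  | succ j ih =>
    have h : Ideal.span {π ^ j} * ℓ ^ 2 ≤ ℓ ^ (j + 2) := by
      rw [pow_add ℓ j 2]
      exact Ideal.mul_mono_left ((Ideal.span_singleton_le_iff_mem _).2 (Ideal.pow_mem_pow hπ j))
    calc ℓ ^ (j + 1) = ℓ ^ j * ℓ := pow_succ _ _
      _ ≤ (Ideal.span {π ^ j} ⊔ ℓ ^ (j + 1)) * ℓ := Ideal.mul_mono_left ih
      _ = Ideal.span {π ^ j} * ℓ ⊔ ℓ ^ (j + 2) := by rw [Ideal.sup_mul, ← pow_succ]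
      _ ≤ Ideal.span {π ^ j} * (Ideal.span {π} ⊔ ℓ ^ 2) ⊔ ℓ ^ (j + 2) :=
        sup_le_sup_right (Ideal.mul_mono_right hℓ) _
      _ = Ideal.span {π ^ (j + 1)} ⊔ (Ideal.span {π ^ j} * ℓ ^ 2 ⊔ ℓ ^ (j + 2)) := by
        rw [Ideal.mul_sup, Ideal.span_singleton_mul_span_singleton, ← pow_succ, sup_assoc]
      _ ≤ _ := sup_le_sup_left (sup_le h le_rfl) _

theorem pow_le_span_sup_pow (hπ : π ∈ ℓ) (hℓ : ℓ ≤ Ideal.span {π} ⊔ ℓ ^ 2) (j k : ℕ) :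
    ℓ ^ j ≤ Ideal.span {π ^ j} ⊔ ℓ ^ (j + k) := by
  induction k with
  | zero => simp
  | succ k ih =>
    refine ih.trans (sup_le le_sup_left ((pow_le_span_sup_pow_succ hπ hℓ (j + k)).trans ?_))
    refine sup_le_sup_right ?_ _
    rw [Ideal.span_singleton_le_span_singleton]
    exact pow_dvd_pow _ (Nat.le_add_right j k)

variable {N : Type u} [AddCommGroup N] [Module A N]

/-- The component in `N` of index `n` of an element of the Tate module. -/
def TateModule.component (n : ℕ) : TateModule ℓ π N →+ N where
  toFun x := x.1 n
  map_zero' := rfl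
  map_add' _ _ := rfl

namespace TateModule

theorem ext_component {x y : TateModule ℓ π N} (h : ∀ n, component n x = component n y) : x = y :=
  Subtype.ext (funext fun n => Subtype.ext (h n))

theorem component_smul {n : ℕ} {c : AdicCompletion ℓ A} {a : A}
    (h : AdicCompletion.evalₐ ℓ n c = Ideal.Quotient.mk _ a) (x : TateModule ℓ π N) :
    component n (c • x) = a • component n x := by
  change ((AdicCompletion.evalₐ ℓ n c • x.1 n :
    Submodule.torsionBySet A N (ℓ ^ n : Ideal A)) : N) = _
  rw [h]
  rfl

theorem smul_component_succ (n : ℕ) (x : TateModule ℓ π N) :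
    π • component (n + 1) x = component n x := x.2 n

theorem component_map {N' : Type u} [AddCommGroup N'] [Module A N'] (f : N →ₗ[A] N') (n : ℕ)
    (x : TateModule ℓ π N) : component n (TateModule.map ℓ π f x) = f (component n x) := rfl

theorem smul_component_eq_zero {n : ℕ} {a : A} (ha : a ∈ ℓ ^ n) (x : TateModule ℓ π N) :
    a • component n x = 0 := (Submodule.mem_torsionBySet_iff _ _).1 (x.1 n).2 ⟨a, ha⟩

theorem pow_smul_component (m n : ℕ) (x : TateModule ℓ π N) :
    π ^ m • component (n + m) x = component n x := by
  induction m with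
  | zero => simp
  | succ m ih => rw [pow_succ, mul_smul, ← add_assoc, smul_component_succ, ih]

/-- A family of elements of the Tate module which at each level `n` is a basis over `A ⧸ ℓ ^ n`
of the `ℓ ^ n`-torsion. -/
structure IsLevelBasis {ι : Type*} [Fintype ι] (x : ι → TateModule ℓ π N) : Prop where
  mem_of_sum_eq_zero : ∀ n (c : ι → A), ∑ i, c i • component n (x i) = 0 → ∀ i, c i ∈ ℓ ^ n
  exists_eq_sum : ∀ n, ∀ y ∈ Submodule.torsionBySet A N (ℓ ^ n : Ideal A),
    ∃ c : ι → A, y = ∑ i, c i • component n (x i)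

/-- Divide `z` by `π` repeatedly, staying inside the `ℓ`-power torsion. -/
theorem exists_component_one_eq (hπ : π ∈ ℓ)
    (hsurj : ∀ n, ∀ y ∈ Submodule.torsionBySet A N (ℓ ^ n : Ideal A),
      ∃ x ∈ Submodule.torsionBySet A N (ℓ ^ (n + 1) : Ideal A), π • x = y)
    (z : N) (hz : z ∈ Submodule.torsionBySet A N (ℓ : Ideal A)) :
    ∃ x : TateModule ℓ π N, component 1 x = z := by
  choose! g hg hgπ using hsurj
  -- The recursion starts at level `1` with `z`, so its index is shifted by one; level `0` is filled
  -- with `0` afterwards.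
  let s : ∀ n, Submodule.torsionBySet A N (ℓ ^ (n + 1) : Ideal A) := fun n =>
    Nat.rec ⟨z, by simpa using hz⟩ (fun n y => ⟨g (n + 1) y, hg (n + 1) y y.2⟩) n
  let t : ∀ n, Submodule.torsionBySet A N (ℓ ^ n : Ideal A) := fun n =>
    match n with
    | 0 => 0
    | n + 1 => s n
  refine ⟨⟨t, fun n => ?_⟩, rfl⟩
  rcases n with _ | n
  · exact (Submodule.mem_torsionBySet_iff _ _).1 hz ⟨π, hπ⟩
  · exact hgπ (n + 1) (s n).1 (s n).2

variable {ι : Type*} [Fintype ι]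

/-- Induction on the level: multiplication by `π ^ n` sends level `n + 1` to level `1`, where the
hypotheses apply, and what remains is a statement at level `n`. -/
theorem isLevelBasis_of_component_one (hπ : π ∈ ℓ) (hℓ : ℓ ≤ Ideal.span {π} ⊔ ℓ ^ 2)
    (x : ι → TateModule ℓ π N)
    (hli : ∀ c : ι → A, ∑ i, c i • component 1 (x i) = 0 → ∀ i, c i ∈ ℓ)
    (hsp : ∀ y ∈ Submodule.torsionBySet A N (ℓ : Ideal A),
      ∃ c : ι → A, y = ∑ i, c i • component 1 (x i)) : IsLevelBasis x where
  mem_of_sum_eq_zero n := by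
    induction n with
    | zero => intro c _ i; simp
    | succ n ih =>
      intro c hc
      have h1 := hli c (by
        have := congrArg (π ^ n • ·) hc
        simpa only [Finset.smul_sum, smul_comm (π ^ n), smul_zero, add_comm n 1,
          pow_smul_component] using this)
      -- The coefficients lie in `ℓ`, hence are multiples of `π` up to `ℓ ^ (n + 1)`, which kills
      -- the components of index `n + 1`. Dividing by `π` leaves a relation at level `n`.
      have h2 (i : ι) : ∃ d, c i - π * d ∈ ℓ ^ (n + 1) := by
        have := pow_le_span_sup_pow hπ hℓ 1 n (by simpa using h1 i)
        obtain ⟨a, ha, b, hb, hab⟩ := Submodule.mem_sup.1 this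
        obtain ⟨d, rfl⟩ := Ideal.mem_span_singleton'.1 ha
        refine ⟨d, ?_⟩
        rw [← hab, pow_one, mul_comm, add_sub_cancel_left, add_comm n 1]
        exact hb
      choose d hd using h2
      have h3 := ih d (by
        rw [← hc]
        refine Finset.sum_congr rfl fun i _ => ?_
        have := smul_component_eq_zero (hd i) (x i)
        rw [sub_smul, sub_eq_zero] at this
        rw [this, mul_comm, mul_smul, smul_component_succ])
      intro i
      have := (ℓ ^ (n + 1)).add_mem (hd i) (by
        rw [pow_succ']; exact Ideal.mul_mem_mul hπ (h3 i))
      rwa [sub_add_cancel] at this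
  exists_eq_sum n := by
    induction n with
    | zero =>
      intro y hy
      refine ⟨0, ?_⟩
      have := (Submodule.mem_torsionBySet_iff _ _).1 hy ⟨1, by simp⟩
      simpa using this
    | succ n ih =>
      intro y hy
      rw [Submodule.mem_torsionBySet_iff] at hy
      obtain ⟨c, hc⟩ := hsp (π ^ n • y) ((Submodule.mem_torsionBySet_iff _ _).2 fun a => by
        have := hy ⟨a.1 * π ^ n, by rw [pow_succ']; exact Ideal.mul_mem_mul a.2 (Ideal.pow_mem_pow hπ n)⟩
        rw [← this, ← mul_smul])
      have h0 : π ^ n • (y - ∑ i, c i • component (n + 1) (x i)) = 0 := by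
        rw [smul_sub, hc, sub_eq_zero, Finset.smul_sum]
        refine Finset.sum_congr rfl fun i _ => ?_
        rw [smul_comm, add_comm n 1, pow_smul_component]
      -- The difference is killed by `π ^ n` and by `ℓ ^ (n + 1)`, hence by `ℓ ^ n`.
      obtain ⟨d, hd⟩ := ih (y - ∑ i, c i • component (n + 1) (x i))
        ((Submodule.mem_torsionBySet_iff _ _).2 fun a => by
          obtain ⟨e, he, b, hb, hab⟩ := Submodule.mem_sup.1 (pow_le_span_sup_pow hπ hℓ n 1 a.2)
          obtain ⟨d, rfl⟩ := Ideal.mem_span_singleton'.1 he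
          rw [← hab, add_smul, mul_smul, h0, smul_zero, zero_add, smul_sub, Finset.smul_sum]
          rw [sub_eq_zero, show b • y = 0 from hy ⟨b, hb⟩, Finset.sum_eq_zero]
          intro i _
          rw [smul_comm, smul_component_eq_zero hb, smul_zero])
      refine ⟨fun i => c i + d i * π, ?_⟩
      rw [sub_eq_iff_eq_add] at hd
      rw [hd, add_comm, ← Finset.sum_add_distrib]
      refine Finset.sum_congr rfl fun i _ => ?_
      rw [add_smul, mul_smul, smul_component_succ]

theorem component_sum_smul {n : ℕ} {c : ι → AdicCompletion ℓ A} {a : ι → A}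
    (h : ∀ i, AdicCompletion.evalₐ ℓ n (c i) = Ideal.Quotient.mk _ (a i))
    (x : ι → TateModule ℓ π N) :
    component n (∑ i, c i • x i) = ∑ i, a i • component n (x i) := by
  rw [map_sum]
  exact Finset.sum_congr rfl fun i _ => component_smul (h i) (x i)

/-- A family which is a basis at each level is a basis over the completion. -/
theorem IsLevelBasis.exists_basis {x : ι → TateModule ℓ π N} (hx : IsLevelBasis x) :
    ∃ b : Module.Basis ι (AdicCompletion ℓ A) (TateModule ℓ π N), ∀ i, b i = x i := by
  have hli : LinearIndependent (AdicCompletion ℓ A) x := by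
    rw [Fintype.linearIndependent_iff]
    intro c hc i
    refine AdicCompletion.ext_evalₐ fun n => ?_
    choose a ha using fun i => Ideal.Quotient.mk_surjective (AdicCompletion.evalₐ ℓ n (c i))
    have h := component_sum_smul (n := n) (fun i => (ha i).symm) x
    rw [hc, map_zero] at h
    rw [← ha, map_zero, Ideal.Quotient.eq_zero_iff_mem]
    exact hx.mem_of_sum_eq_zero n a h.symm i
  have hsp : ⊤ ≤ Submodule.span (AdicCompletion ℓ A) (Set.range x) := by
    intro t _
    choose a ha using fun n => hx.exists_eq_sum n (component n t) (t.1 n).2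
    -- Coefficients at level `n` are unique modulo `ℓ ^ n`, so the choices made at successive levels
    -- agree and define elements of the completion.
    have hcauchy (i : ι) (n : ℕ) : a n i ≡ a (n + 1) i [SMOD (ℓ ^ n • ⊤ : Submodule A A)] := by
      rw [SModEq.sub_mem, smul_eq_mul, Ideal.mul_top]
      refine hx.mem_of_sum_eq_zero n (fun i => a n i - a (n + 1) i) ?_ i
      have h1 := smul_component_succ n t
      rw [ha (n + 1), ha n, Finset.smul_sum] at h1
      simp only [sub_smul, Finset.sum_sub_distrib, ← h1]
      rw [sub_eq_zero]
      refine Finset.sum_congr rfl fun i _ => ?_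
      rw [smul_comm, smul_component_succ]
    have : t = ∑ i, AdicCompletion.mk ℓ A (AdicCompletion.AdicCauchySequence.mk ℓ A
        (fun n => a n i) (hcauchy i)) • x i := by
      refine ext_component fun n => ?_
      rw [component_sum_smul (a := a n) (fun i => AdicCompletion.evalₐ_mk _ _ _), ← ha]
    rw [this]
    exact Submodule.sum_mem _ fun i _ =>
      Submodule.smul_mem _ _ (Submodule.subset_span (Set.mem_range_self i))
  exact ⟨Module.Basis.mk hli hsp, fun i => Module.Basis.mk_apply hli hsp i⟩

/-- The determinant of an endomorphism of the Tate module, modulo `ℓ ^ n`. -/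
theorem evalₐ_det_map [DecidableEq ι] {x : ι → TateModule ℓ π N} (hx : IsLevelBasis x)
    (f : N →ₗ[A] N) (n : ℕ) (Q : Matrix ι ι A)
    (hQ : ∀ j, f (component n (x j)) = ∑ i, Q i j • component n (x i)) :
    AdicCompletion.evalₐ ℓ n (LinearMap.det (TateModule.map ℓ π f)) =
      Ideal.Quotient.mk _ Q.det := by
  obtain ⟨b, hb⟩ := hx.exists_basis
  rw [← LinearMap.det_toMatrix b, ← AlgHom.coe_toRingHom, RingHom.map_det, RingHom.map_det]
  congr 1
  ext i j
  choose a ha using fun i => Ideal.Quotient.mk_surjective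
    (AdicCompletion.evalₐ ℓ n (LinearMap.toMatrix b b (TateModule.map ℓ π f) i j))
  have h1 : TateModule.map ℓ π f (x j) =
      ∑ i, LinearMap.toMatrix b b (TateModule.map ℓ π f) i j • x i := by
    have := b.sum_repr (TateModule.map ℓ π f (b j))
    simp only [hb] at this
    rw [← this]
    simp [LinearMap.toMatrix_apply, hb]
  have h2 := congrArg (component n) h1
  rw [component_map, hQ, component_sum_smul (fun i => (ha i).symm)] at h2
  simp only [RingHom.mapMatrix_apply, Matrix.map_apply, AlgHom.coe_toRingHom]
  rw [← ha, eq_comm, Ideal.Quotient.eq]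
  refine hx.mem_of_sum_eq_zero n (fun i => Q i j - a i) ?_ i
  simp only [sub_smul, Finset.sum_sub_distrib, h2, sub_self]

end TateModule

end TateBasis

/-! ### Ranks, divisibility and the number of torsion points. -/

section Rank

/-- An Artinian ring is semilocal, so a projective module of constant rank over it is free. -/
theorem nonempty_basis_of_rankAtStalk_eq {C M : Type*} [CommRing C] [IsArtinianRing C]
    [AddCommGroup M] [Module C M] [Module.Finite C M] [Module.Projective C M] (r : ℕ)
    (h : ∀ q : PrimeSpectrum C, Module.rankAtStalk M q = r) :
    Nonempty (Module.Basis (Fin r) C M) := by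
  refine Module.nonempty_basis_of_flat_of_finrank_eq C M r fun P => ?_
  have := P.isMaximal
  let _ : Field (C ⧸ P.asIdeal) := Ideal.Quotient.field _
  have h1 := congrFun (Module.rankAtStalk_eq_finrank_of_free (R := C ⧸ P.asIdeal)
    (M := (C ⧸ P.asIdeal) ⊗[C] M)) ⊥
  rw [Module.rankAtStalk_baseChange, h] at h1
  simpa using h1.symm

attribute [local instance] Algebra.TensorProduct.rightAlgebra in
/-- The dimension of the reduction of a module of constant rank over `A ⊗ L`. -/
theorem finrank_quotient_smul_top {F A L M : Type*} [Field F] [CommRing A] [Algebra F A]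
    [Field L] [Algebra F L] [AddCommGroup M] [Module (A ⊗[F] L) M] [Module.Finite (A ⊗[F] L) M]
    [Module.Projective (A ⊗[F] L) M] [Module L M] [IsScalarTower L (A ⊗[F] L) M] (r : ℕ)
    (h : ∀ q : PrimeSpectrum (A ⊗[F] L), Module.rankAtStalk M q = r)
    (I : Ideal A) [Module.Finite F (A ⧸ I)] :
    Module.finrank L (M ⧸ (I.map (algebraMap A (A ⊗[F] L)) • ⊤ : Submodule (A ⊗[F] L) M)) =
      r * Module.finrank F (A ⧸ I) := by
  set K := I.map (algebraMap A (A ⊗[F] L)) with hK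
  let e0 := Algebra.TensorProduct.quotientTensorEquiv (R := F) F L A I
  let e1 : L ⊗[F] (A ⧸ I) ≃ₗ[L] ((A ⊗[F] L) ⧸ K) :=
    { (TensorProduct.comm F L (A ⧸ I)).toAddEquiv.trans e0.toAddEquiv with
      map_smul' l x := by
        induction x with
        | zero => simp
        | add x y hx hy =>
          rw [smul_add]
          exact (map_add ((TensorProduct.comm F L (A ⧸ I)).toAddEquiv.trans e0.toAddEquiv)
            _ _).trans ((congrArg₂ (· + ·) hx hy).trans (by
              rw [← smul_add]
              exact congrArg _ (map_add ((TensorProduct.comm F L (A ⧸ I)).toAddEquiv.trans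
                e0.toAddEquiv) x y).symm))
        | tmul m a =>
          obtain ⟨a, rfl⟩ := Ideal.Quotient.mk_surjective a
          change Ideal.Quotient.mk K (a ⊗ₜ[F] (l * m)) = l • Ideal.Quotient.mk K (a ⊗ₜ[F] m)
          change _ = Ideal.Quotient.mk K (1 ⊗ₜ[F] l * a ⊗ₜ[F] m)
          rw [Algebra.TensorProduct.tmul_mul_tmul, one_mul] }
  have hC : Module.finrank L ((A ⊗[F] L) ⧸ K) = Module.finrank F (A ⧸ I) := by
    rw [← e1.finrank_eq, Module.finrank_baseChange]
  have : Module.Finite L ((A ⊗[F] L) ⧸ K) := Module.Finite.equiv e1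
  -- This quotient is finite over `L`, so `M` becomes free of rank `r` over it and the dimension is
  -- a product.
  have : IsArtinianRing ((A ⊗[F] L) ⧸ K) := IsArtinianRing.of_finite L _
  obtain ⟨b⟩ := nonempty_basis_of_rankAtStalk_eq (C := (A ⊗[F] L) ⧸ K)
    (M := ((A ⊗[F] L) ⧸ K) ⊗[A ⊗[F] L] M) r fun q => by
      rw [Module.rankAtStalk_baseChange, h]
  let e2 := (TensorProduct.quotTensorEquivQuotSMul M K).restrictScalars L
  rw [← e2.finrank_eq, (b.equivFun.restrictScalars L).finrank_eq, Module.finrank_pi_fintype]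
  simp [hC]

end Rank

section Divisible

variable {A : Type*} [CommRing A] [IsDedekindDomain A]

/-- The right side contains `ℓ ^ 2`, so it is a power of `ℓ` with exponent at most `2`; the exponent
`2` is excluded by `π`. -/
theorem le_span_sup_sq {ℓ : Ideal A} (hℓ : ℓ.IsMaximal) {π : A} (hπ : π ∈ ℓ) (hπ2 : π ∉ ℓ ^ 2) :
    ℓ ≤ Ideal.span {π} ⊔ ℓ ^ 2 := by
  have h0 : ℓ ≠ ⊥ := by
    rintro rfl
    simp_all
  have hp : Prime ℓ := Ideal.prime_of_isPrime h0 hℓ.isPrime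
  have hdvd : Ideal.span {π} ⊔ ℓ ^ 2 ∣ ℓ ^ 2 := Ideal.dvd_iff_le.2 le_sup_right
  obtain ⟨i, hi, ha⟩ := (dvd_prime_pow hp 2).1 hdvd
  rw [associated_iff_eq] at ha
  rw [ha]
  have hi2 : i ≠ 2 := by
    rintro rfl
    exact hπ2 (ha ▸ Ideal.mem_sup_left (Ideal.mem_span_singleton_self π))
  calc ℓ = ℓ ^ 1 := (pow_one ℓ).symm
    _ ≤ ℓ ^ i := Ideal.pow_le_pow_right (by omega)

/-- In a divisible module, the multiplication by a uniformizer is surjective on the `ℓ`-power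
torsion. -/
theorem exists_smul_eq_of_divisible {N : Type*} [AddCommGroup N] [Module A N]
    (hN : ∀ a : A, a ≠ 0 → ∀ y : N, ∃ x : N, a • x = y)
    {ℓ : Ideal A} (hℓ : ℓ.IsMaximal) {π : A} (hπ : π ∈ ℓ) (hπ2 : π ∉ ℓ ^ 2) (n : ℕ) (y : N)
    (hy : y ∈ Submodule.torsionBySet A N (ℓ ^ n : Ideal A)) :
    ∃ x ∈ Submodule.torsionBySet A N (ℓ ^ (n + 1) : Ideal A), π • x = y := by
  have hπ0 : π ≠ 0 := fun h => hπ2 (h ▸ zero_mem _)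
  obtain ⟨x, rfl⟩ := hN π hπ0 y
  rw [Submodule.mem_torsionBySet_iff] at hy
  -- Write `(π) = ℓ * J` with `J` prime to `ℓ`. A preimage `x` of `y` may have torsion at the primes
  -- dividing `J`; multiplying it by `e ∈ J` with `e ≡ 1` modulo `ℓ ^ n` removes that torsion and
  -- does not change `y`.
  obtain ⟨J, hJ⟩ : ℓ ∣ Ideal.span {π} :=
    Ideal.dvd_iff_le.2 ((Ideal.span_singleton_le_iff_mem _).2 hπ)
  have hJℓ : ¬ J ≤ ℓ := fun h => hπ2 (by
    rw [← Ideal.span_singleton_le_iff_mem, hJ, sq]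
    exact Ideal.mul_mono_right h)
  have hcop : J ⊔ ℓ ^ n = ⊤ := by
    refine Ideal.sup_pow_eq_top ?_
    rw [sup_comm]
    exact hℓ.1.2 _ (lt_of_le_of_ne le_sup_left fun h => hJℓ (h ▸ le_sup_right))
  obtain ⟨e, he, d, hd, hed⟩ := Submodule.mem_sup.1 ((Ideal.eq_top_iff_one _).1 hcop)
  refine ⟨e • x, (Submodule.mem_torsionBySet_iff _ _).2 fun a => ?_, ?_⟩
  · have : a.1 * e ∈ Ideal.span {π} * ℓ ^ n := by
      rw [hJ, mul_right_comm, ← pow_succ']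
      exact Ideal.mul_mem_mul a.2 he
    obtain ⟨c, hc, hca⟩ := Ideal.mem_span_singleton_mul.1 this
    change a.1 • e • x = 0
    rw [← mul_smul, ← hca, mul_comm, mul_smul]
    exact hy ⟨c, hc⟩
  · have := hy ⟨d, hd⟩
    change d • π • x = 0 at this
    rw [smul_comm, ← add_zero (e • π • x), ← this, ← add_smul, hed, one_smul]

end Divisible

section FiniteQuotient

/-- Nonzero primes of `A` are maximal, so the quotient has Krull dimension zero; a finitely
generated algebra of dimension zero over a field is finite. -/
theorem finite_zmod_quotient (p : ℕ) [Fact p.Prime] {A : Type*} [CommRing A] [IsDedekindDomain A]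
    [Algebra (ZMod p) A] [Algebra.FiniteType (ZMod p) A] {I : Ideal A} (hI : I ≠ ⊥) :
    Module.Finite (ZMod p) (A ⧸ I) := by
  have : Algebra.FiniteType (ZMod p) (A ⧸ I) :=
    Algebra.FiniteType.of_surjective (Ideal.Quotient.mkₐ (ZMod p) I)
      (Ideal.Quotient.mkₐ_surjective (ZMod p) I)
  rw [Module.finite_iff_krullDimLE_zero]
  rw [Ring.krullDimLE_zero_iff]
  intro P hP
  have hc : (P.comap (Ideal.Quotient.mk I)).IsMaximal := by
    refine Ideal.IsPrime.isMaximal (Ideal.IsPrime.comap _) fun h => hI (eq_bot_iff.2 ?_)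
    rw [← h]
    intro x hx
    rw [Ideal.mem_comap, Ideal.Quotient.eq_zero_iff_mem.2 hx]
    exact P.zero_mem
  have hs : Function.Surjective (Ideal.Quotient.mk I) := Ideal.Quotient.mk_surjective
  have := Ideal.map_eq_top_or_isMaximal_of_surjective _ hs hc
  rw [Ideal.map_comap_of_surjective _ hs] at this
  exact this.resolve_left hP.ne_top

/-- A finite module over a field `A ⧸ ℓ` with `card (A ⧸ ℓ) ^ r` elements has a basis with `r`
elements. -/
theorem exists_residue_basis {A : Type w} [CommRing A] {ℓ : Ideal A} (hℓ : ℓ.IsMaximal)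
    [Finite (A ⧸ ℓ)] {N : Type u} [AddCommGroup N] [Module A N] (r : ℕ)
    (h : Nat.card (Submodule.torsionBySet A N (ℓ : Ideal A)) = Nat.card (A ⧸ ℓ) ^ r) :
    ∃ z : Fin r → N, (∀ i, z i ∈ Submodule.torsionBySet A N (ℓ : Ideal A)) ∧
      (∀ c : Fin r → A, ∑ i, c i • z i = 0 → ∀ i, c i ∈ ℓ) ∧
      ∀ y ∈ Submodule.torsionBySet A N (ℓ : Ideal A), ∃ c : Fin r → A, y = ∑ i, c i • z i := by
  let _ : Field (A ⧸ ℓ) := Ideal.Quotient.field ℓ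
  have hcard : 1 < Nat.card (A ⧸ ℓ) := Finite.one_lt_card
  have : Finite (Submodule.torsionBySet A N (ℓ : Ideal A)) :=
    Nat.finite_of_card_ne_zero (by rw [h]; positivity)
  have hr : Module.finrank (A ⧸ ℓ) (Submodule.torsionBySet A N (ℓ : Ideal A)) = r := by
    have := Module.natCard_eq_pow_finrank (K := A ⧸ ℓ)
      (V := Submodule.torsionBySet A N (ℓ : Ideal A))
    rw [h] at this
    exact (Nat.pow_right_injective hcard this).symm
  let b := Module.finBasisOfFinrankEq _ _ hr
  have key (c : Fin r → A) : ((∑ i, Ideal.Quotient.mk ℓ (c i) • b i :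
      Submodule.torsionBySet A N (ℓ : Ideal A)) : N) = ∑ i, c i • (b i : N) := by
    rw [AddSubmonoidClass.coe_finsetSum]
    rfl
  refine ⟨fun i => b i, fun i => (b i).2, fun c hc i => ?_, fun y hy => ?_⟩
  · rw [← key, ZeroMemClass.coe_eq_zero] at hc
    exact Ideal.Quotient.eq_zero_iff_mem.1 (Fintype.linearIndependent_iff.1 b.linearIndependent _ hc i)
  · choose c hc using fun i => Ideal.Quotient.mk_surjective (b.repr ⟨y, hy⟩ i)
    refine ⟨c, ?_⟩
    rw [← key]
    simp only [hc, b.sum_repr]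

end FiniteQuotient

namespace TwistedPoly

section Torsion

variable {p : ℕ} [hp : Fact p.Prime] {L : Type*} [Field L] [CharP L p]
  {A : Type*} [CommRing A] (φ : A →+* TwistedPoly p L)

/-- The left ideal generated by the image of an ideal of `A`. -/
def leftIdeal (I : Ideal A) : Submodule (TwistedPoly p L) (TwistedPoly p L) :=
  Submodule.span _ (φ '' I)

variable {φ}

theorem mul_mem_leftIdeal {I : Ideal A} {a : A} (ha : a ∈ I) (P : TwistedPoly p L) :
    P * φ a ∈ leftIdeal φ I :=
  Submodule.smul_mem _ P (Submodule.subset_span (Set.mem_image_of_mem φ ha))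

/-- The common zeros of the twisted polynomials `φ a`, `a ∈ I`. -/
def zeros (φ : A →+* TwistedPoly p L) (I : Ideal A) (Ω : Type*) [Field Ω] [Algebra L Ω] : Set Ω :=
  {x | ∀ a ∈ I, ev (φ a) x = 0}

theorem exists_zeros_eq (Ω : Type*) [Field Ω] [Algebra L Ω] {I : Ideal A} {a : A} (ha : a ∈ I)
    (ha0 : φ a ≠ 0) : ∃ g h : TwistedPoly p L, φ a = h * g ∧ zeros φ I Ω = {x | ev g x = 0} ∧
      Module.Finite L (TwistedPoly p L ⧸ (leftIdeal φ I).restrictScalars L) ∧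
      Module.finrank L (TwistedPoly p L ⧸ (leftIdeal φ I).restrictScalars L) = g.natDegree := by
  have : CharP Ω p := charP_of_injective_algebraMap (algebraMap L Ω).injective p
  have haJ : φ a ∈ leftIdeal φ I := Submodule.subset_span (Set.mem_image_of_mem φ ha)
  obtain ⟨g, hgJ, -, hg, hfin, hrank⟩ := exists_generator (leftIdeal φ I) fun h => ha0 (by
    rwa [h, Submodule.mem_bot] at haJ)
  obtain ⟨h, hh⟩ := hg _ haJ
  refine ⟨g, h, hh, Set.eq_of_subset_of_subset ?_ ?_, hfin, hrank⟩
  · intro x hx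
    change ev g x = 0
    have hspan : ∀ P ∈ Submodule.span (TwistedPoly p L) (φ '' I), ev P x = 0 := by
      intro P hP
      induction hP using Submodule.span_induction with
      | mem P hP =>
        obtain ⟨b, hb, rfl⟩ := hP
        exact hx b hb
      | zero => exact ev_zero_left x
      | add P Q _ _ hP hQ => rw [ev_add, hP, hQ, add_zero]
      | smul P Q _ hQ => rw [smul_eq_mul, ev_mul, hQ, ev_zero_right]
    exact hspan g hgJ
  · intro x hx b hb
    obtain ⟨k, hk⟩ := hg (φ b) (Submodule.subset_span (Set.mem_image_of_mem φ hb))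
    rw [hk, ev_mul, show ev g x = 0 from hx, ev_zero_right]

/-- The zeros are those of the generator of the left ideal. It divides `φ a` on the right, so its
linear coefficient is nonzero and it is separable. -/
theorem ncard_zeros (Ω : Type*) [Field Ω] [Algebra L Ω] [IsSepClosed Ω] {I : Ideal A} {a : A}
    (ha : a ∈ I) (ha0 : (φ a).coeff 0 ≠ 0) : (zeros φ I Ω).ncard =
      p ^ Module.finrank L (TwistedPoly p L ⧸ (leftIdeal φ I).restrictScalars L) := by
  obtain ⟨g, h, hg, hz, -, hr⟩ := exists_zeros_eq Ω ha (fun h => ha0 (by rw [h]; rfl))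
  rw [hz, hr, ncard_ker_eq]
  intro h0
  rw [hg, coeff_zero_mul, h0, mul_zero] at ha0
  exact ha0 rfl

end Torsion

end TwistedPoly

/-! ### Torsion and Tate modules of Drinfeld modules. -/

namespace AModuleScheme

variable {A : Type w} [CommRing A] {L : Type u} [Field L] {E : AModuleScheme A L}

namespace Coordinate

variable (c : E.Coordinate) (p : ℕ) [Fact p.Prime] [CharP L p]

open TwistedPoly

theorem mem_torsionBySet_iff {I : Ideal A} {Ω : Type u} [Field Ω] [Algebra L Ω] (x : E.Pts Ω) :
    x ∈ Submodule.torsionBySet A (E.Pts Ω) (I : Ideal A) ↔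
      c.pts Ω x ∈ zeros (c.hom p) I Ω := by
  rw [Submodule.mem_torsionBySet_iff]
  refine ⟨fun h a ha => ?_, fun h a => (c.pts Ω).injective ?_⟩
  · rw [← c.pts_smul, h ⟨a, ha⟩, map_zero]
  · rw [map_zero]
    exact (c.pts_smul p a.1 x).trans (h a.1 a.2)

variable [Algebra (ZMod p) A] [Algebra (ZMod p) L]

-- Under the isomorphism of `M(E)` with the twisted polynomials, the submodule `I • M(E)`
-- corresponds to the left ideal generated by the image of `I`, since `A` acts by right
-- multiplication.
attribute [local instance] Algebra.TensorProduct.rightAlgebra in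
theorem finrank_quotient_leftIdeal {r : ℕ} (hE : E.IsDrinfeld p r) (I : Ideal A)
    [Module.Finite (ZMod p) (A ⧸ I)] :
    Module.finrank L (TwistedPoly p L ⧸ (leftIdeal (c.hom p) I).restrictScalars L) =
      r * Module.finrank (ZMod p) (A ⧸ I) := by
  have h1 (l : L) (m : E.M) : ((1 : A) ⊗ₜ[ZMod p] l) • m = l • m :=
    Subtype.ext (funext fun R => AddMonoidHom.ext fun x => by
      rw [tmul_smul_apply, one_smul, M_scalar_apply])
  have h2 (a : A) (m : E.M) : (a ⊗ₜ[ZMod p] (1 : L)) • m = a • m :=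
    Subtype.ext (funext fun R => AddMonoidHom.ext fun x => by
      rw [tmul_smul_apply, one_smul, M_smul_apply])
  have : IsScalarTower L (A ⊗[ZMod p] L) E.M := ⟨fun l b m => by
    rw [← h1 l (b • m), ← mul_smul]
    rfl⟩
  have := hE.finite
  have := hE.projective
  rw [← finrank_quotient_smul_top (M := E.M) r hE.rank I]
  refine LinearEquiv.finrank_eq (Submodule.Quotient.equiv _
    ((I.map (algebraMap A (A ⊗[ZMod p] L)) • ⊤ : Submodule (A ⊗[ZMod p] L) E.M).restrictScalars L)
    (c.mEquiv p).symm ?_)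
  have hmul (a : A) (m : E.M) : c.mEquiv p ((a ⊗ₜ[ZMod p] (1 : L)) • m) =
      c.mEquiv p m * c.hom p a := by rw [h2, mEquiv_smul]
  ext m
  rw [Submodule.mem_map_equiv, LinearEquiv.symm_symm, Submodule.restrictScalars_mem,
    Submodule.restrictScalars_mem]
  constructor
  · intro hm
    suffices ∀ P ∈ leftIdeal (c.hom p) I, (c.mEquiv p).symm P ∈
        (I.map (algebraMap A (A ⊗[ZMod p] L)) • ⊤ : Submodule (A ⊗[ZMod p] L) E.M) by
      simpa using this _ hm
    intro P hP
    rw [leftIdeal, Finsupp.mem_span_iff_linearCombination] at hP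
    obtain ⟨f, rfl⟩ := hP
    rw [Finsupp.linearCombination_apply, Finsupp.sum, map_sum]
    refine Submodule.sum_mem _ fun s _ => ?_
    obtain ⟨_, a, ha, rfl⟩ := s
    rw [smul_eq_mul]
    have : (c.mEquiv p).symm (f ⟨c.hom p a, a, ha, rfl⟩ * c.hom p a) =
        (a ⊗ₜ[ZMod p] (1 : L)) • (c.mEquiv p).symm (f ⟨c.hom p a, a, ha, rfl⟩) := by
      rw [LinearEquiv.symm_apply_eq, hmul, LinearEquiv.apply_symm_apply]
    rw [this]
    exact Submodule.smul_mem_smul (Ideal.mem_map_of_mem (algebraMap A (A ⊗[ZMod p] L)) ha)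
      Submodule.mem_top
  · intro hm
    refine Submodule.smul_induction_on (p := fun m => c.mEquiv p m ∈ leftIdeal (c.hom p) I) hm
      (fun b hb m _ => ?_) fun x y hx hy => by rw [map_add]; exact Submodule.add_mem _ hx hy
    revert m
    refine Submodule.span_induction (p := fun b _ => ∀ m ∈ (⊤ : Submodule (A ⊗[ZMod p] L) E.M),
      c.mEquiv p (b • m) ∈ leftIdeal (c.hom p) I) ?_ ?_ ?_ ?_ hb
    · rintro _ ⟨a, ha, rfl⟩ m _
      exact (hmul a m).symm ▸ mul_mem_leftIdeal ha _
    · intro m _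
      rw [zero_smul, map_zero]
      exact Submodule.zero_mem _
    · intro b b' _ _ hb hb' m hm
      rw [add_smul, map_add]
      exact Submodule.add_mem _ (hb m hm) (hb' m hm)
    · intro b b' _ hb m _
      rw [smul_eq_mul, mul_comm, mul_smul]
      exact hb _ Submodule.mem_top

end Coordinate

/-- Rank zero would make `M(E)` vanish, whereas it is isomorphic to the nonzero ring of twisted
polynomials. -/
theorem IsDrinfeld.one_le {p : ℕ} [Fact p.Prime] [Algebra (ZMod p) A] [Algebra (ZMod p) L]
    {r : ℕ} (hE : E.IsDrinfeld p r) : 1 ≤ r := by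
  have : CharP L p := charP_of_injective_algebraMap (algebraMap (ZMod p) L).injective p
  obtain ⟨c⟩ := hE.additive.exists_coordinate
  by_contra h
  have := hE.finite
  have := hE.projective
  have h0 : Module.rankAtStalk (R := A ⊗[ZMod p] L) E.M = 0 := funext fun q => by
    rw [hE.rank q]
    simp only [Pi.zero_apply]
    omega
  rw [Module.rankAtStalk_eq_zero_iff_subsingleton] at h0
  have := (c.mEquiv p).symm.injective.subsingleton
  exact one_ne_zero (Subsingleton.elim (1 : TwistedPoly p L) 0)

end AModuleScheme

namespace AModuleScheme

open TwistedPoly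

variable {p : ℕ} [Fact p.Prime] {A : Type w} [CommRing A] [IsDedekindDomain A]
  [Algebra (ZMod p) A] [Algebra.FiniteType (ZMod p) A] {L : Type u} [Field L] [Algebra (ZMod p) L]
  [CharP L p] {E : AModuleScheme A L} {r : ℕ}

theorem Coordinate.natCard_torsionBySet (c : E.Coordinate) (hE : E.IsDrinfeld p r)
    (Ls : Type u) [Field Ls] [Algebra L Ls] [IsSepClosed Ls] {δ : A →+* L}
    (hδ : E.ActsOnLieThrough δ) (hδi : Function.Injective δ) {I : Ideal A} (hI : I ≠ ⊥) :
    Nat.card (Submodule.torsionBySet A (E.Pts Ls) (I : Ideal A)) = Nat.card (A ⧸ I) ^ r := by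
  have := finite_zmod_quotient p hI
  obtain ⟨a, ha, ha0⟩ := Submodule.exists_mem_ne_zero_of_ne_bot hI
  have h1 : Nat.card (Submodule.torsionBySet A (E.Pts Ls) (I : Ideal A)) =
      (zeros (c.hom p) I Ls).ncard :=
    (Nat.card_congr ((c.pts Ls).toEquiv.subtypeEquiv fun x => c.mem_torsionBySet_iff p x)).trans
      (Nat.card_coe_set_eq _)
  rw [h1, ncard_zeros Ls ha (by rw [c.coeff_zero_hom p hδ]; exact (map_ne_zero_iff δ hδi).2 ha0),
    c.finrank_quotient_leftIdeal p hE, mul_comm, pow_mul,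
    Module.natCard_eq_pow_finrank (K := ZMod p) (V := A ⧸ I), Nat.card_zmod]

theorem Coordinate.exists_isLevelBasis (c : E.Coordinate) (hE : E.IsDrinfeld p r)
    (Ls : Type u) [Field Ls] [Algebra L Ls] [IsSepClosed Ls] {δ : A →+* L}
    (hδ : E.ActsOnLieThrough δ) (hδi : Function.Injective δ) {ℓ : Ideal A} (hℓ : ℓ.IsMaximal)
    {π : A} (hπ : π ∈ ℓ) (hπ2 : π ∉ ℓ ^ 2) :
    ∃ x : Fin r → E.Tate Ls ℓ π, TateModule.IsLevelBasis x := by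
  have hℓ0 : ℓ ≠ ⊥ := by
    rintro rfl
    simp_all
  have := finite_zmod_quotient p hℓ0
  have : Finite (A ⧸ ℓ) := Module.finite_of_finite (ZMod p)
  obtain ⟨z, hz, hli, hsp⟩ := exists_residue_basis hℓ r
    (c.natCard_torsionBySet hE Ls hδ hδi hℓ0)
  have hdiv (a : A) (ha : a ≠ 0) (y : E.Pts Ls) : ∃ x : E.Pts Ls, a • x = y := by
    obtain ⟨x, hx⟩ := ev_surjective (Ω := Ls) (g := c.hom p a)
      (by rw [c.coeff_zero_hom p hδ]; exact (map_ne_zero_iff δ hδi).2 ha) (c.pts Ls y)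
    refine ⟨(c.pts Ls).symm x, (c.pts Ls).injective ?_⟩
    rw [c.pts_smul p, AddEquiv.apply_symm_apply, hx]
  choose x hx using fun i => TateModule.exists_component_one_eq (π := π) hπ
    (fun n y hy => exists_smul_eq_of_divisible hdiv hℓ hπ hπ2 n y hy) (z i) (hz i)
  refine ⟨x, TateModule.isLevelBasis_of_component_one hπ (le_span_sup_sq hℓ hπ hπ2) x ?_ ?_⟩
  · simpa only [hx] using hli
  · simpa only [hx] using hsp

theorem IsDrinfeld.isPreElementary (hE : E.IsDrinfeld p r)
    (Ls : Type u) [Field Ls] [Algebra L Ls] [IsSepClosed Ls] {δ : A →+* L}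
    (hδ : E.IsCharacteristicMorphism δ) (hδi : Function.Injective δ) :
    E.IsPreElementary Ls r := by
  obtain ⟨c⟩ := hE.additive.exists_coordinate
  refine ⟨c.locallyOfFiniteType, c.quasiCompact, c.connectedSpace, c.smoothOfRelativeDimension,
    hE.one_le, δ, hδ, fun ℓ hℓ _ π hπ hπ2 => ?_⟩
  obtain ⟨x, hx⟩ := c.exists_isLevelBasis hE Ls hδ.1 hδi hℓ hπ hπ2
  obtain ⟨b, -⟩ := hx.exists_basis
  exact ⟨b⟩

end AModuleScheme

/-! ### The determinant of Frobenius over a finite field. -/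

section DualBases

/-- The quotients `A ⧸ ℓ ^ n` of a Dedekind domain are Frobenius algebras. -/
theorem exists_dual_bases {F A : Type*} [Field F] [CommRing A] [IsDedekindDomain A] [Algebra F A]
    {ℓ : Ideal A} (hℓ : ℓ.IsMaximal) (hℓ0 : ℓ ≠ ⊥) (n : ℕ) [Module.Finite F (A ⧸ ℓ ^ (n + 1))] :
    ∃ (μ : (A ⧸ ℓ ^ (n + 1)) →ₗ[F] F) (d : ℕ) (b b' : Module.Basis (Fin d) F (A ⧸ ℓ ^ (n + 1))),
      ∀ i j, μ (b i * b' j) = if i = j then 1 else 0 := by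
  -- Every nonzero ideal of the quotient contains the class of `z`. A functional `μ` that is nonzero
  -- at `z` therefore makes the form `μ (x * y)` nondegenerate.
  obtain ⟨z, hz, hz'⟩ : ∃ z ∈ ℓ ^ n, z ∉ ℓ ^ (n + 1) :=
    SetLike.exists_of_lt (Ideal.pow_right_strictAnti ℓ hℓ0 hℓ.ne_top (Nat.lt_succ_self n))
  obtain ⟨μ, hμ⟩ : ∃ μ : (A ⧸ ℓ ^ (n + 1)) →ₗ[F] F, μ (Ideal.Quotient.mk (ℓ ^ (n + 1)) z) ≠ 0 := by
    by_contra! h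
    exact hz' (Ideal.Quotient.eq_zero_iff_mem.1
      ((Module.forall_dual_apply_eq_zero_iff F _).1 h))
  let B : LinearMap.BilinForm F (A ⧸ ℓ ^ (n + 1)) := (LinearMap.mul F _).compr₂ μ
  have hB (x y) : B x y = μ (x * y) := rfl
  have hsymm : B.IsSymm := ⟨fun x y => by
    rw [hB, hB, mul_comm]⟩
  have hsep (y : A ⧸ ℓ ^ (n + 1)) (hy : ∀ x, B x y = 0) : y = 0 := by
    obtain ⟨y, rfl⟩ := Ideal.Quotient.mk_surjective y
    have hp : Prime ℓ := Ideal.prime_of_isPrime hℓ0 hℓ.isPrime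
    have hdvd : Ideal.span {y} ⊔ ℓ ^ (n + 1) ∣ ℓ ^ (n + 1) := Ideal.dvd_iff_le.2 le_sup_right
    obtain ⟨i, hi, ha⟩ := (dvd_prime_pow hp _).1 hdvd
    rw [associated_iff_eq] at ha
    rcases hi.eq_or_lt with rfl | hi
    · exact Ideal.Quotient.eq_zero_iff_mem.2
        (ha ▸ Ideal.mem_sup_left (Ideal.mem_span_singleton_self y))
    · have hzi : z ∈ Ideal.span {y} ⊔ ℓ ^ (n + 1) :=
        ha ▸ Ideal.pow_le_pow_right (by omega : i ≤ n) hz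
      obtain ⟨u, hu, v, hv, rfl⟩ := Submodule.mem_sup.1 hzi
      obtain ⟨x, rfl⟩ := Ideal.mem_span_singleton'.1 hu
      refine absurd (hy (Ideal.Quotient.mk _ x)) ?_
      rwa [map_add, Ideal.Quotient.eq_zero_iff_mem.2 hv, add_zero, map_mul] at hμ
  have hnd : B.Nondegenerate := ⟨fun x hx => hsep x fun y => by
    rw [hB, mul_comm, ← hB, hx], fun y hy => hsep y hy⟩
  let b := Module.finBasis F (A ⧸ ℓ ^ (n + 1))
  exact ⟨μ, _, b, LinearMap.BilinForm.dualBasis B hnd b, fun i j => by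
    rw [← hB, LinearMap.BilinForm.apply_dualBasis_right hnd hsymm]⟩

end DualBases

namespace TwistedPoly

theorem coeff_sum {p : ℕ} {R : Type*} [CommRing R] {ι : Type*} (s : Finset ι)
    (P : ι → TwistedPoly p R) (j : ℕ) : (∑ i ∈ s, P i).coeff j = ∑ i ∈ s, (P i).coeff j := by
  classical
  induction s using Finset.induction_on with
  | empty => simp
  | insert a s ha ih => rw [Finset.sum_insert ha, Finset.sum_insert ha, coeff_add, ih]

theorem coeff_sum_monomial {p : ℕ} {R : Type*} [CommRing R] {n : ℕ} (y : Fin n → R) (i : Fin n) :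
    (∑ i : Fin n, monomial (i : ℕ) (y i) : TwistedPoly p R).coeff i = y i := by
  rw [coeff_sum, Finset.sum_eq_single i
    (fun j _ hj => by rw [coeff_monomial, if_neg fun h => hj (Fin.ext h)])
    (fun h => absurd (Finset.mem_univ _) h), coeff_monomial, if_pos rfl]

theorem coeff_sum_monomial_of_le {p : ℕ} {R : Type*} [CommRing R] {n : ℕ} (y : Fin n → R) {j : ℕ}
    (hj : n ≤ j) : (∑ i : Fin n, monomial (i : ℕ) (y i) : TwistedPoly p R).coeff j = 0 := by
  rw [coeff_sum]
  exact Finset.sum_eq_zero fun i _ => by rw [coeff_monomial, if_neg (by omega)]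

theorem eq_sum_monomial {p : ℕ} {R : Type*} [CommRing R] {P : TwistedPoly p R} {n : ℕ}
    (h : ∀ i, n ≤ i → P.coeff i = 0) : P = ∑ i : Fin n, monomial (i : ℕ) (P.coeff i) := by
  ext j
  by_cases hj : j < n
  · exact (coeff_sum_monomial (fun i : Fin n => P.coeff i) ⟨j, hj⟩).symm
  · rw [h j (not_lt.1 hj), coeff_sum_monomial_of_le _ (not_lt.1 hj)]

/-- Over a finite field, the twisted polynomials form a finitely generated projective module under
right multiplication by the values of `φ`. -/
theorem exists_right_dual_basis {p : ℕ} [Fact p.Prime] {k : Type*} [Field k] [Finite k] [CharP k p]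
    {A : Type*} [CommRing A] [IsDedekindDomain A] (φ : A →+* TwistedPoly p k)
    (hφ : Function.Injective φ) {t : A} (ht : 0 < (φ t).natDegree) :
    ∃ (N : ℕ) (m : Fin N → TwistedPoly p k) (g : TwistedPoly p k →+ (Fin N → A)),
      (∀ a P, g (P * φ a) = a • g P) ∧ ∀ P, P = ∑ i, m i * φ (g P i) := by
  let _ : Module A (TwistedPoly p k) :=
    { smul := fun a P => P * φ a
      one_smul := fun P => show P * φ 1 = P by rw [map_one, mul_one]
      mul_smul := fun a b P => show P * φ (a * b) = P * φ b * φ a by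
        rw [mul_comm, map_mul, mul_assoc]
      smul_zero := fun a => zero_mul _
      smul_add := fun a P Q => add_mul _ _ _
      add_smul := fun a b P => show P * φ (a + b) = P * φ a + P * φ b by rw [map_add, mul_add]
      zero_smul := fun P => show P * φ 0 = 0 by rw [map_zero, mul_zero] }
  have smul_eq (a : A) (P : TwistedPoly p k) : a • P = P * φ a := rfl
  have : Module.IsTorsionFree A (TwistedPoly p k) := by
    refine ⟨fun a ha P Q h => ?_⟩
    simp only [smul_eq] at h
    exact mul_right_cancel₀ ((map_ne_zero_iff φ hφ).2 ha.ne_zero) h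
  have ht0 : φ t ≠ 0 := by
    intro h
    rw [h] at ht
    exact lt_irrefl 0 ht
  have : Module.Finite A (TwistedPoly p k) := by
    -- Right division by `φ t` reduces every degree below that of `φ t`. Since `A` need not contain
    -- `k`, all coefficients are allowed in the generators, a finite set because `k` is finite.
    let s : Set (TwistedPoly p k) :=
      Set.range fun x : Fin (φ t).natDegree × k => monomial (x.1 : ℕ) x.2
    refine ⟨(Submodule.fg_def).2 ⟨s, Set.finite_range _, eq_top_iff.2 fun P _ => ?_⟩⟩
    suffices ∀ n, ∀ P : TwistedPoly p k, P.natDegree < n → P ∈ Submodule.span A s from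
      this _ P (Nat.lt_succ_self _)
    intro n
    induction n with
    | zero => exact fun P h => absurd h (Nat.not_lt_zero _)
    | succ n ih =>
      intro P hP
      obtain ⟨h, R, rfl, hR⟩ := exists_eq_mul_add ht0 P
      have hRs : R ∈ Submodule.span A s := by
        rw [eq_sum_monomial hR]
        exact Submodule.sum_mem _ fun i _ => Submodule.subset_span ⟨(i, _), rfl⟩
      refine Submodule.add_mem _ ?_ hRs
      by_cases hh : h = 0
      · rw [hh, zero_mul]
        exact Submodule.zero_mem _
      refine Submodule.smul_mem _ t (ih h ?_)
      have h1 := natDegree_mul hh ht0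
      have h2 : (h * φ t).natDegree ≤ (h * φ t + R).natDegree := by
        refine le_natDegree_of_ne_zero ?_
        rw [coeff_add, hR _ (by omega), add_zero, coeff_natDegree, ne_eq, leadingCoeff_eq_zero]
        exact mul_ne_zero hh ht0
      omega
  have : Module.FinitePresentation A (TwistedPoly p k) := Module.finitePresentation_of_finite _ _
  -- Torsion-free modules over a Dedekind domain are flat.
  have : Module.Projective A (TwistedPoly p k) := Module.Flat.projective_of_finitePresentation
  obtain ⟨N, f, g, -, -, hfg⟩ := Module.Finite.exists_comp_eq_id_of_projective A (TwistedPoly p k)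
  refine ⟨N, fun i => f (Pi.single i 1), g.toAddMonoidHom, fun a P => map_smul g a P, fun P => ?_⟩
  have h := LinearMap.congr_fun hfg P
  rw [LinearMap.comp_apply, LinearMap.id_apply, pi_eq_sum_univ' (g P), map_sum] at h
  refine h.symm.trans (Finset.sum_congr rfl fun i _ => ?_)
  rw [map_smul]
  rfl

/-- A twisted polynomial of degree less than `n` with at least `p ^ n` zeros vanishes. -/
theorem eq_zero_of_le_ncard {p : ℕ} [Fact p.Prime] {k : Type*} [Field k] [CharP k p]
    {P : TwistedPoly p k} {n : ℕ} (h : ∀ i, n ≤ i → P.coeff i = 0) {s : Set k}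
    (hs : p ^ n ≤ s.ncard) (hP : ∀ x ∈ s, ev P x = 0) : P = 0 := by
  by_contra h0
  have h1 := (Set.ncard_le_ncard (t := {x : k | ev P x = 0}) hP (finite_ker h0)).trans
    (ncard_ker_le h0)
  have h2 := (Nat.pow_le_pow_iff_right (Fact.out : p.Prime).one_lt).1 (hs.trans h1)
  exact h0 (leadingCoeff_eq_zero.1 (h _ h2))

end TwistedPoly

section Companion

open Matrix in
/-- The determinant of an endomorphism of a direct factor that shifts `f + 1` blocks of `r`
coordinates, the last block being mapped to the first one through `Q`. -/
theorem det_one_add_sub_of_shift {R : Type*} [CommRing R] {f r N : ℕ}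
    (Q : Matrix (Fin r) (Fin r) R) (B : Matrix (Fin r × Fin (f + 1)) (Fin N) R)
    (B' : Matrix (Fin N) (Fin r × Fin (f + 1)) R) (T : Matrix (Fin N) (Fin N) R)
    (hB : B * B' = 1) (hT : B' * B * T = T)
    (hshift : ∀ j (i : Fin f) s, (B * T) (j, i.castSucc) s = B (j, i.succ) s)
    (hlast : ∀ j s, (B * T) (j, Fin.last f) s = ∑ i, Q i j * B (i, 0) s) :
    (1 + T - B' * B).det =
      (Equiv.Perm.sign ((Equiv.refl (Fin r)).prodCongr (finRotate (f + 1))) : ℤ) * Q.det := by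
  -- The matrix `B' * B` is a projector whose image contains that of `T`, so `1 + T - B' * B` is `T`
  -- on this image and the identity modulo it. The identity `det (1 + X * Y) = det (1 + Y * X)`
  -- turns its determinant into that of `B * T * B'`.
  have h1 : 1 + T - B' * B = 1 + B' * (B * T - B) := by
    rw [Matrix.mul_sub, ← Matrix.mul_assoc, hT, add_sub_assoc]
  have h2 : 1 + (B * T - B) * B' = B * T * B' := by
    rw [Matrix.sub_mul, hB]
    abel
  -- Cyclically, block `i` of `B * T` is block `i + 1` of `B`; only block `0`, which becomes the
  -- last one, is transformed, by `Qᵀ`.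
  have h3 : B * T = (blockDiagonal (fun i : Fin (f + 1) => if i = 0 then Qᵀ else 1)).submatrix
      ((Equiv.refl (Fin r)).prodCongr (finRotate (f + 1))) id * B := by
    ext ⟨j, i⟩ s
    conv_rhs => rw [Matrix.mul_apply, Fintype.sum_prod_type]
    simp only [submatrix_apply, id, Equiv.prodCongr_apply, Prod.map_apply, Equiv.refl_apply,
      blockDiagonal_apply, ite_mul, zero_mul, Finset.sum_ite_eq, Finset.mem_univ, if_true]
    induction i using Fin.lastCases with
    | last =>
      rw [hlast]
      simp [Matrix.transpose_apply]
    | cast i =>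
      rw [hshift]
      simp [Fin.succ_ne_zero, Matrix.one_apply]
  rw [h1, det_one_add_mul_comm, h2, h3, Matrix.mul_assoc, hB, Matrix.mul_one, det_permute,
    det_blockDiagonal]
  congr 1
  rw [Finset.prod_eq_single 0 (fun i _ hi => by rw [if_neg hi, det_one])
    (fun h => absurd (Finset.mem_univ _) h), if_pos rfl, det_transpose]

end Companion

section DualCoord

variable {p : ℕ} [Fact p.Prime] {Λ Ω W : Type*} [CommRing Λ] [Algebra (ZMod p) Λ] [Field Ω]
  [Algebra (ZMod p) Ω] [AddCommGroup W] [Module Λ W] {d r : ℕ}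
  (b b' : Module.Basis (Fin d) (ZMod p) Λ) (w : Fin r → W)

/-- The coordinates of additive maps from a free `Λ`-module to a field, with respect to dual bases
of `Λ` over the prime field. -/
def dualCoord : (W →+ Ω) →ₗ[Ω] (Fin r → Ω ⊗[ZMod p] Λ) where
  toFun h j := ∑ m, h (b m • w j) ⊗ₜ b' m
  map_add' h h' := funext fun j => by
    simp only [AddMonoidHom.add_apply, TensorProduct.add_tmul, Finset.sum_add_distrib,
      Pi.add_apply]
  map_smul' c h := funext fun j => by
    simp only [AddMonoidHom.smul_apply, RingHom.id_apply, Pi.smul_apply, Finset.smul_sum,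
      TensorProduct.smul_tmul']

theorem dualCoord_apply (h : W →+ Ω) (j : Fin r) :
    dualCoord b b' w h j = ∑ m, h (b m • w j) ⊗ₜ[ZMod p] b' m := rfl

variable {b b'} {μ : Λ →ₗ[ZMod p] ZMod p} (hμ : ∀ i j, μ (b i * b' j) = if i = j then 1 else 0)
include hμ

theorem sum_dual_smul (x : Λ) : ∑ m, μ (x * b' m) • b m = x := by
  conv_rhs => rw [← b.sum_repr x]
  refine Finset.sum_congr rfl fun m _ => ?_
  congr 1
  have := congrArg (fun y => μ (y * b' m)) (b.sum_repr x)
  simpa only [Finset.sum_mul, map_sum, smul_mul_assoc, map_smul, hμ, smul_eq_mul, mul_ite, mul_one,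
    mul_zero, Finset.sum_ite_eq', Finset.mem_univ, if_true] using this.symm

theorem sum_dual_smul' (x : Λ) : ∑ m, μ (b m * x) • b' m = x := by
  conv_rhs => rw [← b'.sum_repr x]
  refine Finset.sum_congr rfl fun m _ => ?_
  congr 1
  have := congrArg (fun y => μ (b m * y)) (b'.sum_repr x)
  simpa only [Finset.mul_sum, map_sum, mul_smul_comm, map_smul, hμ, smul_eq_mul, mul_ite, mul_one,
    mul_zero, Finset.sum_ite_eq, Finset.mem_univ, if_true] using this.symm

/-- Multiplication by `a` is self-adjoint for the form `μ (x * y)`, so it passes from one dual basis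
to the other. -/
theorem sum_tmul_dual (h : Λ →+ Ω) (a : Λ) :
    ∑ m, h (b m * a) ⊗ₜ[ZMod p] b' m = ((1 : Ω) ⊗ₜ a) * ∑ m, h (b m) ⊗ₜ[ZMod p] b' m := by
  have hs (c : ZMod p) (x : Λ) : h (c • x) = c • h x := ZMod.map_smul h c x
  calc ∑ m, h (b m * a) ⊗ₜ[ZMod p] b' m
      = ∑ m, ∑ m', μ (b m * a * b' m') • h (b m') ⊗ₜ[ZMod p] b' m := by
        refine Finset.sum_congr rfl fun m _ => ?_
        conv_lhs => rw [← sum_dual_smul hμ (b m * a)]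
        simp only [map_sum, hs, TensorProduct.sum_tmul, TensorProduct.smul_tmul']
    _ = ∑ m', h (b m') ⊗ₜ[ZMod p] (a * b' m') := by
        rw [Finset.sum_comm]
        refine Finset.sum_congr rfl fun m' _ => ?_
        conv_rhs => rw [← sum_dual_smul' hμ (a * b' m')]
        simp only [TensorProduct.tmul_sum, TensorProduct.tmul_smul, mul_assoc]
    _ = _ := by
        rw [Finset.mul_sum]
        simp only [Algebra.TensorProduct.tmul_mul_tmul, one_mul]

theorem dualCoord_comp_smul (h : W →+ Ω) (a : Λ) (j : Fin r) :
    dualCoord b b' w (h.comp (DistribSMul.toAddMonoidHom W a)) j =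
      ((1 : Ω) ⊗ₜ a) * dualCoord b b' w h j := by
  rw [dualCoord_apply]
  refine Eq.trans ?_ (sum_tmul_dual hμ (h.comp ((smulAddHom Λ W).flip (w j)) : Λ →+ Ω) a)
  refine Finset.sum_congr rfl fun m _ => ?_
  refine congrArg (fun y => h y ⊗ₜ[ZMod p] b' m) ?_
  show a • b m • w j = (b m * a) • w j
  rw [smul_smul, mul_comm]

theorem dualCoord_comp (h : W →+ Ω) (F : W →ₗ[Λ] W) (Q : Matrix (Fin r) (Fin r) Λ)
    (hQ : ∀ j, F (w j) = ∑ i, Q i j • w i) (j : Fin r) :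
    dualCoord b b' w (h.comp F.toAddMonoidHom) j =
      ∑ i, ((1 : Ω) ⊗ₜ Q i j) * dualCoord b b' w h i := by
  have h1 (i : Fin r) := dualCoord_comp_smul w hμ h (Q i j) i
  rw [← Finset.sum_congr rfl fun i _ => h1 i]
  simp only [dualCoord_apply]
  rw [Finset.sum_comm]
  refine Finset.sum_congr rfl fun m _ => ?_
  rw [← TensorProduct.sum_tmul]
  congr 1
  show h (F (b m • w j)) = ∑ i, h (Q i j • b m • w i)
  rw [map_smul, hQ, Finset.smul_sum, map_sum]
  refine Finset.sum_congr rfl fun i _ => ?_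
  rw [smul_comm]

omit hμ in
theorem dualCoord_injective (hw : ⊤ ≤ Submodule.span Λ (Set.range w)) :
    Function.Injective (dualCoord (Ω := Ω) b b' w) := by
  rw [injective_iff_map_eq_zero]
  intro h hh
  have h1 (j : Fin r) (m : Fin d) : h (b m • w j) = 0 := by
    have := congrFun hh j
    rw [dualCoord_apply] at this
    have h2 := Fintype.linearIndependent_iff.1
      (Algebra.TensorProduct.basis Ω b').linearIndependent (fun m => h (b m • w j)) (by
        simpa [TensorProduct.smul_tmul'] using this)
    exact h2 m
  have h3 (j : Fin r) (x : Λ) : h (x • w j) = 0 := by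
    rw [← b.sum_repr x, Finset.sum_smul, map_sum]
    refine Finset.sum_eq_zero fun m _ => ?_
    have := ZMod.map_smul (h.comp ((smulAddHom Λ W).flip (w j))) (b.repr x m) (b m)
    exact this.trans (by simp [h1])
  ext y
  obtain ⟨c, rfl⟩ := (Submodule.mem_span_range_iff_exists_fun Λ).1 (hw (Submodule.mem_top (x := y)))
  rw [map_sum]
  exact Finset.sum_eq_zero fun j _ => h3 j _

end DualCoord

namespace TwistedPoly

section FrobeniusDet

variable {p : ℕ} [hp : Fact p.Prime] {k : Type*} [Field k] [CharP k p] [Algebra (ZMod p) k]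
  {Ω : Type*} [Field Ω] [Algebra k Ω]

/-- A basis of a finite field over its prime field stays independent after evaluating the powers of
the Frobenius endomorphism: the Moore matrix of the basis is invertible. -/
theorem moore_injective [Finite k] {f : ℕ} (κ : Module.Basis (Fin f) (ZMod p) k) (c : Fin f → Ω)
    (hc : ∀ i : Fin f, ∑ u, c u * algebraMap k Ω (κ u) ^ p ^ (i : ℕ) = 0) : c = 0 := by
  have : CharP Ω p := charP_of_injective_algebraMap (algebraMap k Ω).injective p
  let M : Matrix (Fin f) (Fin f) Ω := Matrix.of fun i u => algebraMap k Ω (κ u) ^ p ^ (i : ℕ)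
  have hM : M.det ≠ 0 := by
    intro h0
    obtain ⟨y, hy, hyM⟩ := Matrix.exists_vecMul_eq_zero_iff.2 h0
    refine hy (funext fun i => ?_)
    -- A left null vector of the Moore matrix gives a twisted polynomial of degree less than `f`
    -- that vanishes on the basis, hence on all `p ^ f` elements of `k`.
    let P : TwistedPoly p Ω := ∑ i : Fin f, monomial (i : ℕ) (y i)
    have hev (x : Ω) : ev P x = ∑ i : Fin f, y i * x ^ p ^ (i : ℕ) := by
      rw [ev_sum]
      simp
    let h : k →+ Ω := (evHom P).comp (algebraMap k Ω).toAddMonoidHom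
    have hκ (u : Fin f) : h (κ u) = 0 := (hev _).trans (congrFun hyM u)
    have hk (a : k) : h a = 0 := by
      let _ : Algebra (ZMod p) Ω := ZMod.algebra Ω p
      rw [← κ.sum_repr a, map_sum]
      exact Finset.sum_eq_zero fun u _ => by rw [ZMod.map_smul, hκ, smul_zero]
    have hP : P = 0 := eq_zero_of_le_ncard (n := f)
      (fun j hj => coeff_sum_monomial_of_le _ hj) (s := Set.range (algebraMap k Ω)) (by
        rw [← Nat.card_coe_set_eq, Nat.card_range_of_injective (algebraMap k Ω).injective,
          Module.natCard_eq_pow_finrank (K := ZMod p) (V := k), Nat.card_zmod,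
          Module.finrank_eq_card_basis κ, Fintype.card_fin]) (by
        rintro _ ⟨a, rfl⟩
        exact hk a)
    rw [← coeff_sum_monomial (p := p) y i]
    exact congrArg (fun P : TwistedPoly p Ω => P.coeff i) hP
  refine Matrix.eq_zero_of_mulVec_eq_zero hM (funext fun i => ?_)
  exact (Finset.sum_congr rfl fun u _ => mul_comm _ _).trans (hc i)

omit [Algebra (ZMod p) k] in
theorem ev_monomial_one_mul [CharP Ω p] (P : TwistedPoly p k) (x : Ω) :
    ev (monomial 1 1 * P) x = ev P x ^ p := by
  rw [ev_mul, ev_monomial, map_one, one_mul, pow_one]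

omit hp [CharP k p] [Algebra (ZMod p) k] in
theorem ev_pow_card [Finite k] (P : TwistedPoly p k) (x : Ω) :
    ev P x ^ Nat.card k = ev P (x ^ Nat.card k) := by
  have := Fintype.ofFinite k
  rw [Nat.card_eq_fintype_card]
  exact map_ev (FiniteField.frobeniusAlgHom k Ω) P x

variable [CharP Ω p] {A : Type*} [CommRing A] (φ : A →+* TwistedPoly p k) {I : Ideal A}
  {W : Type*} [AddCommGroup W] [Module (A ⧸ I) W] (ι : W →+ Ω)

/-- The additive map `x ↦ P(x) ^ (p ^ i)` on a group of points. -/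
def pointMap (P : TwistedPoly p k) (i : ℕ) : W →+ Ω :=
  (iterateFrobenius Ω p i).toAddMonoidHom.comp ((evHom P).comp ι)

omit [CharP k p] [Algebra (ZMod p) k] in
theorem pointMap_apply (P : TwistedPoly p k) (i : ℕ) (x : W) :
    pointMap ι P i x = ev P (ι x) ^ p ^ i := rfl

/-- `pointMap` as an additive map in the twisted polynomial. -/
def pointMapHom (i : ℕ) : TwistedPoly p k →+ (W →+ Ω) where
  toFun P := pointMap ι P i
  map_zero' := by
    ext x
    rw [pointMap_apply, ev_zero_left, zero_pow (pow_ne_zero _ hp.1.ne_zero)]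
    rfl
  map_add' P Q := by
    ext x
    rw [AddMonoidHom.add_apply, pointMap_apply, pointMap_apply, pointMap_apply, ev_add,
      add_pow_char_pow]

omit [Algebra (ZMod p) k] in
theorem pointMap_monomial_one_mul (P : TwistedPoly p k) (i : ℕ) :
    pointMap ι (monomial 1 1 * P) i = pointMap ι P (i + 1) := by
  ext x
  rw [pointMap_apply, pointMap_apply, ev_monomial_one_mul, ← pow_mul, pow_succ']

variable {φ ι}

omit [Algebra (ZMod p) k] in
theorem pointMap_mul (hφ : ∀ a x, ι (Ideal.Quotient.mk I a • x) = ev (φ a) (ι x))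
    (P : TwistedPoly p k) (a : A) (i : ℕ) : pointMap ι (P * φ a) i =
      (pointMap ι P i).comp (DistribSMul.toAddMonoidHom W (Ideal.Quotient.mk I a)) := by
  ext x
  rw [AddMonoidHom.comp_apply, pointMap_apply, pointMap_apply, ev_mul]
  congr 2
  exact (hφ a x).symm

omit [CharP k p] [Algebra (ZMod p) k] in
theorem pointMap_card [Finite k] {f : ℕ} (hf : Nat.card k = p ^ f) (F : W →ₗ[A ⧸ I] W)
    (hF : ∀ x, ι (F x) = ι x ^ Nat.card k) (P : TwistedPoly p k) :
    pointMap ι P f = (pointMap ι P 0).comp F.toAddMonoidHom := by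
  ext x
  rw [AddMonoidHom.comp_apply, pointMap_apply, pointMap_apply, ← hf, ev_pow_card, ← hF]
  simp

/-- The functions `x ↦ (κ u * x ^ (p ^ t)) ^ (p ^ i)` are linearly independent. -/
theorem eq_zero_of_sum_smul_pointMap [Finite k] (hι : Function.Injective ι) {f D : ℕ}
    (κ : Module.Basis (Fin f) (ZMod p) k) (hD : p ^ D ≤ Nat.card W) (c : Fin D × Fin f → Ω)
    (hc : ∀ i : Fin f, ∑ e, c e • pointMap ι (monomial (e.1 : ℕ) (κ e.2)) i = 0) : c = 0 := by
  -- For fixed `i` the relation is a twisted polynomial with coefficients `y i` vanishing at the `p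
  -- ^ i`-th powers of the points. There are at least `p ^ D` of these and the degree is less than
  -- `D`, so `y i = 0`; the Moore matrix then yields `c = 0`.
  let y (i : Fin f) (t : Fin D) : Ω := ∑ u, c (t, u) * algebraMap k Ω (κ u) ^ p ^ (i : ℕ)
  have hy (i : Fin f) : y i = 0 := by
    let P : TwistedPoly p Ω := ∑ t : Fin D, monomial (t : ℕ) (y i t)
    have hP : P = 0 := eq_zero_of_le_ncard (n := D)
      (fun j hj => coeff_sum_monomial_of_le _ hj)
      (s := Set.range fun x => ι x ^ p ^ (i : ℕ)) (by
        rw [← Nat.card_coe_set_eq, Nat.card_range_of_injective]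
        · exact hD
        · exact (iterateFrobenius_inj Ω p i).comp hι) (by
        rintro _ ⟨x, rfl⟩
        rw [ev_sum]
        refine Eq.trans ?_ (DFunLike.congr_fun (hc i) x)
        rw [AddMonoidHom.finsetSum_apply, Fintype.sum_prod_type]
        refine Finset.sum_congr rfl fun t _ => ?_
        rw [ev_monomial, Algebra.algebraMap_self, RingHom.id_apply, Finset.sum_mul]
        refine Finset.sum_congr rfl fun u _ => ?_
        rw [AddMonoidHom.smul_apply, pointMap_apply, ev_monomial, smul_eq_mul, mul_pow, mul_assoc,
          ← pow_mul, ← pow_mul, mul_comm (p ^ (i : ℕ))])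
    funext t
    rw [← coeff_sum_monomial (p := p) (y i) t]
    exact congrArg (fun P : TwistedPoly p Ω => P.coeff t) hP
  funext ⟨t, u⟩
  exact congrFun (moore_injective κ (fun u => c (t, u)) fun i => congrFun (hy i) t) u

variable [Algebra (ZMod p) A] {N r f d : ℕ}

open Matrix in
/-- The determinant of the Frobenius endomorphism of a free module of torsion points is, up to a
sign, the determinant of the left multiplication by `τ` on the twisted polynomials. -/
theorem det_frobenius_eq [Finite k] (hf : Nat.card k = p ^ (f + 1))
    {m : Fin N → TwistedPoly p k} {g : TwistedPoly p k →+ (Fin N → A)}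
    (hg : ∀ a P, g (P * φ a) = a • g P) (hmg : ∀ P, P = ∑ i, m i * φ (g P i))
    {μ : A ⧸ I →ₗ[ZMod p] ZMod p} {b b' : Module.Basis (Fin d) (ZMod p) (A ⧸ I)}
    (hμ : ∀ i j, μ (b i * b' j) = if i = j then 1 else 0)
    {G : TwistedPoly p k} (hG : G ∈ leftIdeal φ I) (hG0 : G ≠ 0)
    (hcard : Nat.card W = p ^ G.natDegree) (w : Module.Basis (Fin r) (A ⧸ I) W)
    (hι : Function.Injective ι) (hφ : ∀ a x, ι (Ideal.Quotient.mk I a • x) = ev (φ a) (ι x))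
    (F : W →ₗ[A ⧸ I] W) (hF : ∀ x, ι (F x) = ι x ^ Nat.card k) :
    LinearMap.det F = Ideal.Quotient.mk I
      ((Equiv.Perm.sign ((Equiv.refl (Fin r)).prodCongr (finRotate (f + 1))) : ℤ) *
        (1 + (of fun s' s => g (monomial 1 1 * m s) s') - (of fun s' s => g (m s) s')).det) := by
  let _ : Algebra (ZMod p) Ω := ZMod.algebra Ω p
  let ψ : A →+* Ω ⊗[ZMod p] (A ⧸ I) :=
    (Algebra.TensorProduct.includeRight : (A ⧸ I) →ₐ[ZMod p] Ω ⊗[ZMod p] (A ⧸ I)).toRingHom.comp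
      (Ideal.Quotient.mk I)
  let κ : Module.Basis (Fin (f + 1)) (ZMod p) k :=
    Module.finBasisOfFinrankEq _ _ (Nat.pow_right_injective hp.1.two_le (by
      dsimp only
      rw [← hf, Module.natCard_eq_pow_finrank (K := ZMod p) (V := k), Nat.card_zmod]))
  let γ : TwistedPoly p k →+ (Fin N → Ω ⊗[ZMod p] (A ⧸ I)) :=
    (AddMonoidHom.pi fun s => ψ.toAddMonoidHom.comp (Pi.evalAddMonoidHom _ s)).comp g
  have hγ (P : TwistedPoly p k) (s : Fin N) : γ P s = ψ (g P s) := rfl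
  have hγmul (P : TwistedPoly p k) (a : A) : γ (P * φ a) = ψ a • γ P := by
    funext s
    rw [hγ, hg, Pi.smul_apply, Pi.smul_apply, hγ, smul_eq_mul, smul_eq_mul, map_mul]
  -- The elements `κ u * τ ^ t` with `t` less than the degree of `G` span the twisted polynomials
  -- modulo the left ideal, over the prime field. The range of `α` turns out to be that of the
  -- projector `E₀`.
  let α : (Fin G.natDegree × Fin (f + 1) → Ω) →ₗ[Ω] (Fin N → Ω ⊗[ZMod p] (A ⧸ I)) :=
    Fintype.linearCombination Ω fun e => γ (monomial (e.1 : ℕ) (κ e.2))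
  -- The matrix `B` sends `P` to the coordinates of the `f + 1` additive maps `x ↦ P(x) ^ (p ^ i)`
  -- on `W`.
  let B : Matrix (Fin r × Fin (f + 1)) (Fin N) (Ω ⊗[ZMod p] (A ⧸ I)) :=
    of fun e s => dualCoord b b' w (pointMap ι (m s) e.2) e.1
  let E₀ : Matrix (Fin N) (Fin N) (Ω ⊗[ZMod p] (A ⧸ I)) := of fun s' s => γ (m s) s'
  let T : Matrix (Fin N) (Fin N) (Ω ⊗[ZMod p] (A ⧸ I)) :=
    of fun s' s => γ (monomial 1 1 * m s) s'
  have hBγ (P : TwistedPoly p k) (j : Fin r) (i : Fin (f + 1)) :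
      (B *ᵥ γ P) (j, i) = dualCoord b b' w (pointMap ι P i) j := by
    have h1 : pointMap ι P i = ∑ s, (pointMap ι (m s) i).comp
        (DistribSMul.toAddMonoidHom W (Ideal.Quotient.mk I (g P s))) := by
      conv_lhs => rw [hmg P]
      refine (map_sum (pointMapHom ι i) _ _).trans (Finset.sum_congr rfl fun s _ => ?_)
      exact pointMap_mul hφ _ _ _
    rw [h1, map_sum, Finset.sum_apply]
    rw [Matrix.mulVec, dotProduct]
    refine Finset.sum_congr rfl fun s _ => ?_
    rw [dualCoord_comp_smul w hμ, mul_comm]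
    rfl
  have hEmul (v : Fin N → Ω ⊗[ZMod p] (A ⧸ I)) : E₀ *ᵥ v = ∑ s, v s • γ (m s) := by
    funext s'
    rw [Finset.sum_apply, Matrix.mulVec, dotProduct]
    exact Finset.sum_congr rfl fun s _ => mul_comm _ _
  have hEγ (P : TwistedPoly p k) : E₀ *ᵥ γ P = γ P := by
    conv_rhs => rw [hmg P, map_sum]
    rw [hEmul]
    exact Finset.sum_congr rfl fun s _ => (hγmul _ _).symm
  have hγG (P : TwistedPoly p k) (hP : P ∈ leftIdeal φ I) : γ P = 0 := by
    suffices ∀ Q, γ (Q * P) = 0 by simpa using this 1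
    refine Submodule.span_induction (p := fun P _ => ∀ Q, γ (Q * P) = 0) ?_ (fun Q => ?_)
      (fun P P' _ _ h h' Q => ?_) (fun R P _ h Q => ?_) hP
    · rintro _ ⟨a, ha, rfl⟩ Q
      have : ψ a = 0 := by
        change Algebra.TensorProduct.includeRight (Ideal.Quotient.mk I a) = 0
        rw [Ideal.Quotient.eq_zero_iff_mem.2 ha, map_zero]
      rw [hγmul, this]
      exact zero_smul (Ω ⊗[ZMod p] (A ⧸ I)) (γ Q)
    · rw [mul_zero, map_zero]
    · rw [mul_add, map_add, h, h', add_zero]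
    · rw [smul_eq_mul, ← mul_assoc, h]
  have hγα (P : TwistedPoly p k) : γ P ∈ LinearMap.range α := by
    obtain ⟨h, R, rfl, hR⟩ := exists_eq_mul_add hG0 P
    rw [map_add, ← smul_eq_mul h G, hγG _ (Submodule.smul_mem _ h hG), zero_add, eq_sum_monomial hR, map_sum]
    refine Submodule.sum_mem _ fun t _ => ?_
    let γt : k →+ (Fin N → Ω ⊗[ZMod p] (A ⧸ I)) :=
      γ.comp ⟨⟨monomial (t : ℕ), monomial_zero _⟩, monomial_add _⟩
    change γt (R.coeff t) ∈ _
    rw [← κ.sum_repr (R.coeff t), map_sum]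
    refine Submodule.sum_mem _ fun u _ => ?_
    rw [ZMod.map_smul, ← algebraMap_smul Ω]
    refine Submodule.smul_mem _ _ ⟨Pi.single (t, u) 1, ?_⟩
    rw [Fintype.linearCombination_apply_single, one_smul]
    rfl
  have hEα (v : Fin N → Ω ⊗[ZMod p] (A ⧸ I)) : E₀ *ᵥ v ∈ LinearMap.range α := by
    rw [hEmul]
    refine Submodule.sum_mem _ fun s _ => ?_
    refine TensorProduct.induction_on (v s) ?_ (fun x a => ?_) fun x y hx hy => ?_
    · exact (zero_smul (Ω ⊗[ZMod p] (A ⧸ I)) (γ (m s))).symm ▸ Submodule.zero_mem _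
    · obtain ⟨a, rfl⟩ := Ideal.Quotient.mk_surjective a
      have : x ⊗ₜ[ZMod p] Ideal.Quotient.mk I a = x • ψ a := by
        change _ = x • ((1 : Ω) ⊗ₜ[ZMod p] Ideal.Quotient.mk I a)
        rw [TensorProduct.smul_tmul', smul_eq_mul, mul_one]
      rw [this, smul_assoc, ← hγmul]
      exact Submodule.smul_mem _ _ (hγα _)
    · exact (add_smul x y (γ (m s))).symm ▸ Submodule.add_mem _ hx hy
  have hαE (c) : E₀ *ᵥ α c = α c := by
    have h : (E₀.mulVecLin.restrictScalars Ω).comp α = α := by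
      refine LinearMap.pi_ext' fun e => LinearMap.ext_ring ?_
      change E₀ *ᵥ α (Pi.single e 1) = α (Pi.single e 1)
      rw [Fintype.linearCombination_apply_single, one_smul, hEγ]
    exact LinearMap.congr_fun h c
  let β : (Fin G.natDegree × Fin (f + 1) → Ω) →ₗ[Ω]
      (Fin r × Fin (f + 1) → Ω ⊗[ZMod p] (A ⧸ I)) := (B.mulVecLin.restrictScalars Ω).comp α
  have hβ : Function.Injective β := by
    rw [injective_iff_map_eq_zero]
    intro c hc
    refine eq_zero_of_sum_smul_pointMap hι κ hcard.ge c fun i => ?_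
    refine dualCoord_injective (b := b) (b' := b') w w.span_eq.ge ?_
    rw [map_zero, map_sum]
    funext j
    refine Eq.trans ?_ (congrFun hc (j, i))
    change _ = (B.mulVecLin.restrictScalars Ω) (α c) (j, i)
    rw [Fintype.linearCombination_apply, map_sum, Finset.sum_apply, Finset.sum_apply]
    refine Finset.sum_congr rfl fun e _ => ?_
    rw [map_smul, map_smul, Pi.smul_apply, Pi.smul_apply, ← hBγ]
    rfl
  have hβ' : Function.Surjective β := by
    have := Module.Finite.of_basis b
    have hfr : Module.finrank Ω (Ω ⊗[ZMod p] (A ⧸ I)) = d := by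
      rw [Module.finrank_baseChange, Module.finrank_eq_card_basis b, Fintype.card_fin]
    -- Both sides are exponents of `p` in the cardinality of `W`. Source and target of `β` then have
    -- the same dimension over `Ω`, so injectivity gives surjectivity.
    have hd : G.natDegree = r * d := by
      refine Nat.pow_right_injective hp.1.two_le ?_
      dsimp only
      rw [← hcard, Nat.card_congr w.equivFun.toEquiv, Nat.card_fun,
        Module.natCard_eq_pow_finrank (K := ZMod p) (V := A ⧸ I), Nat.card_zmod,
        Module.finrank_eq_card_basis b, Fintype.card_fin, ← pow_mul, Nat.card_eq_fintype_card,
        Fintype.card_fin, mul_comm]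
    refine (LinearMap.injective_iff_surjective_of_finrank_eq_finrank ?_).1 hβ
    rw [Module.finrank_fintype_fun_eq_card, Module.finrank_pi_fintype]
    simp only [hfr, Finset.sum_const, Finset.card_univ, Fintype.card_prod, Fintype.card_fin, hd,
      smul_eq_mul]
    ring
  choose c hc using fun e => hβ' (Pi.single e 1)
  let B' : Matrix (Fin N) (Fin r × Fin (f + 1)) (Ω ⊗[ZMod p] (A ⧸ I)) := of fun s e => α (c e) s
  have hBB' : B * B' = 1 := by
    ext e e'
    refine (congrFun (hc e') e).trans ?_
    rw [Matrix.one_apply, Pi.single_apply]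
  have hEB' : E₀ * B' = B' := by
    ext s e
    exact congrFun (hαE (c e)) s
  -- The columns of both sides lie in the range of `α` and have the same image under `B`, which is
  -- injective on that range.
  have hB'B : B' * B = E₀ := by
    ext s' s
    have hmem : (B' * B).col s - γ (m s) ∈ LinearMap.range α := by
      refine Submodule.sub_mem _ ?_ (hγα _)
      have : (B' * B).col s = E₀ *ᵥ (B' * B).col s := by
        conv_lhs => rw [← hEB', Matrix.mul_assoc]
        rfl
      rw [this]
      exact hEα _
    obtain ⟨x, hx⟩ := hmem
    have hx0 : β x = 0 := by
      change B *ᵥ α x = 0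
      rw [hx, Matrix.mulVec_sub, sub_eq_zero]
      calc B *ᵥ (B' * B).col s = (B * (B' * B)).col s := rfl
        _ = B.col s := by rw [← Matrix.mul_assoc, hBB', Matrix.one_mul]
        _ = B *ᵥ γ (m s) := funext fun e => (hBγ (m s) e.1 e.2).symm
    rw [(injective_iff_map_eq_zero β).1 hβ x hx0, map_zero] at hx
    exact sub_eq_zero.1 (congrFun hx s').symm
  have hET : E₀ * T = T := by
    ext s' s
    exact congrFun (hEγ _) s'
  have hBT (j : Fin r) (i : Fin (f + 1)) (s : Fin N) : (B * T) (j, i) s =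
      dualCoord b b' w (pointMap ι (m s) (i + 1)) j := by
    rw [← pointMap_monomial_one_mul]
    exact hBγ _ j i
  have key := det_one_add_sub_of_shift ((LinearMap.toMatrix w w F).map
    (Algebra.TensorProduct.includeRight : (A ⧸ I) →ₐ[ZMod p] Ω ⊗[ZMod p] (A ⧸ I))) B B' T hBB'
    (by rw [hB'B, hET]) (fun j i s => by rw [hBT]; rfl) (fun j s => by
      rw [hBT, Fin.val_last, pointMap_card hf F hF, dualCoord_comp w hμ _ F (LinearMap.toMatrix w w F) fun j => ?_]
      · rfl
      · exact (w.sum_repr (F (w j))).symm.trans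
          (Finset.sum_congr rfl fun i _ => by rw [LinearMap.toMatrix_apply]))
  rw [hB'B] at key
  refine Algebra.TensorProduct.includeRight_injective (R := ZMod p) (A := Ω) (B := A ⧸ I)
    (algebraMap (ZMod p) Ω).injective ?_
  set ε := Equiv.Perm.sign ((Equiv.refl (Fin r)).prodCongr (finRotate (f + 1)))
  have hε : (((ε : ℤˣ) : ℤ) : Ω ⊗[ZMod p] (A ⧸ I)) * ((ε : ℤ) : Ω ⊗[ZMod p] (A ⧸ I)) = 1 := by
    rw [← Int.cast_mul, ← Units.val_mul, Int.units_mul_self, Units.val_one, Int.cast_one]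
  have hq : Algebra.TensorProduct.includeRight (LinearMap.det F) =
      ((LinearMap.toMatrix w w F).map (Algebra.TensorProduct.includeRight :
        (A ⧸ I) →ₐ[ZMod p] Ω ⊗[ZMod p] (A ⧸ I))).det := by
    rw [← LinearMap.det_toMatrix w F]
    exact AlgHom.map_det _ _
  change _ = ψ _
  rw [hq, map_mul, map_intCast, RingHom.map_det, map_sub, map_add, map_one]
  change _ = (ε : ℤ) * (1 + T - E₀).det
  rw [key, ← mul_assoc, hε, one_mul]

end FrobeniusDet

/-- Over a finite field, the determinants of the Frobenius endomorphism on the modules of torsion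
points come from a single element of `A`. -/
theorem exists_det_frobenius_eq {p : ℕ} [Fact p.Prime] {k : Type*} [Field k] [CharP k p] [Finite k]
    {A : Type*} [CommRing A] [IsDedekindDomain A] [Algebra (ZMod p) A]
    [Algebra.FiniteType (ZMod p) A] (φ : A →+* TwistedPoly p k) (hφ : Function.Injective φ) {t : A}
    (ht : 0 < (φ t).natDegree) (r : ℕ) :
    ∃ s : A, ∀ ℓ : Ideal A, ℓ.IsMaximal → ℓ ≠ ⊥ → ∀ (n : ℕ) (Ω : Type u) [Field Ω] [Algebra k Ω]
      (W : Type w) [AddCommGroup W] [Module (A ⧸ ℓ ^ n) W] (_ : Module.Basis (Fin r) (A ⧸ ℓ ^ n) W)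
      (ι : W →+ Ω), Function.Injective ι →
      (∀ a x, ι (Ideal.Quotient.mk (ℓ ^ n) a • x) = ev (φ a) (ι x)) →
      ∀ G ∈ leftIdeal φ (ℓ ^ n), G ≠ 0 → Nat.card W = p ^ G.natDegree →
      ∀ F : W →ₗ[A ⧸ ℓ ^ n] W, (∀ x, ι (F x) = ι x ^ Nat.card k) →
        LinearMap.det F = Ideal.Quotient.mk (ℓ ^ n) s := by
  let _ : Algebra (ZMod p) k := ZMod.algebra k p
  obtain ⟨f, hf⟩ : ∃ f, Nat.card k = p ^ (f + 1) := by
    refine ⟨Module.finrank (ZMod p) k - 1, ?_⟩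
    rw [Nat.sub_add_cancel Module.finrank_pos, Module.natCard_eq_pow_finrank (K := ZMod p) (V := k),
      Nat.card_zmod]
  obtain ⟨N, m, g, hg, hmg⟩ := exists_right_dual_basis φ hφ ht
  -- The witness involves only `k`, `φ`, `r` and the chosen `m` and `g`, hence neither `ℓ` nor `n`.
  refine ⟨(Equiv.Perm.sign ((Equiv.refl (Fin r)).prodCongr (finRotate (f + 1))) : ℤ) *
    (1 + (Matrix.of fun s' s => g (monomial 1 1 * m s) s') -
      (Matrix.of fun s' s => g (m s) s')).det, fun ℓ hℓ hℓ0 n Ω _ _ W _ _ w ι hι hιφ G hG hG0 hcard F hF => ?_⟩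
  rcases n with _ | n
  · have : Subsingleton (A ⧸ ℓ ^ 0) :=
      Ideal.Quotient.subsingleton_iff.2 (by rw [pow_zero, Ideal.one_eq_top])
    exact Subsingleton.elim _ _
  · have := finite_zmod_quotient p (pow_ne_zero (n + 1) hℓ0)
    have : CharP Ω p := charP_of_injective_algebraMap (algebraMap k Ω).injective p
    obtain ⟨μ, d, b, b', hμ⟩ := exists_dual_bases (F := ZMod p) hℓ hℓ0 n
    exact det_frobenius_eq hf hg hmg hμ hG hG0 hcard w hι hιφ F hF

end TwistedPoly

/-! ### Finiteness of the set of primes containing a given element. -/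

section FinitePrimes

variable {A : Type*} [CommRing A] [IsDedekindDomain A]

/-- A finite family of elements of a Dedekind domain, not all zero, is proportional to a family
with a member outside a given prime ideal. -/
theorem exists_mul_eq_mul_notMem {ι : Type*} [Finite ι] (a : ι → A) {j : ι} (hj : a j ≠ 0)
    {P : Ideal A} (hP : P ≠ ⊤) :
    ∃ x y : A, x ≠ 0 ∧ ∃ d : ι → A, (∀ i, y * a i = x * d i) ∧ ∃ i, d i ∉ P := by
  -- With `(a) * J = (a j)`, each `y ∈ J` makes all `y * a i` divisible by `a j`. If the quotients
  -- always lay in `P`, then `(a j)` would be contained in `(a j) * P`, which is impossible.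
  obtain ⟨J, hJ⟩ : Ideal.span (Set.range a) ∣ Ideal.span {a j} :=
    Ideal.dvd_span_singleton.2 (Ideal.subset_span ⟨j, rfl⟩)
  have hmem (y : A) (hy : y ∈ J) (i : ι) : ∃ d, y * a i = a j * d := by
    have : a i * y ∈ Ideal.span {a j} := hJ ▸ Ideal.mul_mem_mul (Ideal.subset_span ⟨i, rfl⟩) hy
    obtain ⟨d, hd⟩ := Ideal.mem_span_singleton.1 this
    exact ⟨d, by rw [← hd, mul_comm]⟩
  by_contra! H
  have hle : Ideal.span (Set.range a) * J ≤ Ideal.span {a j} * P := by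
    rw [Ideal.mul_le]
    intro b hb y hy
    choose d hd using hmem y hy
    have hdP := H (a j) y hj d hd
    refine Submodule.span_induction (p := fun b _ => b * y ∈ Ideal.span {a j} * P) ?_ ?_ ?_ ?_ hb
    · rintro _ ⟨i, rfl⟩
      rw [mul_comm (a i), hd]
      exact Ideal.mul_mem_mul (Ideal.mem_span_singleton_self _) (hdP i)
    · rw [zero_mul]
      exact Ideal.zero_mem _
    · intro b b' _ _ h h'
      rw [add_mul]
      exact Ideal.add_mem _ h h'
    · intro c b _ h
      rw [smul_eq_mul, mul_assoc]
      exact Ideal.mul_mem_left _ c h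
  rw [← hJ] at hle
  obtain ⟨z, hz, hzj⟩ := Ideal.mem_span_singleton_mul.1 (hle (Ideal.mem_span_singleton_self _))
  have : z = 1 := mul_left_cancel₀ hj (by rw [hzj, mul_one])
  exact hP ((Ideal.eq_top_iff_one _).2 (this ▸ hz))

variable {K L : Type*} [Field K] [Algebra A K] [IsFractionRing A K] [Field L] [Algebra K L]
  [FiniteDimensional K L] [Algebra A L] [IsScalarTower A K L]

-- At most `[L : K]` maximal ideals lie over `P`: elements congruent to `1` at one of them and to
-- `0` at the others are linearly independent. Indeed a relation can be scaled to have a coefficient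
-- outside `P`, which reduction at the corresponding ideal contradicts. The argument does not use
-- separability of `L` over `K`.
variable (K) in
include K in
theorem finite_setOf_isMaximal_comap_eq (P : Ideal A) : {Q : Ideal (integralClosure A L) |
    Q.IsMaximal ∧ Q.comap (algebraMap A (integralClosure A L)) = P}.Finite := by
  classical
  by_contra H
  obtain ⟨s, hs, hcard⟩ := Set.Infinite.exists_subset_card_eq H (Module.finrank K L + 1)
  have hmax (Q : s) : Q.1.IsMaximal := (hs Q.2).1
  have hcop : Pairwise (Function.onFun IsCoprime fun Q : s => Q.1) := fun Q Q' h =>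
    Ideal.isCoprime_of_isMaximal fun h' => h (Subtype.ext h')
  choose e he using fun Q : s => Ideal.exists_forall_sub_mem_ideal hcop (Pi.single Q 1)
  have hli : LinearIndependent A fun Q : s => ((e Q : integralClosure A L) : L) := by
    rw [Fintype.linearIndependent_iff]
    intro a ha
    by_contra! hne
    obtain ⟨Q, hQ⟩ := hne
    have hP : P ≠ ⊤ := by
      rw [← (hs Q.2).2]
      exact Ideal.comap_ne_top _ (hmax Q).ne_top
    obtain ⟨x, y, hx, d, hd, Q', hQ'⟩ := exists_mul_eq_mul_notMem a hQ hP
    have h1 : ∑ Q, d Q • e Q = 0 := by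
      have h2 : algebraMap A L x * ∑ Q, d Q • ((e Q : integralClosure A L) : L) = 0 := by
        rw [← mul_zero (algebraMap A L y), ← ha, Finset.mul_sum, Finset.mul_sum]
        refine Finset.sum_congr rfl fun Q _ => ?_
        rw [Algebra.smul_def, Algebra.smul_def, ← mul_assoc, ← mul_assoc, ← map_mul, ← map_mul, hd]
      have hx' : algebraMap A L x ≠ 0 := by
        rw [IsScalarTower.algebraMap_apply A K L]
        simpa using hx
      have h3 := (mul_eq_zero.1 h2).resolve_left hx'
      apply Subtype.ext
      simpa using h3
    have h4 : algebraMap A (integralClosure A L) (d Q') ∈ Q'.1 := by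
      have : algebraMap A (integralClosure A L) (d Q') =
          -∑ Q, d Q • (e Q - Pi.single (M := fun _ => integralClosure A L) Q 1 Q') := by
        simp only [smul_sub, Finset.sum_sub_distrib, h1]
        rw [Finset.sum_eq_single Q']
        · simp [Algebra.smul_def]
        · intro Q _ hQ
          rw [Pi.single_eq_of_ne hQ.symm, smul_zero]
        · exact fun h => absurd (Finset.mem_univ _) h
      rw [this]
      refine neg_mem (sum_mem fun Q _ => ?_)
      rw [Algebra.smul_def]
      exact Ideal.mul_mem_left _ _ (he Q Q')
    refine hQ' ?_
    rw [← (hs Q'.2).2]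
    exact h4
  have := ((LinearIndependent.iff_fractionRing A K).1 hli).fintype_card_le_finrank
  rw [Fintype.card_coe, hcard] at this
  omega

-- As `c` is integral over `A`, the ideal it generates meets `A` in a nonzero ideal. The latter has
-- finitely many divisors, and over each of them lie finitely many maximal ideals.
variable (K) in
include K in
theorem finite_setOf_isMaximal_mem {c : integralClosure A L} (hc : c ≠ 0) :
    {Q : Ideal (integralClosure A L) | Q.IsMaximal ∧ c ∈ Q}.Finite := by
  have hI : (Ideal.span {c}).comap (algebraMap A (integralClosure A L)) ≠ ⊥ :=
    Ideal.comap_ne_bot_of_integral_mem hc (Ideal.mem_span_singleton_self c)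
      (Algebra.IsIntegral.isIntegral c)
  let _ : Fintype (Ideal A)ˣ := Fintype.ofFinite _
  let h := UniqueFactorizationMonoid.fintypeSubtypeDvd _ hI
  have hfin : {P : Ideal A | P ∣ (Ideal.span {c}).comap
      (algebraMap A (integralClosure A L))}.Finite := 
    Set.finite_coe_iff.1 (@Finite.of_fintype _ h)
  refine (hfin.biUnion fun P _ =>
    finite_setOf_isMaximal_comap_eq (A := A) (L := L) K P).subset ?_
  rintro Q ⟨hQ, hcQ⟩
  rw [Set.mem_iUnion₂]
  refine ⟨_, Ideal.dvd_iff_le.2 (Ideal.comap_mono ?_), hQ, rfl⟩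
  exact (Ideal.span_singleton_le_iff_mem _).2 hcQ

end FinitePrimes

/-! ### Leading coefficients and integral models. -/

namespace TwistedPoly

theorem mem_range_map {p : ℕ} {R S : Type*} [CommRing R] [CommRing S] [ExpChar R p] [ExpChar S p]
    (f : R →+* S) {P : TwistedPoly p S} (h : ∀ i, P.coeff i ∈ f.range) : P ∈ (map (p := p) f).range := by
  choose a ha using h
  rw [eq_sum_monomial (P := P) (n := P.natDegree + 1) fun i hi => coeff_eq_zero_of_natDegree_lt hi]
  refine Subring.sum_mem _ fun i _ => ⟨monomial i (a i), ?_⟩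
  rw [map_monomial, ha]

/-- The leading coefficient of a monic polynomial over the prime field in a twisted polynomial is
a power of the leading coefficient of the latter. -/
theorem leadingCoeff_aeval {p : ℕ} [Fact p.Prime] {R : Type*} [CommRing R] [IsDomain R] [CharP R p]
    {A : Type*} [CommRing A] [Algebra (ZMod p) A] (φ : A →+* TwistedPoly p R) {t : A}
    (ht : 0 < (φ t).natDegree) {f : Polynomial (ZMod p)} (hf : f.Monic) :
    ∃ N, (φ (Polynomial.aeval t f)).leadingCoeff = (φ t).leadingCoeff ^ N := by
  have ht0 : φ t ≠ 0 := by
    intro h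
    rw [h] at ht
    exact lt_irrefl 0 ht
  have hpow (n : ℕ) : (φ (t ^ n)).natDegree = n * (φ t).natDegree ∧
      ∃ N, (φ (t ^ n)).leadingCoeff = (φ t).leadingCoeff ^ N := by
    induction n with
    | zero =>
      rw [pow_zero, map_one, zero_mul]
      have h1 : (1 : TwistedPoly p R).natDegree = 0 := Polynomial.natDegree_monomial_eq 0 one_ne_zero
      refine ⟨h1, 0, ?_⟩
      rw [← coeff_natDegree, h1, pow_zero, one_def, coeff_monomial, if_pos rfl]
    | succ n ih =>
      obtain ⟨h1, N, h2⟩ := ih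
      have h3 : φ (t ^ n) ≠ 0 := by
        rw [map_pow]
        exact pow_ne_zero _ ht0
      rw [pow_succ, map_mul, natDegree_mul h3 ht0, leadingCoeff_mul, h1, h2, ← pow_add]
      exact ⟨by ring, _, rfl⟩
  -- The twisted polynomials of degree less than that of `φ (t ^ f.natDegree)`. All lower terms of
  -- `f` contribute elements of `Y`, so they do not affect the leading coefficient.
  let Y : AddSubgroup (TwistedPoly p R) :=
    { carrier := {P | ∀ i, f.natDegree * (φ t).natDegree ≤ i → P.coeff i = 0}
      zero_mem' := fun i _ => rfl
      add_mem' := fun {P Q} hP hQ i hi => by rw [coeff_add, hP i hi, hQ i hi, add_zero]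
      neg_mem' := fun {P} hP i hi => by
        rw [← zero_sub, coeff_sub, hP i hi, coeff_zero, sub_zero] }
  have hY : φ (Polynomial.aeval t f) - φ (t ^ f.natDegree) ∈ Y := by
    rw [Polynomial.aeval_eq_sum_range, Finset.sum_range_succ, hf.coeff_natDegree, one_smul, map_add,
      add_sub_cancel_right, map_sum]
    refine sum_mem fun i hi => ?_
    obtain ⟨n, hn⟩ := ZMod.intCast_surjective (f.coeff i)
    rw [← hn, Int.cast_smul_eq_zsmul, map_zsmul]
    refine AddSubgroup.zsmul_mem Y ?_ n
    refine fun j hj => coeff_eq_zero_of_natDegree_lt ?_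
    rw [(hpow i).1]
    exact (Nat.mul_lt_mul_of_pos_right (Finset.mem_range.1 hi) ht).trans_le hj
  obtain ⟨h1, N, h2⟩ := hpow f.natDegree
  have hc (i : ℕ) (hi : f.natDegree * (φ t).natDegree ≤ i) :
      (φ (Polynomial.aeval t f)).coeff i = (φ (t ^ f.natDegree)).coeff i := by
    have := hY i hi
    rwa [coeff_sub, sub_eq_zero] at this
  have hd : (φ (Polynomial.aeval t f)).natDegree = f.natDegree * (φ t).natDegree := by
    refine le_antisymm ?_ ?_
    · by_contra! hlt
      have h3 := hc _ hlt.le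
      rw [coeff_eq_zero_of_natDegree_lt (P := φ (t ^ f.natDegree)) (h1.trans_lt hlt), coeff_natDegree,
        leadingCoeff_eq_zero] at h3
      rw [h3] at hlt
      exact absurd hlt (Nat.not_lt_zero _)
    · refine le_natDegree_of_ne_zero ?_
      rw [hc _ le_rfl, ← h1, coeff_natDegree, h2]
      exact pow_ne_zero _ (by simpa using ht0)
  exact ⟨N, by rw [← coeff_natDegree, hd, hc _ le_rfl, ← h1, coeff_natDegree, h2]⟩

end TwistedPoly

/-- In a finitely generated algebra over a prime field that is a Dedekind domain, every nonzero
element divides a monic polynomial in any given element. -/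
theorem exists_monic_aeval_mem_span {p : ℕ} [Fact p.Prime] {A : Type*} [CommRing A]
    [IsDedekindDomain A] [Algebra (ZMod p) A] [Algebra.FiniteType (ZMod p) A] (t : A) {a : A}
    (ha : a ≠ 0) : ∃ f : Polynomial (ZMod p), f.Monic ∧ a ∣ Polynomial.aeval t f := by
  -- The quotient by `a` is finite over the prime field, so the class of `t` is integral.
  have := finite_zmod_quotient p (I := Ideal.span {a}) (by simpa using ha)
  obtain ⟨f, hf, h⟩ := Algebra.IsIntegral.isIntegral (R := ZMod p) (Ideal.Quotient.mk (Ideal.span {a}) t)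
  refine ⟨f, hf, Ideal.mem_span_singleton.1 (Ideal.Quotient.eq_zero_iff_mem.1 ?_)⟩
  exact (Polynomial.aeval_algHom_apply (Ideal.Quotient.mkₐ (ZMod p) (Ideal.span {a})) t f).symm.trans h

namespace AModuleScheme

open TwistedPoly

/-- A coordinate of a Drinfeld module can be rescaled so that `A` acts through twisted polynomials
with integral coefficients. -/
theorem Coordinate.exists_integral {p : ℕ} [Fact p.Prime] {A : Type w} [CommRing A] [IsDomain A]
    [Algebra (ZMod p) A] [Algebra.FiniteType (ZMod p) A] (K : Type*) [Field K] [Algebra A K]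
    [IsFractionRing A K] {L : Type u} [Field L] [CharP L p] [Algebra K L] [FiniteDimensional K L]
    [Algebra A L] [IsScalarTower A K L] [CharP (integralClosure A L) p] {E : AModuleScheme A L}
    (c : E.Coordinate) {δ : A →+* L} (hδ : E.ActsOnLieThrough δ) (hδA : ∀ a, IsIntegral A (δ a)) :
    ∃ (c' : E.Coordinate) (φ : A →+* TwistedPoly p (integralClosure A L)),
      ∀ a, c'.hom p a = TwistedPoly.map (algebraMap (integralClosure A L) L) (φ a) := by
  classical
  obtain ⟨s, hs⟩ := Algebra.FiniteType.out (R := ZMod p) (A := A)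
  obtain ⟨y, hy, hint⟩ := exists_integral_multiples A K (L := L)
    (s.biUnion fun a => (Finset.range ((c.hom p a).natDegree + 1)).image fun i => (c.hom p a).coeff i)
  have hy' : algebraMap A L y ≠ 0 := by
    rw [IsScalarTower.algebraMap_apply A K L]
    simpa using hy
  let c' := c.rescale (algebraMap A L y)⁻¹ (inv_ne_zero hy')
  let ψ := TwistedPoly.map (p := p) (algebraMap (integralClosure A L) L)
  have hψ : Function.Injective ψ := map_injective Subtype.val_injective
  have hgen (a : A) (ha : a ∈ s) : c'.hom p a ∈ ψ.range := by
    refine mem_range_map _ fun i => ?_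
    suffices IsIntegral A ((c'.hom p a).coeff i) from ⟨⟨_, this⟩, rfl⟩
    rcases i with _ | i
    · rw [c'.coeff_zero_hom p hδ]
      exact hδA a
    · rw [coeff_hom_rescale, inv_inv]
      have h1 : IsIntegral A (y • (c.hom p a).coeff (i + 1)) := by
        by_cases hi : i + 1 ≤ (c.hom p a).natDegree
        · exact hint _ (Finset.mem_biUnion.2 ⟨a, ha, Finset.mem_image.2
            ⟨_, Finset.mem_range.2 (Nat.lt_succ_of_le hi), rfl⟩⟩)
        · rw [coeff_eq_zero_of_natDegree_lt (not_le.1 hi), smul_zero]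
          exact isIntegral_zero
      -- Rescaling multiplies this coefficient by `y ^ (p ^ (i + 1) - 1) = y ^ m * y`; one factor
      -- `y` clears the denominator and the others are integral.
      obtain ⟨m, hm⟩ : ∃ m, p ^ (i + 1) = m + 2 :=
        ⟨p ^ (i + 1) - 2, (Nat.sub_add_cancel ((Fact.out : p.Prime).two_le.trans
          (Nat.le_self_pow (Nat.succ_ne_zero i) p))).symm⟩
      have h2 : (algebraMap A L y)⁻¹ * (c.hom p a).coeff (i + 1) * algebraMap A L y ^ p ^ (i + 1) =
          algebraMap A L (y ^ m) * (y • (c.hom p a).coeff (i + 1)) := by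
        rw [hm, Algebra.smul_def, map_pow]
        field_simp
        ring
      rw [h2]
      exact isIntegral_algebraMap.mul h1
  -- The range is a subring, so integrality on the finitely many generators suffices.
  have hall (a : A) : c'.hom p a ∈ ψ.range := by
    have ha : a ∈ Algebra.adjoin (ZMod p) (s : Set A) := hs ▸ Algebra.mem_top
    induction ha using Algebra.adjoin_induction with
    | mem a ha => exact hgen a ha
    | algebraMap z =>
      obtain ⟨n, rfl⟩ := ZMod.intCast_surjective z
      rw [map_intCast, map_intCast]
      exact intCast_mem _ n
    | add a b _ _ ha hb => rw [map_add]; exact add_mem ha hb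
    | mul a b _ _ ha hb => rw [map_mul]; exact mul_mem ha hb
  choose φ hφ using hall
  refine ⟨c', ⟨⟨⟨φ, hψ ?_⟩, fun a b => hψ ?_⟩, hψ ?_, fun a b => hψ ?_⟩, fun a => (hφ a).symm⟩
  · rw [hφ, map_one, map_one]
  · rw [hφ, map_mul, map_mul, hφ, hφ]
  · change ψ (φ 0) = _
    rw [hφ, map_zero, map_zero]
  · change ψ (φ (a + b)) = ψ (φ a + φ b)
    rw [hφ, map_add, map_add, hφ, hφ]

end AModuleScheme

/-! ### Reduction of torsion points modulo a prime. -/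

namespace TwistedPoly

theorem natDegree_map {p : ℕ} {R S : Type*} [CommRing R] [CommRing S] [ExpChar R p] [ExpChar S p]
    (f : R →+* S) {P : TwistedPoly p R} (h : f P.leadingCoeff ≠ 0) :
    (map (p := p) f P).natDegree = P.natDegree := by
  refine le_antisymm ?_ (le_natDegree_of_ne_zero (by rwa [coeff_map]))
  by_contra! hlt
  have h1 : (map (p := p) f P).leadingCoeff = 0 := by
    rw [← coeff_natDegree, coeff_map, coeff_eq_zero_of_natDegree_lt hlt, map_zero]
  rw [leadingCoeff_eq_zero] at h1
  rw [h1] at hlt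
  exact absurd hlt (Nat.not_lt_zero _)

theorem ev_map_algebraMap {p : ℕ} {O k Ω : Type*} [CommRing O] [CommRing k] [ExpChar O p]
    [ExpChar k p] [Algebra O k] [CommRing Ω] [Algebra O Ω] [Algebra k Ω] [IsScalarTower O k Ω]
    (P : TwistedPoly p O) (x : Ω) : ev (map (algebraMap O k) P) x = ev P x :=
  ev_map (algebraMap O k) P (RingHom.id Ω)
    (fun z => IsScalarTower.algebraMap_apply O k Ω z) x

/-- A zero of a twisted polynomial reducing to zero vanishes if the linear coefficient does not
reduce to zero. -/
theorem eq_zero_of_ev_eq_zero {p : ℕ} [Fact p.Prime] {O R Ω : Type*} [CommRing O] [CommRing R]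
    [IsDomain R] [Algebra O R] [CommRing Ω] [Algebra O Ω] (ρ : R →ₐ[O] Ω)
    {P : TwistedPoly p O} (hP : algebraMap O Ω (P.coeff 0) ≠ 0) {x : R} (hx : ev P x = 0)
    (hρ : ρ x = 0) : x = 0 := by
  by_contra h0
  have hc : P.toPoly.coeff 0 = 0 := coeff_toPoly_of_ne P 0 fun i =>
    (pow_ne_zero i (Fact.out : p.Prime).ne_zero).symm
  -- Writing `P = X * Q`, a nonzero zero `x` of `P` is a zero of `Q`. If `x` reduces to `0`, then
  -- `Q(0)`, which is the linear coefficient of `P`, reduces to `0`.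
  have h1 := Polynomial.divX_mul_X_add P.toPoly
  rw [hc, map_zero, add_zero] at h1
  rw [ev_eq_aeval, ← h1, map_mul, Polynomial.aeval_X] at hx
  have h2 := (mul_eq_zero.1 hx).resolve_right h0
  have h3 := congrArg ρ h2
  rw [← Polynomial.aeval_algHom_apply, hρ, map_zero, ← Polynomial.coeff_zero_eq_aeval_zero',
    Polynomial.coeff_divX, zero_add] at h3
  have h4 := coeff_toPoly P 0
  rw [pow_zero] at h4
  exact hP (h4 ▸ h3)

end TwistedPoly

namespace AModuleScheme

open TwistedPoly

namespace Coordinate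

section Reduction

variable {p : ℕ} [Fact p.Prime] {A : Type w} [CommRing A] {L : Type u} [Field L] [CharP L p]
  {E : AModuleScheme A L} {c : E.Coordinate} {O : Type*} [CommRing O] [CharP O p] [Algebra O L]
  {φ : A →+* TwistedPoly p O} (hφ : ∀ a, c.hom p a = TwistedPoly.map (algebraMap O L) (φ a))
  {Ls : Type u} [Field Ls] [Algebra L Ls] [Algebra O Ls] [IsScalarTower O L Ls]
  {R : Type*} [CommRing R] [IsDomain R] [Algebra O R] {j : R →ₐ[O] Ls} (hj : Function.Injective j)
  {Ω : Type*} [Field Ω] [Algebra O Ω] (ρ : R →ₐ[O] Ω)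

include hφ in
theorem pts_smul_integral (a : A) (x : E.Pts Ls) :
    c.pts Ls (a • x) = ev (φ a) (c.pts Ls x) := by
  rw [c.pts_smul p, hφ, ev_map_algebraMap]

variable (j) in
/-- The points whose coordinate lies in a subring of the field. -/
def integralPoints : Submodule A (E.Pts Ls) where
  carrier := {x | c.pts Ls x ∈ j.range}
  zero_mem' := by
    change c.pts Ls 0 ∈ j.range
    rw [map_zero]
    exact zero_mem _
  add_mem' {x y} hx hy := by
    change c.pts Ls (x + y) ∈ j.range
    rw [map_add]
    exact add_mem hx hy
  smul_mem' a x hx := by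
    obtain ⟨y, hy⟩ := hx
    exact ⟨ev (φ a) y, by
      rw [pts_smul_integral hφ]
      exact (map_ev j _ _).trans (congrArg _ hy)⟩

omit [IsDomain R] in
theorem exists_eq_pts (x : integralPoints hφ j) : ∃ y, j y = c.pts Ls x.1 := x.2

/-- The reduction of integral points. -/
def reduction : integralPoints hφ j →+ Ω where
  toFun x := ρ (exists_eq_pts hφ x).choose
  map_zero' := by
    rw [← map_zero ρ]
    refine congrArg ρ (hj ?_)
    rw [(exists_eq_pts hφ _).choose_spec, map_zero]
    exact map_zero _
  map_add' x y := by
    rw [← map_add ρ]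
    refine congrArg ρ (hj ?_)
    rw [(exists_eq_pts hφ _).choose_spec, map_add, (exists_eq_pts hφ _).choose_spec,
      (exists_eq_pts hφ _).choose_spec]
    exact map_add _ _ _

omit [IsDomain R] in
theorem reduction_eq {x : integralPoints hφ j} {y : R} (h : j y = c.pts Ls x.1) :
    reduction hφ hj ρ x = ρ y :=
  congrArg ρ (hj ((exists_eq_pts hφ x).choose_spec.trans h.symm))

omit [IsDomain R] in
theorem reduction_smul (a : A) (x : integralPoints hφ j) :
    reduction hφ hj ρ (a • x) = ev (φ a) (reduction hφ hj ρ x) := by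
  obtain ⟨y, hy⟩ := exists_eq_pts hφ x
  rw [reduction_eq hφ hj ρ hy, reduction_eq hφ hj ρ (y := ev (φ a) y), map_ev]
  rw [map_ev, hy]
  exact (pts_smul_integral hφ a x.1).symm

theorem eq_zero_of_reduction_eq_zero {a : A} (ha : algebraMap O Ω ((φ a).coeff 0) ≠ 0)
    {x : integralPoints hφ j} (hx : a • x = 0) (h : reduction hφ hj ρ x = 0) : x = 0 := by
  obtain ⟨y, hy⟩ := exists_eq_pts hφ x
  rw [reduction_eq hφ hj ρ hy] at h
  have h1 : ev (φ a) y = 0 := hj (by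
    rw [map_ev, hy, ← pts_smul_integral hφ, map_zero]
    exact (congrArg _ (congrArg Subtype.val hx)).trans (map_zero _))
  have h2 := eq_zero_of_ev_eq_zero ρ ha h1 h
  rw [h2, map_zero] at hy
  exact Subtype.ext ((c.pts Ls).injective (hy.symm.trans (map_zero _).symm))

include hj ρ in
/-- Reduction identifies the torsion points with the zeros of the reduced twisted polynomials; in
particular their number is determined by the latter. -/
theorem natCard_torsionBySet_eq [IsSepClosed Ls] (hOL : Function.Injective (algebraMap O L))
    {k : Type*} [Field k] [CharP k p] [Algebra O k] [Algebra k Ω] [IsScalarTower O k Ω]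
    {I : Ideal A} {a : A} (haI : a ∈ I) (ha : algebraMap O k ((φ a).coeff 0) ≠ 0)
    (hdeg : algebraMap O k (φ a).leadingCoeff ≠ 0)
    (hint : ∀ x : E.Pts Ls, a • x = 0 → x ∈ integralPoints hφ j) :
    ∃ G ∈ leftIdeal ((TwistedPoly.map (algebraMap O k)).comp φ) I, G ≠ 0 ∧
      Nat.card (Submodule.torsionBySet A (E.Pts Ls) (I : Ideal A)) = p ^ G.natDegree := by
  set φ' := (TwistedPoly.map (p := p) (algebraMap O k)).comp φ with hφ'
  have : CharP Ω p := charP_of_injective_algebraMap (algebraMap k Ω).injective p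
  have hev (b : A) (y : Ω) : ev (φ' b) y = ev (φ b) y := ev_map_algebraMap _ _
  have haΩ : algebraMap O Ω ((φ a).coeff 0) ≠ 0 := by
    rw [IsScalarTower.algebraMap_apply O k Ω]
    simpa using ha
  have hφ'a : φ' a ≠ 0 := by
    intro h
    have := congrArg (fun P => P.coeff 0) h
    simp only [hφ', RingHom.comp_apply, coeff_map, coeff_zero] at this
    exact ha this
  let T : Set (integralPoints hφ j) := {x | a • x = 0}
  let Z : Set Ω := {y | ev (φ' a) y = 0}
  have hTcard : T.ncard = p ^ (φ' a).natDegree := by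
    have h1 : (fun x : integralPoints hφ j => c.pts Ls x.1) '' T = {y | ev (c.hom p a) y = 0} := by
      ext y
      constructor
      · rintro ⟨x, hx, rfl⟩
        change ev (c.hom p a) (c.pts Ls x.1) = 0
        rw [← c.pts_smul p]
        exact (congrArg _ (congrArg Subtype.val hx)).trans (map_zero _)
      · intro hy
        have hx : a • (c.pts Ls).symm y = 0 := (c.pts Ls).injective (by
          rw [c.pts_smul p, AddEquiv.apply_symm_apply, map_zero]
          exact hy)
        exact ⟨⟨_, hint _ hx⟩, Subtype.ext hx, AddEquiv.apply_symm_apply _ _⟩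
    have hne {z : O} (hz : algebraMap O k z ≠ 0) : algebraMap O L z ≠ 0 := by
      rw [map_ne_zero_iff _ hOL]
      rintro rfl
      exact hz (map_zero _)
    have h2 : (φ' a).natDegree = (c.hom p a).natDegree := by
      rw [hφ, natDegree_map _ (hne hdeg)]
      exact natDegree_map _ hdeg
    rw [h2, ← ncard_ker_eq (Ω := Ls) (g := c.hom p a) (by rw [hφ, coeff_map]; exact hne ha), ← h1,
      Set.ncard_image_of_injective T (f := fun x : integralPoints hφ j => c.pts Ls x.1)
        ((c.pts Ls).injective.comp Subtype.val_injective)]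
  have hinj : Set.InjOn (reduction hφ hj ρ) T := by
    intro x hx y hy hxy
    refine sub_eq_zero.1 (eq_zero_of_reduction_eq_zero hφ hj ρ haΩ ?_ ?_)
    · rw [smul_sub, show a • x = 0 from hx, show a • y = 0 from hy, sub_zero]
    · rw [map_sub, hxy, sub_self]
  -- Reduction is injective on the points killed by `a`, and the degree of `φ a` is preserved, so
  -- these points already exhaust the zeros of the reduced polynomial.
  have hTZ : reduction hφ hj ρ '' T = Z := by
    refine Set.eq_of_subset_of_ncard_le ?_ ?_ (finite_ker hφ'a)
    · rintro _ ⟨x, hx, rfl⟩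
      change ev (φ' a) _ = 0
      rw [hev, ← reduction_smul, show a • x = 0 from hx, map_zero]
    · rw [hinj.ncard_image, hTcard]
      exact ncard_ker_le hφ'a
  have haJ : φ' a ∈ leftIdeal φ' I := Submodule.subset_span (Set.mem_image_of_mem φ' haI)
  obtain ⟨G, hGJ, hG0, hG, -, -⟩ := exists_generator (leftIdeal φ' I) fun h => hφ'a (by
    rwa [h, Submodule.mem_bot] at haJ)
  obtain ⟨h, hh⟩ := hG _ haJ
  refine ⟨G, hGJ, hG0, ?_⟩
  -- `Ω` is not assumed separably closed: `G` has enough zeros there because it is a right factor of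
  -- a polynomial that does.
  have hGcard : {y : Ω | ev G y = 0}.ncard = p ^ G.natDegree := by
    refine ncard_ker_of_mul (h := h) ?_ hG0 ?_
    · rintro rfl
      exact hφ'a (by rw [hh, zero_mul])
    · rw [← hh, ← hTcard, ← hinj.ncard_image, hTZ]
  let TI : Set (integralPoints hφ j) := {x | ∀ b ∈ I, b • x = 0}
  have hTI : reduction hφ hj ρ '' TI = {y : Ω | ev G y = 0} := by
    refine Set.eq_of_subset_of_subset ?_ fun y hy => ?_
    · rintro _ ⟨x, hx, rfl⟩
      have hspan : ∀ P ∈ leftIdeal φ' I, ev P (reduction hφ hj ρ x) = 0 := by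
        intro P hP
        induction hP using Submodule.span_induction with
        | mem P hP =>
          obtain ⟨b, hb, rfl⟩ := hP
          rw [hev, ← reduction_smul, hx b hb, map_zero]
        | zero => exact ev_zero_left _
        | add P Q _ _ hP hQ => rw [ev_add, hP, hQ, add_zero]
        | smul P Q _ hQ => rw [smul_eq_mul, ev_mul, hQ, ev_zero_right]
      exact hspan G hGJ
    · have hzero (b : A) (hb : b ∈ I) : ev (φ' b) y = 0 := by
        obtain ⟨h', hh'⟩ := hG (φ' b) (Submodule.subset_span (Set.mem_image_of_mem φ' hb))
        rw [hh', ev_mul, show ev G y = 0 from hy, ev_zero_right]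
      obtain ⟨x, hx, rfl⟩ : y ∈ reduction hφ hj ρ '' T := hTZ ▸ hzero a haI
      refine ⟨x, fun b hb => eq_zero_of_reduction_eq_zero hφ hj ρ haΩ ?_ ?_, rfl⟩
      · rw [smul_comm, show a • x = 0 from hx, smul_zero]
      · rw [reduction_smul, ← hev, hzero b hb]
  rw [← hGcard, ← hTI, (hinj.mono (s₁ := TI) fun x hx => hx a haI).ncard_image,
    ← Set.ncard_image_of_injective _ (Subtype.val_injective (p := (· ∈ integralPoints hφ j))),
    ← Nat.card_coe_set_eq]
  refine Nat.card_congr (Equiv.subtypeEquivRight fun x => ?_)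
  rw [Submodule.mem_torsionBySet_iff]
  constructor
  · intro hx
    exact ⟨⟨x, hint x (hx ⟨a, haI⟩)⟩, fun b hb => Subtype.ext (hx ⟨b, hb⟩), rfl⟩
  · rintro ⟨x, hx, rfl⟩ b
    exact congrArg Subtype.val (hx b.1 b.2)

end Reduction

end Coordinate

end AModuleScheme

/-- Points of a field that are integral at a prime `𝔔` of a subring `B` can be reduced modulo
`𝔔`. -/
theorem exists_localReduction {O : Type*} {B S : Type u} [CommRing O] [CommRing B] [IsDomain B]
    [Algebra O B] [Field S] [Algebra O S] (v : B →ₐ[O] S) (hv : Function.Injective v)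
    (𝔔 : Ideal B) [𝔔.IsPrime] :
    ∃ (R : Type u) (_ : CommRing R) (_ : IsDomain R) (_ : Algebra O R) (j : R →ₐ[O] S)
      (Ω : Type u) (_ : Field Ω) (_ : Algebra O Ω) (ρ : R →ₐ[O] Ω), Function.Injective j ∧
      (∀ u, algebraMap O Ω u = 0 ↔ algebraMap O B u ∈ 𝔔) ∧
      (∀ x u, algebraMap O B u ∉ 𝔔 → u • x ∈ v.range → x ∈ j.range) ∧
      ∀ (n : ℕ) (σ : S →+* S) (τ : B → B), (∀ b, v (τ b) = σ (v b)) → (∀ b, τ b - b ^ n ∈ 𝔔) →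
        ∀ y y', j y' = σ (j y) → ρ y' = ρ y ^ n := by
  have hunit (y : 𝔔.primeCompl) : IsUnit (v y) := IsUnit.mk0 _ fun h => y.2 (by
    rw [(map_eq_zero_iff v hv).1 h]
    exact 𝔔.zero_mem)
  let j : Localization.AtPrime 𝔔 →ₐ[O] S := IsLocalization.liftAlgHom (M := 𝔔.primeCompl) hunit
  have hj (b : B) : j (algebraMap _ _ b) = v b := IsLocalization.lift_eq hunit b
  have hji : Function.Injective j := by
    refine (IsLocalization.lift_injective_iff _).2 fun x y => ?_
    rw [(IsLocalization.injective (Localization.AtPrime 𝔔)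
      𝔔.primeCompl_le_nonZeroDivisors).eq_iff]
    exact hv.eq_iff.symm
  let ρ : Localization.AtPrime 𝔔 →ₐ[O] 𝔔.ResidueField := IsScalarTower.toAlgHom _ _ _
  have hρ (b : B) : ρ (algebraMap _ _ b) = algebraMap _ 𝔔.ResidueField b :=
    (IsScalarTower.algebraMap_apply _ (Localization.AtPrime 𝔔) 𝔔.ResidueField b).symm
  refine ⟨Localization.AtPrime 𝔔, inferInstance, IsLocalization.isDomain_localization
    𝔔.primeCompl_le_nonZeroDivisors, inferInstance, j, 𝔔.ResidueField, inferInstance, inferInstance,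
    ρ, hji, fun u => ?_, ?_, ?_⟩
  · rw [IsScalarTower.algebraMap_apply _ B 𝔔.ResidueField, Ideal.algebraMap_residueField_eq_zero]
  · rintro x u hu ⟨b, hb⟩
    refine ⟨IsLocalization.mk' _ b (⟨_, hu⟩ : 𝔔.primeCompl), ?_⟩
    have h1 := congrArg j (IsLocalization.mk'_spec (Localization.AtPrime 𝔔) b
      (⟨_, hu⟩ : 𝔔.primeCompl))
    rw [map_mul, hj, hj] at h1
    refine mul_right_cancel₀ (hunit ⟨_, hu⟩).ne_zero (h1.trans (hb.trans ?_))
    rw [AlgHom.commutes, mul_comm, Algebra.smul_def]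
  · intro n σ τ hτ hτn y y' h
    obtain ⟨b, s, rfl⟩ := IsLocalization.exists_mk'_eq 𝔔.primeCompl y
    have hres (b : B) :
        algebraMap _ 𝔔.ResidueField (τ b) = algebraMap _ 𝔔.ResidueField b ^ n := by
      rw [← map_pow, ← sub_eq_zero, ← map_sub, Ideal.algebraMap_residueField_eq_zero]
      exact hτn b
    have h1 := IsLocalization.mk'_spec (Localization.AtPrime 𝔔) b s
    -- From `y * s = b` one gets `y' * τ s = τ b`, and `τ` is the `n`-th power in the residue field.
    -- Stability of the localization under `σ` is not needed, since `y'` is given.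
    have h2 : y' * algebraMap _ _ (τ s) = algebraMap _ _ (τ b) := by
      apply hji
      rw [map_mul, h, hj, hj, hτ, hτ, ← map_mul, ← hj s, ← map_mul, h1, hj]
    have h3 := congrArg ρ h2
    have h4 := congrArg ρ h1
    rw [map_mul, hρ, hρ] at h3 h4
    rw [hres, hres, ← h4, mul_pow] at h3
    refine mul_right_cancel₀ (pow_ne_zero n ?_) h3
    rw [ne_eq, Ideal.algebraMap_residueField_eq_zero]
    exact s.2

namespace TateModule

variable {A : Type w} [CommRing A] {ℓ : Ideal A} {π : A} {N : Type u} [AddCommGroup N] [Module A N]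
  {ι : Type*} [Fintype ι] {x : ι → TateModule ℓ π N}

theorem IsLevelBasis.exists_basis_torsionBySet (hx : IsLevelBasis x) (n : ℕ) :
    ∃ b : Module.Basis ι (A ⧸ ℓ ^ n) (Submodule.torsionBySet A N (ℓ ^ n : Ideal A)),
      ∀ i, (b i : N) = component n (x i) := by
  let z (i : ι) : Submodule.torsionBySet A N (ℓ ^ n : Ideal A) := (x i).1 n
  have hsum (c : ι → A) : ((∑ i, Ideal.Quotient.mk (ℓ ^ n) (c i) • z i :
      Submodule.torsionBySet A N (ℓ ^ n : Ideal A)) : N) = ∑ i, c i • component n (x i) := by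
    rw [AddSubmonoidClass.coe_finsetSum]
    rfl
  have hli : LinearIndependent (A ⧸ ℓ ^ n) z := by
    rw [Fintype.linearIndependent_iff]
    intro c hc i
    choose a ha using fun i => Ideal.Quotient.mk_surjective (c i)
    have h := hsum a
    simp only [ha] at h
    rw [hc] at h
    rw [← ha, Ideal.Quotient.eq_zero_iff_mem]
    exact hx.mem_of_sum_eq_zero n a h.symm i
  have hsp : ⊤ ≤ Submodule.span (A ⧸ ℓ ^ n) (Set.range z) := by
    rintro y -
    obtain ⟨c, hc⟩ := hx.exists_eq_sum n y y.2
    rw [show y = ∑ i, Ideal.Quotient.mk (ℓ ^ n) (c i) • z i from Subtype.ext (hc.trans (hsum c).symm)]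
    exact Submodule.sum_mem _ fun i _ => Submodule.smul_mem _ _ (Submodule.subset_span ⟨i, rfl⟩)
  exact ⟨Module.Basis.mk hli hsp, fun i => by rw [Module.Basis.mk_apply]; rfl⟩

/-- The determinant on the Tate module is given modulo `ℓ ^ n` by the determinant on the
`ℓ ^ n`-torsion. -/
theorem evalₐ_det_map_eq_det [DecidableEq ι] (hx : IsLevelBasis x) (f : N →ₗ[A] N) (n : ℕ)
    (F : Submodule.torsionBySet A N (ℓ ^ n : Ideal A) →ₗ[A ⧸ ℓ ^ n]
      Submodule.torsionBySet A N (ℓ ^ n : Ideal A)) (hF : ∀ y, (F y : N) = f y) :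
    AdicCompletion.evalₐ ℓ n (LinearMap.det (TateModule.map ℓ π f)) = LinearMap.det F := by
  obtain ⟨b, hb⟩ := hx.exists_basis_torsionBySet n
  choose Q hQ using fun j => hx.exists_eq_sum n (F (b j)) (F (b j)).2
  rw [evalₐ_det_map hx f n (Matrix.of fun i j => Q j i), ← LinearMap.det_toMatrix b,
    RingHom.map_det]
  · congr 1
    ext i j
    rw [LinearMap.toMatrix_apply]
    have h : F (b j) = ∑ i, Ideal.Quotient.mk (ℓ ^ n) (Q j i) • b i := Subtype.ext (by
      rw [hQ j, AddSubmonoidClass.coe_finsetSum]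
      exact Finset.sum_congr rfl fun i _ => by rw [torsion_mk_smul, hb])
    rw [h, b.repr_sum_self]
    rfl
  · intro j
    rw [← hb, ← hF, hQ]
    rfl

end TateModule

/-! ### The Galois action on torsion at primes of good reduction. -/

namespace AModuleScheme

open TwistedPoly

namespace Coordinate

section Galois

variable {p : ℕ} [Fact p.Prime] {A : Type w} [CommRing A] {L : Type u} [Field L] [CharP L p]
  {E : AModuleScheme A L} {c : E.Coordinate} {O : Type*} [CommRing O] [CharP O p] [Algebra O L]
  {φ : A →+* TwistedPoly p O} (hφ : ∀ a, c.hom p a = TwistedPoly.map (algebraMap O L) (φ a))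
  {Ls : Type u} [Field Ls] [Algebra L Ls] [Algebra O Ls] [IsScalarTower O L Ls]
  {R : Type*} [CommRing R] [Algebra O R] {j : R →ₐ[O] Ls} (hj : Function.Injective j)
  {Ω : Type*} [Field Ω] [Algebra O Ω] (ρ : R →ₐ[O] Ω) {t : A} (ht : 0 < (φ t).natDegree)
  {𝔓 : Ideal O} [𝔓.IsPrime] (ht𝔓 : (φ t).leadingCoeff ∉ 𝔓)

section Integral

variable [IsDomain O] [IsDedekindDomain A] [Algebra (ZMod p) A] [Algebra.FiniteType (ZMod p) A]

-- Some multiple `e * a` is a monic polynomial in `t`. The leading coefficient of its image is a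
-- power of that of `φ t`, and it is divisible by a power with positive exponent of that of `φ a`.
include ht ht𝔓 in
theorem leadingCoeff_notMem {a : A} (ha : a ≠ 0) : (φ a).leadingCoeff ∉ 𝔓 := by
  obtain ⟨f, hf, e, he⟩ := exists_monic_aeval_mem_span (p := p) t ha
  obtain ⟨N, hN⟩ := leadingCoeff_aeval φ ht hf
  rw [he, mul_comm, map_mul, leadingCoeff_mul] at hN
  intro h
  refine ht𝔓 (Ideal.IsPrime.mem_of_pow_mem ‹_› N ?_)
  rw [← hN]
  exact Ideal.mul_mem_left _ _ (Ideal.pow_mem_of_mem _ h _ (pow_pos (Fact.out : p.Prime).pos _))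

-- The point is killed by a monic polynomial in `t`, whose image under `φ` has as leading
-- coefficient a power of that of `φ t`. This power is outside `𝔓`, and its product with the
-- coordinate is integral.
include ht ht𝔓 in
theorem mem_integralPoints (hrange : ∀ x u, u ∉ 𝔓 → IsIntegral O (u • x) → x ∈ j.range) {a : A}
    (ha : a ≠ 0) {x : E.Pts Ls} (hx : a • x = 0) : x ∈ integralPoints hφ j := by
  obtain ⟨f, hf, e, he⟩ := exists_monic_aeval_mem_span (p := p) t ha
  obtain ⟨N, hN⟩ := leadingCoeff_aeval φ ht hf
  have h1 : Polynomial.aeval t f • x = 0 := by rw [he, mul_comm, mul_smul, hx, smul_zero]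
  have h2 : Polynomial.aeval (c.pts Ls x) (φ (Polynomial.aeval t f)).toPoly = 0 := by
    rw [← ev_eq_aeval, ← pts_smul_integral hφ, h1, map_zero]
  have h3 := isIntegral_leadingCoeff_smul _ _ h2
  rw [leadingCoeff_toPoly, hN] at h3
  exact hrange _ _ (fun h => ht𝔓 (Ideal.IsPrime.mem_of_pow_mem ‹_› N h)) h3

end Integral

theorem exists_mem_pow [Algebra A O] {m : ℕ} (hφ0 : ∀ a, (φ a).coeff 0 = algebraMap A O a ^ m)
    {ℓ : Ideal A} (hℓ : ℓ.IsMaximal) (hℓ𝔓 : ℓ ≠ 𝔓.under A) (n : ℕ) :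
    ∃ a ∈ ℓ ^ n, a ≠ 0 ∧ (φ a).coeff 0 ∉ 𝔓 := by
  have hP : (𝔓.under A).IsPrime := Ideal.IsPrime.under A 𝔓
  have h1 : ¬ ℓ ^ n ≤ 𝔓.under A := fun h =>
    hℓ𝔓 (hℓ.eq_of_le hP.ne_top (hP.le_of_pow_le h))
  obtain ⟨a, ha, ha'⟩ := SetLike.not_le_iff_exists.1 h1
  refine ⟨a, ha, fun h => ha' (h ▸ zero_mem _), fun h => ha' ?_⟩
  rw [hφ0] at h
  exact Ideal.IsPrime.mem_of_pow_mem (I := 𝔓) ‹_› _ h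

theorem reduction_galois {σ : Ls ≃ₐ[L] Ls} {n : ℕ}
    (hpow : ∀ y y', j y' = σ (j y) → ρ y' = ρ y ^ n) {x x' : integralPoints hφ j}
    (h : x'.1 = E.ptsMap (σ : Ls →ₐ[L] Ls) x.1) :
    reduction hφ hj ρ x' = reduction hφ hj ρ x ^ n := by
  obtain ⟨y, hy⟩ := exists_eq_pts hφ x
  obtain ⟨y', hy'⟩ := exists_eq_pts hφ x'
  rw [reduction_eq hφ _ _ hy, reduction_eq hφ _ _ hy']
  refine hpow _ _ ?_
  rw [hy', hy, h, c.pts_map]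
  rfl

end Galois

end Coordinate

end AModuleScheme

namespace AModuleScheme

open TwistedPoly

namespace Coordinate

section Determinant

variable {p : ℕ} [Fact p.Prime] {A : Type w} [CommRing A] [IsDedekindDomain A]
  [Algebra (ZMod p) A] [Algebra.FiniteType (ZMod p) A] {L : Type u} [Field L] [CharP L p]
  {E : AModuleScheme A L} {c : E.Coordinate} {O : Type*} [CommRing O] [IsDomain O] [CharP O p]
  [Algebra O L] {φ : A →+* TwistedPoly p O}
  (hφ : ∀ a, c.hom p a = TwistedPoly.map (algebraMap O L) (φ a))
  {Ls : Type u} [Field Ls] [Algebra L Ls] [Algebra O Ls] [IsScalarTower O L Ls]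
  [Algebra A O] {m : ℕ} (hφ0 : ∀ a, (φ a).coeff 0 = algebraMap A O a ^ m)
  {t : A} (ht : 0 < (φ t).natDegree) {𝔓 : Ideal O}

include ht hφ hφ0 in
/-- The torsion points of order prime to the residue characteristic are unramified. -/
theorem ptsMap_eq_self [𝔓.IsPrime] (ht𝔓 : (φ t).leadingCoeff ∉ 𝔓)
    {R : Type*} [CommRing R] [IsDomain R] [Algebra O R] {j : R →ₐ[O] Ls}
    (hj : Function.Injective j) {Ω : Type*} [Field Ω] [Algebra O Ω] (ρ : R →ₐ[O] Ω)
    (hΩ : ∀ u, algebraMap O Ω u = 0 ↔ u ∈ 𝔓)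
    (hrange : ∀ x u, u ∉ 𝔓 → IsIntegral O (u • x) → x ∈ j.range) {σ : Ls ≃ₐ[L] Ls}
    (hσ : ∀ y y', j y' = σ (j y) → ρ y' = ρ y) {ℓ : Ideal A} (hℓ : ℓ.IsMaximal)
    (hℓ𝔓 : ℓ ≠ 𝔓.under A) {n : ℕ} {x : E.Pts Ls}
    (hx : x ∈ Submodule.torsionBySet A (E.Pts Ls) (ℓ ^ n : Ideal A)) :
    E.ptsMap (σ : Ls →ₐ[L] Ls) x = x := by
  obtain ⟨a, haℓ, ha0, ha𝔓⟩ := exists_mem_pow hφ0 hℓ hℓ𝔓 n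
  have hax : a • x = 0 := (Submodule.mem_torsionBySet_iff _ _).1 hx ⟨a, haℓ⟩
  have hσx : a • E.ptsMap (σ : Ls →ₐ[L] Ls) x = 0 := by rw [← map_smul, hax, map_zero]
  let y : integralPoints hφ j := ⟨x, mem_integralPoints hφ ht ht𝔓 hrange ha0 hax⟩
  let y' : integralPoints hφ j := ⟨_, mem_integralPoints hφ ht ht𝔓 hrange ha0 hσx⟩
  have h : reduction hφ hj ρ y' = reduction hφ hj ρ y ^ 1 :=
    reduction_galois hφ hj ρ (σ := σ) (fun y y' h => by rw [pow_one, hσ y y' h]) rfl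
  -- The difference is killed by `a` and reduces to zero, and the linear coefficient of `φ a` is a
  -- unit at `𝔓`.
  have h1 : y' - y = 0 := by
    refine eq_zero_of_reduction_eq_zero hφ hj ρ (a := a) (by rwa [ne_eq, hΩ]) ?_ ?_
    · exact Subtype.ext (by
        change a • (E.ptsMap (σ : Ls →ₐ[L] Ls) x - x) = 0
        rw [smul_sub, hσx, hax, sub_zero])
    · rw [map_sub, h, pow_one, sub_self]
  exact congrArg Subtype.val (sub_eq_zero.1 h1)

include hφ hφ0 ht in
/-- The determinants of Frobenius on the Tate modules are given by one element of `A`. -/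
theorem exists_det_galTate_eq [Algebra (ZMod p) L] {r : ℕ} (hE : E.IsDrinfeld p r) {δ : A →+* L}
    (hδ : E.ActsOnLieThrough δ) (hδi : Function.Injective δ) [IsSepClosed Ls]
    (hOL : Function.Injective (algebraMap O L)) (h𝔓 : 𝔓.IsMaximal) [Finite (O ⧸ 𝔓)]
    (ht𝔓 : (φ t).leadingCoeff ∉ 𝔓) :
    ∃ s : A, ∀ ℓ : Ideal A, ℓ.IsMaximal → ℓ ≠ 𝔓.under A → ∀ π ∈ ℓ, π ∉ ℓ ^ 2 →
      ∀ (R : Type u) [CommRing R] [IsDomain R] [Algebra O R] (j : R →ₐ[O] Ls)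
        (Ω : Type u) [Field Ω] [Algebra O Ω] (ρ : R →ₐ[O] Ω), Function.Injective j →
        (∀ u, algebraMap O Ω u = 0 ↔ u ∈ 𝔓) →
        (∀ x u, u ∉ 𝔓 → IsIntegral O (u • x) → x ∈ j.range) →
        ∀ σ : Ls ≃ₐ[L] Ls, (∀ y y', j y' = σ (j y) → ρ y' = ρ y ^ Nat.card (O ⧸ 𝔓)) →
          LinearMap.det (E.galTate Ls ℓ π σ) = algebraMap A (AdicCompletion ℓ A) s := by
  let _ : Field (O ⧸ 𝔓) := Ideal.Quotient.field 𝔓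
  have : CharP (O ⧸ 𝔓) p := by
    let _ : Algebra (ZMod p) O := ZMod.algebra O p
    exact charP_of_injective_algebraMap (algebraMap (ZMod p) (O ⧸ 𝔓)).injective p
  have hk (u : O) : algebraMap O (O ⧸ 𝔓) u ≠ 0 ↔ u ∉ 𝔓 := Ideal.Quotient.eq_zero_iff_mem.not
  let φ' := (TwistedPoly.map (p := p) (algebraMap O (O ⧸ 𝔓))).comp φ
  have hφ'i : Function.Injective φ' := by
    -- Reduction modulo `𝔓` keeps the leading coefficient of `φ a` nonzero for `a ≠ 0`.
    rw [injective_iff_map_eq_zero]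
    intro a ha
    by_contra h0
    refine (hk _).2 (leadingCoeff_notMem ht ht𝔓 h0) ?_
    rw [← coeff_natDegree, ← coeff_map]
    exact congrArg (fun P => P.coeff (φ a).natDegree) ha
  have ht' : 0 < (φ' t).natDegree := by
    rwa [RingHom.comp_apply, natDegree_map _ ((hk _).2 ht𝔓)]
  obtain ⟨s, hs⟩ := TwistedPoly.exists_det_frobenius_eq φ' hφ'i ht' r
  refine ⟨s, fun ℓ hℓ hℓ𝔓 π hπ hπ2 R _ _ _ j Ω _ _ ρ hj hΩ hrange σ hσ => ?_⟩
  have hℓ0 : ℓ ≠ ⊥ := by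
    rintro rfl
    simp_all
  let _ : Algebra (O ⧸ 𝔓) Ω :=
    (Ideal.Quotient.lift 𝔓 (algebraMap O Ω) fun u hu => (hΩ u).2 hu).toAlgebra
  have : IsScalarTower O (O ⧸ 𝔓) Ω := IsScalarTower.of_algebraMap_eq fun u => rfl
  obtain ⟨x, hx⟩ := c.exists_isLevelBasis hE Ls hδ hδi hℓ hπ hπ2
  -- The identity is checked modulo each `ℓ ^ n`, where it concerns the finite module of `ℓ ^
  -- n`-torsion points, embedded in the residue field `Ω` by reduction.
  refine AdicCompletion.ext_evalₐ fun n => ?_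
  obtain ⟨a, haℓ, ha0, ha𝔓⟩ := exists_mem_pow hφ0 hℓ hℓ𝔓 n
  have hint (y : E.Pts Ls) (hy : a • y = 0) : y ∈ integralPoints hφ j :=
    mem_integralPoints hφ ht ht𝔓 hrange ha0 hy
  have htor {y : E.Pts Ls} (hy : y ∈ Submodule.torsionBySet A (E.Pts Ls) (ℓ ^ n : Ideal A)) :
      a • y = 0 := (Submodule.mem_torsionBySet_iff _ _).1 hy ⟨a, haℓ⟩
  obtain ⟨G, hG, hG0, hGc⟩ := natCard_torsionBySet_eq hφ hj ρ hOL (k := O ⧸ 𝔓) haℓ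
    ((hk _).2 ha𝔓) ((hk _).2 (leadingCoeff_notMem ht ht𝔓 ha0)) hint
  let W := Submodule.torsionBySet A (E.Pts Ls) (ℓ ^ n : Ideal A)
  let i : W →+ integralPoints hφ j :=
    { toFun := fun y => ⟨y, hint _ (htor y.2)⟩
      map_zero' := rfl
      map_add' := fun _ _ => rfl }
  let F : W →ₗ[A ⧸ ℓ ^ n] W :=
    { toFun := fun y => ⟨E.ptsMap (σ : Ls →ₐ[L] Ls) y, (Submodule.mem_torsionBySet_iff _ _).2
        fun b => by rw [← map_smul, (Submodule.mem_torsionBySet_iff _ _).1 y.2 b, map_zero]⟩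
      map_add' := fun _ _ => Subtype.ext (map_add _ _ _)
      map_smul' := fun b y => by
        obtain ⟨b, rfl⟩ := Ideal.Quotient.mk_surjective b
        exact Subtype.ext (map_smul (E.ptsMap (σ : Ls →ₐ[L] Ls)) b y.1) }
  obtain ⟨b, -⟩ := hx.exists_basis_torsionBySet n
  refine (TateModule.evalₐ_det_map_eq_det hx _ n F fun _ => rfl).trans ?_
  refine (hs ℓ hℓ hℓ0 n Ω W b ((reduction hφ hj ρ).comp i) ?_ ?_ G hG hG0 hGc F ?_).trans ?_
  · rw [injective_iff_map_eq_zero]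
    intro y hy
    have h := eq_zero_of_reduction_eq_zero hφ hj ρ (a := a) (x := i y) (by rwa [ne_eq, hΩ])
      (Subtype.ext (htor y.2)) hy
    exact Subtype.ext (congrArg (fun z => z.1) h)
  · intro b y
    refine (reduction_smul hφ hj ρ b (i y)).trans (ev_map_algebraMap _ _).symm
  · intro y
    exact reduction_galois hφ hj ρ hσ rfl
  · exact (AlgHom.commutes (AdicCompletion.evalₐ ℓ n) s).symm

end Determinant

end Coordinate

end AModuleScheme

end

/-! ### Drinfeld modules are elementary. -/

namespace AModuleScheme

open TwistedPoly

/-- A nonzero nonunit `t` has more than one torsion point, whereas a nonzero twisted polynomial of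
degree `0` has only one zero. -/
theorem Coordinate.exists_pos_natDegree {p : ℕ} [Fact p.Prime] {A : Type w} [CommRing A]
    [IsDedekindDomain A] (hA : ¬ IsField A) [Algebra (ZMod p) A] [Algebra.FiniteType (ZMod p) A]
    {L : Type u} [Field L] [Algebra (ZMod p) L] [CharP L p] {E : AModuleScheme A L} {r : ℕ}
    (c : E.Coordinate) (hE : E.IsDrinfeld p r) (Ls : Type u) [Field Ls] [Algebra L Ls]
    [IsSepClosed Ls] {δ : A →+* L} (hδ : E.ActsOnLieThrough δ) (hδi : Function.Injective δ) :
    ∃ t, 0 < (c.hom p t).natDegree := by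
  obtain ⟨t, ht0, htu⟩ := Ring.exists_not_isUnit_of_not_isField hA
  refine ⟨t, Nat.pos_of_ne_zero fun h0 => ?_⟩
  have hI : Ideal.span {t} ≠ ⊥ := by rwa [ne_eq, Ideal.span_singleton_eq_bot]
  have h1 := c.natCard_torsionBySet hE Ls hδ hδi hI
  have := finite_zmod_quotient p hI
  have : Finite (A ⧸ Ideal.span {t}) := Module.finite_of_finite (ZMod p)
  have : Nontrivial (A ⧸ Ideal.span {t}) := Ideal.Quotient.nontrivial_iff.2 (by
    rwa [ne_eq, Ideal.span_singleton_eq_top])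
  have h2 : 1 < Nat.card (A ⧸ Ideal.span {t}) ^ r :=
    Nat.one_lt_pow (Nat.one_le_iff_ne_zero.1 hE.one_le) Finite.one_lt_card
  have h3 : c.hom p t ≠ 0 := by
    intro h
    have h4 := c.coeff_zero_hom p hδ t
    rw [h, coeff_zero] at h4
    exact ht0 ((map_eq_zero_iff δ hδi).1 h4.symm)
  have h5 := ncard_ker_le (Ω := Ls) h3
  rw [h0, pow_zero] at h5
  rw [← h1, Nat.card_congr ((c.pts Ls).toEquiv.subtypeEquiv (q := fun y => ev (c.hom p t) y = 0)
    fun x => ?_)] at h2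
  · exact (h2.trans_le ((Nat.card_coe_set_eq _).trans_le h5)).false
  · rw [Submodule.torsionBySet_span_singleton_eq, Submodule.mem_torsionBy_iff,
      ← (c.pts Ls).map_eq_zero_iff, c.pts_smul p]
    rfl

theorem IsDrinfeld.isElementaryTwo {p : ℕ} [Fact p.Prime] {A : Type w} [CommRing A]
    [IsDedekindDomain A] (hA : ¬ IsField A) [Algebra (ZMod p) A] [Algebra.FiniteType (ZMod p) A]
    (K : Type*) [Field K] [Algebra A K] [IsFractionRing A K] {L : Type u} [Field L] [Algebra K L]
    [FiniteDimensional K L] [Algebra A L] [IsScalarTower A K L] [Algebra (ZMod p) L] [CharP L p]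
    (Ls : Type u) [Field Ls] [Algebra L Ls] [IsSepClosed Ls] {r : ℕ} {E : AModuleScheme A L}
    (hE : E.IsDrinfeld p r) {δ : A →+* L} (hδ : E.IsCharacteristicMorphism δ) {m : ℕ}
    (hδm : ∀ a, δ a = algebraMap A L a ^ p ^ m) : E.IsElementaryTwo Ls r := by
  have hAL : Function.Injective (algebraMap A L) := by
    rw [IsScalarTower.algebraMap_eq A K L]
    exact (algebraMap K L).injective.comp (IsFractionRing.injective A K)
  have hδi : Function.Injective δ := by
    rw [injective_iff_map_eq_zero]
    intro a ha
    rw [hδm] at ha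
    exact (map_eq_zero_iff _ hAL).1 (eq_zero_of_pow_eq_zero ha)
  have hOL : Function.Injective (algebraMap (integralClosure A L) L) := Subtype.val_injective
  have : CharP (integralClosure A L) p := (algebraMap (integralClosure A L) L).charP hOL p
  refine ⟨hE.isPreElementary Ls hδ hδi, ?_⟩
  obtain ⟨c₀⟩ := hE.additive.exists_coordinate
  obtain ⟨c, φ, hφ⟩ := c₀.exists_integral (p := p) K hδ.1 fun a => by
    rw [hδm]
    exact (isIntegral_algebraMap).pow _
  have hφ0 (a : A) : (φ a).coeff 0 = algebraMap A (integralClosure A L) a ^ p ^ m := hOL (by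
    rw [← coeff_map, ← hφ, c.coeff_zero_hom p hδ.1, hδm, map_pow]
    rfl)
  obtain ⟨t, ht⟩ := c.exists_pos_natDegree hA hE Ls hδ.1 hδi
  have ht0 : φ t ≠ 0 := fun h => by
    rw [hφ, h, map_zero] at ht
    exact lt_irrefl _ ht
  have hlc : (φ t).leadingCoeff ≠ 0 := by rwa [ne_eq, leadingCoeff_eq_zero]
  rw [hφ, natDegree_map _ ((map_ne_zero_iff _ hOL).2 hlc)] at ht
  -- The single leading coefficient of `φ t` controls the leading coefficients of all `φ a`, so
  -- these are the only primes to exclude.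
  refine ⟨{𝔓 | 𝔓.IsMaximal ∧ (φ t).leadingCoeff ∈ 𝔓}, finite_setOf_isMaximal_mem K hlc,
    fun 𝔓 h => h.1, fun 𝔓 h𝔓 hS => ?_⟩
  have ht𝔓 : (φ t).leadingCoeff ∉ 𝔓 := fun h => hS ⟨h𝔓, h⟩
  have hprime : 𝔓.IsPrime := h𝔓.isPrime
  constructor
  · intro ℓ hℓ hℓ𝔓 π _ _ 𝔔 _ _ σ hσ
    obtain ⟨R, _, _, _, j, Ω, _, _, ρ, hj, hΩ, hrange, hpow⟩ := exists_localReduction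
      (integralClosure (integralClosure A L) Ls).val Subtype.val_injective 𝔔
    simp only [← Ideal.mem_of_liesOver 𝔔 𝔓] at hΩ hrange
    refine LinearMap.ext fun x => TateModule.ext_component fun n => ?_
    exact Coordinate.ptsMap_eq_self hφ hφ0 ht ht𝔓 hj ρ hΩ
      (fun x u hu hx => hrange x u hu ⟨⟨_, hx⟩, rfl⟩) (σ := σ)
      (fun y y' h => by
        have := hpow 1 (σ : Ls →+* Ls) (galIntegers A σ) (fun b => rfl)
          (fun b => by rw [pow_one]; exact hσ b) y y' h
        rwa [pow_one] at this) hℓ hℓ𝔓 (x.1 n).2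
  · rcases finite_or_infinite (integralClosure A L ⧸ 𝔓) with hfin | hinf
    · obtain ⟨s, hs⟩ := Coordinate.exists_det_galTate_eq (Ls := Ls) hφ hφ0 ht hE hδ.1 hδi hOL h𝔓 ht𝔓
      refine ⟨s, fun ℓ hℓ hℓ𝔓 π hπ hπ2 𝔔 _ _ σ hσ => ?_⟩
      obtain ⟨R, _, _, _, j, Ω, _, _, ρ, hj, hΩ, hrange, hpow⟩ := exists_localReduction
        (integralClosure (integralClosure A L) Ls).val Subtype.val_injective 𝔔
      simp only [← Ideal.mem_of_liesOver 𝔔 𝔓] at hΩ hrange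
      refine hs ℓ hℓ hℓ𝔓 π hπ hπ2 R j Ω ρ hj hΩ (fun x u hu hx => hrange x u hu ⟨⟨_, hx⟩, rfl⟩) σ ?_
      refine hpow _ (σ : Ls →+* Ls) (galIntegers A σ) (fun b => rfl) fun b => ?_
      rw [Ideal.over_def 𝔔 𝔓]
      exact hσ b
    -- For an infinite residue field `Nat.card` is `0`, and the Frobenius condition at `0` reads `0
    -- - 0 ^ 0 = -1 ∈ 𝔔`. There is thus no Frobenius element, and finiteness of the residue field
    -- need not be proved.
    · refine ⟨0, fun ℓ hℓ hℓ𝔓 π hπ hπ2 𝔔 h𝔔 _ σ hσ => (h𝔔.ne_top ?_).elim⟩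
      have h := hσ 0
      rw [← Ideal.over_def 𝔔 𝔓, Nat.card_eq_zero_of_infinite, map_zero, pow_zero, zero_sub,
        neg_mem_iff] at h
      exact (Ideal.eq_top_iff_one _).2 h

end AModuleScheme

theorem mainTheorem4
    {p : ℕ} [Fact p.Prime]
    {A : Type w} [CommRing A] [IsDedekindDomain A] (hA : ¬ IsField A)
    [Algebra (ZMod p) A] [Algebra.FiniteType (ZMod p) A]
    {K : Type*} [Field K] [Algebra A K] [IsFractionRing A K]
    {L : Type u} [Field L] [Algebra K L] [FiniteDimensional K L]
    [Algebra A L] [IsScalarTower A K L] [Algebra (ZMod p) L]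
    (Ls : Type u) [Field Ls] [Algebra L Ls] [IsSepClosure L Ls]
    (r : ℕ) (E : AModuleScheme A L) (hE : E.IsDrinfeld p r) :
    (E.IsGeneric → E.IsElementaryOne Ls r ∧ E.IsElementaryTwo Ls r) ∧
    (∀ (δ : A →+* L) (k : ℕ), E.IsCharacteristicMorphism δ →
      (∀ a : A, δ a = algebraMap A L a ^ p ^ k) → E.IsElementaryTwo Ls r) := by
  have : CharP L p := charP_of_injective_algebraMap (algebraMap (ZMod p) L).injective p
  have : IsSepClosed Ls := IsSepClosure.sep_closed L
  refine ⟨fun h => ?_, fun δ k hδ hδk => hE.isElementaryTwo hA K Ls hδ hδk⟩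
  have hAL : Function.Injective (algebraMap A L) := by
    rw [IsScalarTower.algebraMap_eq A K L]
    exact (algebraMap K L).injective.comp (IsFractionRing.injective A K)
  exact ⟨⟨hE.isPreElementary Ls h hAL, h⟩,
    -- The generic case is the exponent `p ^ 0 = 1`.
    hE.isElementaryTwo hA K Ls h (m := 0) fun a => by rw [pow_zero, pow_one]⟩
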